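/- Let $\mathcal O$ be a cyclic operad in vector spaces over a field $k$. For a finite set $S$ let $\mathcal O((S))$ be the space of operations whose legs (inputs and root) are labelled by $S$. *Graph complex.* Graphs are finite, with loops, multiple edges and several components allowed, and all vertices have valence at least $3$; $H(v)$ is the set of half-edges at the vertex $v$. An orientation of a graph is an ordering of its vertices and a direction of each edge, where transposing two vertices or reversing one edge gives the opposite orientation. Let $\mathcal G^{\mathcal O}$ be the vector space spanned by oriented graphs $G$ (up to isomorphism) with a label $o_v\in\mathcal O((H(v)))$ at each vertex $v$, modulo $(G,or)=-(G,-or)$ and multilinearity in the labels. It is graded by the number $|G|$ of vertices. The disjoint union $G_1\cdots G_n$ is oriented by concatenating the orderings of the vertices. For an edge $e$ of $G$, put $G_e=0$ if $e$ is a loop; otherwise $G_e$ is obtained by contracting $e$ and composing the labels of its ends along $e$, oriented as follows: if $e$ is directed from the first vertex to the second, then the new vertex becomes the first one, and the other vertices keep their order. *Fusion.* Let $n\ge 1$. Let $e_1,\dots,e_n$ be distinct edges of a graph $G$, with a direction from $s_i$ to $t_i$ chosen on each $e_i$ ($s_i$, $t_i$ being half-edges). Let $G\langle e_1,\dots,e_n\rangle$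 be the graph obtained by gluing every other side of an oriented $2n$-gon to $e_1,\dots,e_n$ in this cyclic order, compatibly with the directions, and deleting the $e_i$. So it has the same vertices, half-edges and labels, and the $e_i$ are replaced by the $n$ new edges $f_i=\{t_i,s_{i+1}\}$ (indices mod $n$). If the orientation of $G$ is represented so that each $e_i$ is directed from $s_i$ to $t_i$, then $f_i$ is directed from $s_{i+1}$ to $t_i$, and the rest of the orientation is unchanged. For graphs $G_1,\dots,G_n$ define $$\phi_n(G_1\odot\cdots\odot G_n)=\sum (G_1\cdots G_n)\langle e_1,\dots,e_n\rangle_{f_1}\in\mathcal G^{\mathcal O},$$ the sum being over all $n$-tuples $(e_1,\dots,e_n)$ of directed edges of $G_1\cdots G_n$ that lie in pairwise different $G_i$. Let $S\mathcal G^{\mathcal O}$ be the graded symmetric algebra of $\mathcal G^{\mathcal O}$, with product $\odot$ and $x\odot y=(-1)^{|x||y|}y\odot x$ for homogeneous $x,y$. **Theorem.** For every $n\ge1$ there is exactly one linear map $\phi_n\colon S\mathcal G^{\mathcal O}\to S\mathcal G^{\mathcal O}$ such that, for all $m\ge0$ and all labelled oriented graphs $G_1,\dots,G_m$, $$\phi_n(G_1\odot\cdots\odot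 G_m)=\sum_{I\sqcup J=\{1,\dots,m\},\ |I|=n}\epsilon(I,J)\,\phi_n(G_I)\odot G_J ,$$ where $G_I$ and $G_J$ are the products in increasing order of the index and $\epsilon(I,J)=\pm1$ is the sign with $G_1\odot\cdots\odot G_m=\epsilon(I,J)\,G_I\odot G_J$ given by the sign rule (the extension of $\phi_n$ as a coderivation). These maps satisfy a) $\phi_i^2=0$ for all $i\ge1$; b) $\phi_i\phi_j+\phi_j\phi_i=0$ for all $i,j\ge1$ with $i\ne j$. -/

import Mathlib

universe u v

noncomputable section

open scoped Classical

namespace Fusion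

/-! ### Cyclic operads -/

/-- `Option A ⊕ B ≃ Option (A ⊕ B)`, keeping the distinguished point. -/
def optionSum (A B : Type) : Option A ⊕ B ≃ Option (A ⊕ B) where
  toFun
    | .inl none => none
    | .inl (some a) => some (.inl a)
    | .inr b => some (.inr b)
  invFun
    | none => .inl none
    | some (.inl a) => .inl (some a)
    | some (.inr b) => .inr b
  left_inv := by rintro ((_ | a) | b) <;> rfl
  right_inv := by rintro (_ | (a | b)) <;> rfl

/-- Exchange of the two distinguished points of `Option (Option A)`. -/
def optionSwap (A : Type) : Option (Option A) ≃ Option (Option A) where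
  toFun
    | none => some none
    | some none => none
    | some (some a) => some (some a)
  invFun
    | none => some none
    | some none => none
    | some (some a) => some (some a)
  left_inv := by rintro (_ | (_ | a)) <;> rfl
  right_inv := by rintro (_ | (_ | a)) <;> rfl

/-- Exchange of the last two summands. -/
def sumRightComm (A B C : Type) : (A ⊕ B) ⊕ C ≃ (A ⊕ C) ⊕ B :=
  (Equiv.sumAssoc A B C).trans
    (((Equiv.refl A).sumCongr (Equiv.sumComm B C)).trans (Equiv.sumAssoc A C B).symm)

/-- A cyclic operad in `k`-vector spaces, in coordinate-free form.  `obj S` is the space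
`𝒪((S))` of operations whose legs (inputs and root together) are labelled by the finite set `S`;
so `𝒪(n) = obj (Fin (n + 1))`, with `S_{n+1}` acting through `map`.  `comp p q` composes `p` and
`q` along the leg `none` of `p` and the leg `none` of `q`.  No unit is required, so
that operads with and without unit are both covered. -/
structure CyclicOperad (k : Type u) [Field k] where
  obj : (S : Type) → [Finite S] → Type v
  [addCommGroup : ∀ (S : Type) [Finite S], AddCommGroup (obj S)]
  [module : ∀ (S : Type) [Finite S], Module k (obj S)]
  map : ∀ {S T : Type} [Finite S] [Finite T], S ≃ T → obj S →ₗ[k] obj T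
  map_refl : ∀ {S : Type} [Finite S] (p : obj S), map (Equiv.refl S) p = p
  map_trans : ∀ {S T U : Type} [Finite S] [Finite T] [Finite U] (e : S ≃ T) (f : T ≃ U)
    (p : obj S), map (e.trans f) p = map f (map e p)
  comp : ∀ {A B : Type} [Finite A] [Finite B],
    obj (Option A) →ₗ[k] obj (Option B) →ₗ[k] obj (A ⊕ B)
  comp_map : ∀ {A A' B B' : Type} [Finite A] [Finite A'] [Finite B] [Finite B']
    (e : A ≃ A') (f : B ≃ B') (p : obj (Option A)) (q : obj (Option B)),
    comp (map e.optionCongr p) (map f.optionCongr q) = map (e.sumCongr f) (comp p q)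
  comp_comm : ∀ {A B : Type} [Finite A] [Finite B] (p : obj (Option A)) (q : obj (Option B)),
    comp q p = map (Equiv.sumComm A B) (comp p q)
  /-- Composing `p` with `q` along one leg and with `r` along another one can be done in either
  order. -/
  comp_assoc : ∀ {A B C : Type} [Finite A] [Finite B] [Finite C] (p : obj (Option (Option A)))
    (q : obj (Option B)) (r : obj (Option C)),
    comp (map (optionSum A C) (comp (map (optionSwap A) p) r)) q =
      map (sumRightComm A B C) (comp (map (optionSum A B) (comp p q)) r)

attribute [instance] CyclicOperad.addCommGroup CyclicOperad.module

variable {k : Type u} [Field k]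

/-! ### Labelled oriented graphs -/

/-- A finite graph (loops, multiple edges and several components allowed) with all vertices of
valence at least 3, with an ordering of the vertices, a direction of every edge, and an element of
`𝒪((H(v)))` at every vertex `v`.  `H` is the set of half-edges, `vert h` the vertex at which `h` is
attached, and the edges are the pairs `{h, inv h}`.  The edge `{h, inv h}` is directed from
`h` to `inv h` if `tail h` is true.  The list `ord` enumerates the vertices. -/
structure OGraph (O : CyclicOperad.{u, v} k) where
  V : Type
  H : Type
  [fintypeH : Fintype H]
  vert : H → V
  inv : Equiv.Perm H
  inv_inv : ∀ h, inv (inv h) = h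
  inv_ne : ∀ h, inv h ≠ h
  tail : H → Bool
  tail_inv : ∀ h, tail (inv h) = !tail h
  ord : List V
  ord_nodup : ord.Nodup
  mem_ord : ∀ v, v ∈ ord
  three_le : ∀ v, 3 ≤ Nat.card {h // vert h = v}
  label : ∀ v, O.obj {h // vert h = v}

attribute [instance] OGraph.fintypeH

namespace OGraph

variable {O : CyclicOperad.{u, v} k}

/-- Isomorphism of labelled graphs with ordered vertices and directed edges. -/
structure Iso (G G' : OGraph O) where
  onV : G.V ≃ G'.V
  onH : G.H ≃ G'.H
  vert : ∀ h, G'.vert (onH h) = onV (G.vert h)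
  inv : ∀ h, G'.inv (onH h) = onH (G.inv h)
  tail : ∀ h, G'.tail (onH h) = G.tail h
  ord : G'.ord = G.ord.map onV
  label : ∀ v, G'.label (onV v) =
    O.map (onH.subtypeEquiv (fun h => by rw [vert]; exact onV.injective.eq_iff.symm)) (G.label v)

/-- Change of the ordering of the vertices by a permutation. -/
def reorder (G : OGraph O) (σ : Equiv.Perm G.V) : OGraph O :=
  { G with
    ord := G.ord.map σ
    ord_nodup := G.ord_nodup.map σ.injective
    mem_ord := fun v => List.mem_map.2 ⟨σ.symm v, G.mem_ord _, by simp⟩ }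

/-- Change of the direction of the edge `{a, inv a}`. -/
def reverse (G : OGraph O) (a : G.H) : OGraph O :=
  { G with
    tail := fun x => if x = a ∨ x = G.inv a then !G.tail x else G.tail x
    tail_inv := fun h => by
      have h1 : G.inv h = a ↔ h = G.inv a :=
        ⟨fun e => by rw [← e, G.inv_inv], fun e => by rw [e, G.inv_inv]⟩
      have h2 : G.inv h = G.inv a ↔ h = a := G.inv.injective.eq_iff
      simp only [h1, h2, G.tail_inv, or_comm (a := h = G.inv a)]
      split_ifs <;> simp }

/-- Replace the operad element at the vertex `v` by `p`. -/
def setLabel (G : OGraph O) (v : G.V) (p : O.obj {h // G.vert h = v}) : OGraph O :=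
  { G with label := Function.update G.label v p }

/-- The relations of the graph complex: isomorphic graphs are identified, reordering the vertices
gives the sign of the permutation, reversing an edge gives the sign `-1`, and the
labels are multilinear. -/
inductive Relator : (OGraph O →₀ k) → Prop
  | iso {G G' : OGraph O} (e : Iso G G') :
      Relator (Finsupp.single G 1 - Finsupp.single G' 1)
  | reorder (G : OGraph O) [Fintype G.V] (σ : Equiv.Perm G.V) :
      Relator (Finsupp.single (G.reorder σ) 1 -
        Finsupp.single G (((Equiv.Perm.sign σ : ℤˣ) : ℤ) : k))
  | reverse (G : OGraph O) (a : G.H) :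
      Relator (Finsupp.single (G.reverse a) 1 + Finsupp.single G 1)
  | add (G : OGraph O) (v : G.V) (p q : O.obj {h // G.vert h = v}) :
      Relator (Finsupp.single (G.setLabel v (p + q)) 1 -
        Finsupp.single (G.setLabel v p) 1 - Finsupp.single (G.setLabel v q) 1)
  | smul (G : OGraph O) (v : G.V) (c : k) (p : O.obj {h // G.vert h = v}) :
      Relator (Finsupp.single (G.setLabel v (c • p)) 1 - Finsupp.single (G.setLabel v p) c)

end OGraph

/-- The space `𝒢^𝒪` underlying the graph complex. -/
abbrev GraphSpace (O : CyclicOperad.{u, v} k) :=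
  (OGraph O →₀ k) ⧸ Submodule.span k {x : OGraph O →₀ k | OGraph.Relator x}

namespace OGraph

variable {O : CyclicOperad.{u, v} k}

/-- The class of a labelled oriented graph in the graph complex. -/
def cls (G : OGraph O) : GraphSpace O :=
  Submodule.Quotient.mk (Finsupp.single G 1)

/-! ### Disjoint union -/

/-- The disjoint union of a finite family of graphs indexed by a linearly ordered set; the
orderings of the vertices are concatenated. -/
def union {ι : Type} [Fintype ι] [LinearOrder ι] (G : ι → OGraph O) : OGraph O where
  V := Σ i, (G i).V
  H := Σ i, (G i).H
  vert x := ⟨x.1, (G x.1).vert x.2⟩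
  inv := Equiv.sigmaCongrRight fun i => (G i).inv
  inv_inv := by rintro ⟨i, h⟩; simp [(G i).inv_inv]
  inv_ne := by rintro ⟨i, h⟩; simp [(G i).inv_ne]
  tail x := (G x.1).tail x.2
  tail_inv := by rintro ⟨i, h⟩; exact (G i).tail_inv h
  ord := (Finset.univ.sort (· ≤ ·)).flatMap fun i => (G i).ord.map (Sigma.mk i)
  ord_nodup := by
    rw [List.nodup_flatMap]
    refine ⟨fun i _ => (G i).ord_nodup.map sigma_mk_injective, ?_⟩
    refine (Finset.sort_nodup _ _).imp ?_
    intro i j hij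
    simp only [Function.onFun, List.disjoint_left, List.mem_map]
    rintro _ ⟨a, _, rfl⟩ ⟨b, _, hb⟩
    exact hij (congrArg Sigma.fst hb).symm
  mem_ord := by
    rintro ⟨i, v⟩
    exact List.mem_flatMap.2 ⟨i, by simp, List.mem_map.2 ⟨v, (G i).mem_ord v, rfl⟩⟩
  three_le := by
    rintro ⟨i, v⟩
    refine ((G i).three_le v).trans (Nat.card_le_card_of_injective
      (fun h => ⟨⟨i, h.1⟩, by simp [h.2]⟩) ?_)
    rintro ⟨a, _⟩ ⟨b, _⟩ hab
    simpa using hab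
  label x := O.map
    (Equiv.ofBijective
      (fun h : {h // (G x.1).vert h = x.2} =>
        (⟨⟨x.1, h.1⟩, by rw [h.2]⟩ :
          {y : Σ i, (G i).H // (⟨y.1, (G y.1).vert y.2⟩ : Σ i, (G i).V) = x}))
      (by
        obtain ⟨i, v⟩ := x
        constructor
        · rintro ⟨a, _⟩ ⟨b, _⟩ hab
          simpa using hab
        · rintro ⟨⟨j, h⟩, hj⟩
          obtain rfl : j = i := congrArg Sigma.fst hj
          exact ⟨⟨h, by simpa using hj⟩, rfl⟩))
    ((G x.1).label x.2)

/-! ### Gluing a polygon -/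

/-- The graph with the same vertices, half-edges and labels in which every edge, directed from `x`
to `y`, say, is replaced by an edge directed from `c x` to `c y`. -/
def rewire (G : OGraph O) (c : Equiv.Perm G.H) : OGraph O :=
  { G with
    inv := c * G.inv * c⁻¹
    inv_inv := fun h => by simp [G.inv_inv]
    inv_ne := fun h => by
      intro e
      apply G.inv_ne (c⁻¹ h)
      apply c.injective
      simpa using e
    tail := fun x => G.tail (c⁻¹ x)
    tail_inv := fun h => by simp [G.tail_inv] }

/-- The cyclic permutation `h₁ ↦ h₂ ↦ ⋯ ↦ hₙ ↦ h₁`. -/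
def cyc {n : ℕ} (G : OGraph O) (h : Fin n → G.H) : Equiv.Perm G.H :=
  (List.ofFn h).formPerm

/-- The graph `G⟨e₁, …, eₙ⟩` obtained by gluing a `2n`-gon, where `eᵢ` is the edge of the half-edge
`hᵢ`, directed from `hᵢ` to `inv hᵢ` (the `eᵢ` are distinct edges).  The edges `eᵢ` are
deleted (the cyclic permutation moves each `hᵢ` to `hᵢ₊₁` and fixes all other half-edges), and the new edge coming from the side of the `2n`-gon between `i` and `i + 1` joins
`hᵢ₊₁` to `inv hᵢ`.  The boundary orientation of the `2n`-gon directs it from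
`inv hᵢ` to `hᵢ₊₁`; after the switch it is directed from `hᵢ₊₁` to `inv hᵢ`, if `eᵢ` has the
direction given by the orientation of `G`.  If `G` directs some `eᵢ` the other way, the sign for
reversing `eᵢ` is the sign for reversing the new edge at `inv hᵢ`. -/
def glue {n : ℕ} (G : OGraph O) (h : Fin n → G.H) : OGraph O :=
  G.rewire (G.cyc h)

/-! ### Contracting an edge -/

section Contract

variable (G : OGraph O) (a : G.H)

/-- Half-edges that remain after the contraction of the edge `{a, inv a}`. -/
abbrev CH := {x : G.H // x ≠ a ∧ x ≠ G.inv a}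

/-- Vertices after the contraction; `none` is the new vertex. -/
abbrev CV := Option {w : G.V // w ≠ G.vert a ∧ w ≠ G.vert (G.inv a)}

/-- The image of a vertex in the contracted graph. -/
def cproj (w : G.V) : G.CV a :=
  if hw : w ≠ G.vert a ∧ w ≠ G.vert (G.inv a) then some ⟨w, hw⟩ else none

lemma cproj_eq_none {w : G.V} :
    G.cproj a w = none ↔ w = G.vert a ∨ w = G.vert (G.inv a) := by
  unfold cproj
  split_ifs with hw
  · simp [hw.1, hw.2]
  · simp only [true_iff]
    tauto

lemma cproj_eq_some {w : G.V} {z : {w : G.V // w ≠ G.vert a ∧ w ≠ G.vert (G.inv a)}} :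
    G.cproj a w = some z ↔ w = z.1 := by
  unfold cproj
  split_ifs with hw
  · simp [Subtype.ext_iff]
  · simp only [false_iff]
    rintro rfl
    exact hw z.2

/-- The half-edges at a vertex that is not an end of the contracted edge. -/
def fiberSome (z : {w : G.V // w ≠ G.vert a ∧ w ≠ G.vert (G.inv a)}) :
    {h // G.vert h = z.1} ≃ {x : G.CH a // G.cproj a (G.vert x.1) = some z} :=
  Equiv.ofBijective
    (fun y => ⟨⟨y.1, by
      refine ⟨fun e => z.2.1 ?_, fun e => z.2.2 ?_⟩
      · rw [← y.2, e]
      · rw [← y.2, e]⟩, (G.cproj_eq_some a).2 y.2⟩)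
    (by
      constructor
      · rintro ⟨x, _⟩ ⟨y, _⟩ h
        simpa using h
      · rintro ⟨⟨x, _⟩, h⟩
        exact ⟨⟨x, (G.cproj_eq_some a).1 h⟩, rfl⟩)

/-- The half-edges at the new vertex, if the contracted edge is not a loop. -/
def fiberNone (hl : G.vert a ≠ G.vert (G.inv a)) :
    {y : {h // G.vert h = G.vert a} // y ≠ ⟨a, rfl⟩} ⊕
      {y : {h // G.vert h = G.vert (G.inv a)} // y ≠ ⟨G.inv a, rfl⟩} ≃
    {x : G.CH a // G.cproj a (G.vert x.1) = none} :=
  Equiv.ofBijective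
    (Sum.elim
      (fun y => ⟨⟨y.1.1, fun e => y.2 (Subtype.ext e), fun e => hl (by rw [← y.1.2, e])⟩,
        (G.cproj_eq_none a).2 (Or.inl y.1.2)⟩)
      (fun y => ⟨⟨y.1.1, fun e => hl (by rw [← y.1.2, e]), fun e => y.2 (Subtype.ext e)⟩,
        (G.cproj_eq_none a).2 (Or.inr y.1.2)⟩))
    (by
      constructor
      · rintro (⟨⟨x, hx⟩, hx'⟩ | ⟨⟨x, hx⟩, hx'⟩) (⟨⟨y, hy⟩, hy'⟩ | ⟨⟨y, hy⟩, hy'⟩) h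
        · simpa using h
        · have e : x = y := by simpa using h
          subst e
          exact absurd (hx.symm.trans hy) hl
        · have e : x = y := by simpa using h
          subst e
          exact absurd (hy.symm.trans hx) hl
        · simpa using h
      · rintro ⟨⟨x, hx1, hx2⟩, h⟩
        rcases (G.cproj_eq_none a).1 h with h' | h'
        · exact ⟨.inl ⟨⟨x, h'⟩, fun e => hx1 (congrArg Subtype.val e)⟩, rfl⟩
        · exact ⟨.inr ⟨⟨x, h'⟩, fun e => hx2 (congrArg Subtype.val e)⟩, rfl⟩)

/-- The operad elements of the contracted graph; at the new vertex, the elements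
at the two ends of the edge are composed along the edge. -/
def clabel (hl : G.vert a ≠ G.vert (G.inv a)) :
    ∀ w : G.CV a, O.obj {x : G.CH a // G.cproj a (G.vert x.1) = w}
  | none => O.map (G.fiberNone a hl) (O.comp
      (O.map (Equiv.optionSubtypeNe
        (⟨a, rfl⟩ : {h // G.vert h = G.vert a})).symm (G.label (G.vert a)))
      (O.map (Equiv.optionSubtypeNe
        (⟨G.inv a, rfl⟩ : {h // G.vert h = G.vert (G.inv a)})).symm (G.label (G.vert (G.inv a)))))
  | some z => O.map (G.fiberSome a z) (G.label z.1)

/-- The contraction of the edge `{a, inv a}`, which is not a loop.  The new vertex comes first,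
followed by the other vertices in their old order. -/
def contract (hl : G.vert a ≠ G.vert (G.inv a)) : OGraph O where
  V := G.CV a
  H := G.CH a
  vert x := G.cproj a (G.vert x.1)
  inv := G.inv.subtypePerm (fun x => by
    have h1 : G.inv x = a ↔ x = G.inv a :=
      ⟨fun e => by rw [← e, G.inv_inv], fun e => by rw [e, G.inv_inv]⟩
    have h2 : G.inv x = G.inv a ↔ x = a := G.inv.injective.eq_iff
    simp only [ne_eq, h1, h2]
    exact and_comm)
  inv_inv := by rintro ⟨x, hx⟩; simp [G.inv_inv]
  inv_ne := by rintro ⟨x, hx⟩; simp [G.inv_ne]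
  tail x := G.tail x.1
  tail_inv := by rintro ⟨x, hx⟩; simp [G.tail_inv]
  ord := none :: G.ord.filterMap (fun w =>
    if hw : w ≠ G.vert a ∧ w ≠ G.vert (G.inv a) then some (some ⟨w, hw⟩) else none)
  ord_nodup := by
    rw [List.nodup_cons]
    constructor
    · simp
    · refine G.ord_nodup.filterMap ?_
      intro x y z hx hy
      split_ifs at hx hy
      · simp only [Option.mem_def, Option.some.injEq] at hx hy
        have := hx.trans hy.symm
        simpa using this
      all_goals simp at hx hy
  mem_ord := by
    rintro (_ | z)
    · simp
    · refine List.mem_cons_of_mem _ (List.mem_filterMap.2 ⟨z.1, G.mem_ord _, ?_⟩)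
      simp [z.2.1, z.2.2]
  three_le := by
    rintro (_ | z)
    · rw [← Nat.card_congr (G.fiberNone a hl), Nat.card_sum]
      have h1 := G.three_le (G.vert a)
      have h2 := G.three_le (G.vert (G.inv a))
      rw [← Nat.card_congr (Equiv.optionSubtypeNe
        (⟨a, rfl⟩ : {h // G.vert h = G.vert a})), Finite.card_option] at h1
      rw [← Nat.card_congr (Equiv.optionSubtypeNe
        (⟨G.inv a, rfl⟩ : {h // G.vert h = G.vert (G.inv a)})), Finite.card_option] at h2
      omega
    · rw [← Nat.card_congr (G.fiberSome a z)]
      exact G.three_le z.1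
  label := G.clabel a hl

/-- The sign that brings `G` into the position where the ends of the edge `{a, inv a}` are the
first and the second vertex and the edge is directed from the first to the second:
`-1` if the edge is directed towards `a`, times the sign of moving the vertex of `a` to the first
and then the vertex of `inv a` to the second place. -/
def contractSign : k :=
  (if G.tail a then 1 else -1) *
    (-1) ^ (G.ord.idxOf (G.vert a) + (G.ord.erase (G.vert a)).idxOf (G.vert (G.inv a)))

/-- The element `G_e` of the graph complex for the edge `e = {a, inv a}`; it is `0` for a loop. -/
def contractClass : GraphSpace O :=
  if hl : G.vert a = G.vert (G.inv a) then 0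
  else G.contractSign a • (G.contract a hl).cls

end Contract

/-! ### Fusion -/

/-- `φₙ(G₁ ⊙ ⋯ ⊙ Gₙ)` for a family of `n` graphs (`n ≥ 1`) indexed by a linearly ordered set:
the sum over all `n`-tuples of directed edges (half-edges `h j`, each directed away from `h j`)
that lie in different members of the family, of the result of gluing the `2n`-gon to the
disjoint union and contracting the new edge between `1` and `2`.  That edge joins
the half-edges `h₂ = cyc h (h₁)` and `inv h₁`. -/
def fuse (n : ℕ) [NeZero n] {ι : Type} [Fintype ι] [LinearOrder ι] (G : ι → OGraph O) :
    GraphSpace O :=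
  ∑ h : Fin n → (union G).H with Function.Injective (fun j => (h j).1),
    ((union G).glue h).contractClass ((union G).cyc h (h 0))

end OGraph

/-! ### The graded symmetric algebra -/

/-- The span of the graphs with `d` vertices. -/
def degreePart (O : CyclicOperad.{u, v} k) (d : ℕ) : Submodule k (GraphSpace O) :=
  Submodule.span k {x | ∃ G : OGraph O, Nat.card G.V = d ∧ x = G.cls}

/-- The relations `x ⊙ y = (-1)^{|x||y|} y ⊙ x` for homogeneous `x`, `y`. -/
inductive SymRel (O : CyclicOperad.{u, v} k) :
    TensorAlgebra k (GraphSpace O) → TensorAlgebra k (GraphSpace O) → Prop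
  | swap {d e : ℕ} {x y : GraphSpace O} (hx : x ∈ degreePart O d) (hy : y ∈ degreePart O e) :
      SymRel O (TensorAlgebra.ι k x * TensorAlgebra.ι k y)
        ((-1 : k) ^ (d * e) • (TensorAlgebra.ι k y * TensorAlgebra.ι k x))

/-- The graded symmetric algebra `S𝒢^𝒪`. -/
abbrev SymAlg (O : CyclicOperad.{u, v} k) := RingQuot (SymRel O)

/-- The inclusion of the graph complex into its graded symmetric algebra. -/
def symι (O : CyclicOperad.{u, v} k) : GraphSpace O →ₗ[k] SymAlg O :=
  (RingQuot.mkAlgHom k (SymRel O)).toLinearMap ∘ₗ TensorAlgebra.ι k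

/-- The product `⊙` of the graphs with index in `I`, in increasing order. -/
def word {O : CyclicOperad.{u, v} k} {m : ℕ} (G : Fin m → OGraph O) (I : Finset (Fin m)) :
    SymAlg O :=
  ((I.sort (· ≤ ·)).map fun i => symι O (G i).cls).prod

/-- The sign `ε(I, J)` with `G₁ ⊙ ⋯ ⊙ Gₘ = ε(I, J) G_I ⊙ G_J`, where `J` is the complement
of `I`. -/
def koszulSign {O : CyclicOperad.{u, v} k} {m : ℕ} (G : Fin m → OGraph O) (I : Finset (Fin m)) :
    k :=
  ∏ i ∈ I, ∏ j ∈ Iᶜ with j < i, (-1) ^ (Nat.card (G i).V * Nat.card (G j).V)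

/-- `φ` is the extension of `φₙ` to `S𝒢^𝒪` as a coderivation:
`φ(G₁ ⊙ ⋯ ⊙ Gₘ) = ∑ ε(I, J) φₙ(G_I) ⊙ G_J`, over all `I` with `n` elements and complement `J`,
for all graphs `G₁, …, Gₘ`. -/
def IsFusion {O : CyclicOperad.{u, v} k} (n : ℕ) [NeZero n] (φ : Module.End k (SymAlg O)) : Prop :=
  ∀ (m : ℕ) (G : Fin m → OGraph O),
    φ (word G Finset.univ) =
      ∑ I ∈ Finset.powersetCard n (Finset.univ : Finset (Fin m)),
        koszulSign G I • (symι O (OGraph.fuse n fun i : I => G i) * word G Iᶜ)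

end Fusion

end

/-! The signs are controlled by replacing the graded symmetric algebra with a space of graphs. A
blocked graph is a single oriented graph with a partition of its vertices into blocks such that no
edge joins two blocks. It stands for the product of its blocks, and one ordering of all vertices
carries the Koszul signs. Splitting into blocks and disjoint union give mutually inverse linear maps
`toSym` and `fromSym` between `BSpace O` and `SymAlg O`. On `BSpace O` no sign of a partition
occurs: `fusion O n` sums over all n-tuples `h` of half-edges in pairwise different blocks, glues
the polygon, merges the blocks it meets, and contracts the new edge `{h 1, inv (h 0)}` (indices in
`Fin n`, starting at 0).

Two facts allow a composite of two such maps to be expanded. Contracting two edges in the two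
possible orders gives opposite results (`BGraph.K2_antisymm`); this is the computation behind the
square zero of an edge-contracting differential, with associativity of the operad entering when the
edges share an end. Moreover, gluing commutes with the contraction of an edge that the polygon does
not use (`BGraph.fusion_pcontract`). Hence the composite is a sum over pairs of tuples `h`, `h'`:
both polygons are glued, then the edges at `h 1` and `h' 1` are contracted. There are three kinds of
pairs.

If the second polygon uses a new edge of the first one in the direction given by `h`, the two
polygons form one larger polygon, because the product of two cycles with one common point is a
cycle. The sum runs over one edge from each of two complementary sets of edges of the large polygon.
It vanishes by antisymmetry and rotation (`BGraph.sum_overlap`).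

If the new edge is used in the other direction, reversing the second polygon leads back to the first
kind without changing the term (`BGraph.fterm_rev`, `BGraph.K2_glue_rev`).

If the second polygon uses no new edge, the two gluings commute, so exchanging `h` and `h'` changes
only the order of the contractions and hence the sign. This gives both assertions, the case `i = j`
by an involution without fixed points, so the characteristic plays no role.

To identify the transported map with the coderivation in the statement, the tuples are grouped by
the set `I` of graphs that they meet, and the disjoint union is split into its parts over `I` and
its complement; the reordering of the vertices produces exactly the sign of the partition
(`isFusion_symFusion`). Uniqueness holds since products of graphs span `SymAlg O`. -/

noncomputable section

open scoped Classical

namespace Fusion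

/-! ### Signed permutations of lists -/

/-- `SPerm s l l'`: the list `l'` arises from `l` by a permutation of sign `s`. -/
inductive SPerm {α : Type*} : ℤˣ → List α → List α → Prop
  | nil : SPerm 1 [] []
  | cons (x : α) {s : ℤˣ} {l l' : List α} : SPerm s l l' → SPerm s (x :: l) (x :: l')
  | swap (x y : α) (l : List α) : SPerm (-1) (y :: x :: l) (x :: y :: l)
  | trans {s t : ℤˣ} {l l' l'' : List α} : SPerm s l l' → SPerm t l' l'' → SPerm (s * t) l l''

namespace SPerm

variable {α β : Type*} {s t : ℤˣ} {l l' l'' m m' : List α}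

lemma cast (h : SPerm s l l') (e : s = t) : SPerm t l l' := e ▸ h

lemma refl : ∀ l : List α, SPerm 1 l l
  | [] => .nil
  | x :: l => .cons x (refl l)

lemma of_eq (h : l = l') : SPerm 1 l l' := h ▸ refl l

lemma symm (h : SPerm s l l') : SPerm s l' l := by
  induction h with
  | nil => exact .nil
  | cons x _ ih => exact .cons x ih
  | swap x y l => exact .swap y x l
  | trans _ _ ih1 ih2 => exact (ih2.trans ih1).cast (mul_comm _ _)

lemma perm (h : SPerm s l l') : l.Perm l' := by
  induction h with
  | nil => exact .nil
  | cons x _ ih => exact .cons x ih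
  | swap x y l => exact .swap x y l
  | trans _ _ ih1 ih2 => exact ih1.trans ih2

lemma exists_of_perm (h : l.Perm l') : ∃ s, SPerm s l l' := by
  induction h with
  | nil => exact ⟨1, .nil⟩
  | cons x _ ih => exact ih.imp fun _ h => .cons x h
  | swap x y l => exact ⟨-1, .swap x y l⟩
  | trans _ _ ih1 ih2 =>
    obtain ⟨s, hs⟩ := ih1
    obtain ⟨t, ht⟩ := ih2
    exact ⟨s * t, hs.trans ht⟩

lemma map (f : α → β) (h : SPerm s l l') : SPerm s (l.map f) (l'.map f) := by
  induction h with
  | nil => exact .nil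
  | cons x _ ih => exact .cons _ ih
  | swap x y l => exact .swap _ _ _
  | trans _ _ ih1 ih2 => exact ih1.trans ih2

lemma append_left (m : List α) (h : SPerm s l l') : SPerm s (m ++ l) (m ++ l') := by
  induction m with
  | nil => exact h
  | cons x m ih => exact .cons x ih

lemma append_right (h : SPerm s l l') (m : List α) : SPerm s (l ++ m) (l' ++ m) := by
  induction h with
  | nil => exact refl m
  | cons x _ ih => exact .cons _ ih
  | swap x y l => exact .swap _ _ _
  | trans _ _ ih1 ih2 => exact ih1.trans ih2

lemma append (h : SPerm s l l') (h' : SPerm t m m') : SPerm (s * t) (l ++ m) (l' ++ m') :=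
  (h.append_right m).trans (h'.append_left l')

lemma move (a : α) : ∀ l m : List α, SPerm ((-1) ^ l.length) (l ++ a :: m) (a :: (l ++ m))
  | [], m => (refl _).cast (by simp)
  | x :: l, m => ((SPerm.cons x (move a l m)).trans (.swap a x (l ++ m))).cast (by
      simp [pow_succ])

lemma append_comm (m : List α) : ∀ l : List α,
    SPerm ((-1) ^ (l.length * m.length)) (l ++ m) (m ++ l)
  | [] => (of_eq (by simp)).cast (by simp)
  | x :: l => by
    refine ((SPerm.cons x (append_comm m l)).trans (move x m l).symm).cast ?_
    rw [← pow_add, List.length_cons, Nat.succ_mul]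

/-- The clause on elements outside `l` makes the `cons` case work and determines `σ`. It links the
signs of lists to `Equiv.Perm.sign`. -/
lemma exists_equiv [Fintype α] (h : SPerm s l l') (hl : l.Nodup) :
    ∃ σ : Equiv.Perm α, l' = l.map σ ∧ Equiv.Perm.sign σ = s ∧ ∀ x, x ∉ l → σ x = x := by
  induction h with
  | nil => exact ⟨1, rfl, by simp, by simp⟩
  | cons x h ih =>
    rw [List.nodup_cons] at hl
    obtain ⟨σ, h1, h2, h3⟩ := ih hl.2
    refine ⟨σ, ?_, h2, fun y hy => h3 y fun h => hy (List.mem_cons_of_mem _ h)⟩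
    rw [List.map_cons, h3 x hl.1, h1]
  | swap x y l =>
    have hxy : y ≠ x := fun e => by simp [e] at hl
    refine ⟨Equiv.swap x y, ?_, Equiv.Perm.sign_swap hxy.symm, fun z hz => ?_⟩
    · simp only [List.map_cons, Equiv.swap_apply_right, Equiv.swap_apply_left, List.cons.injEq,
        true_and]
      conv_lhs => rw [← List.map_id l]
      refine List.map_congr_left fun z hz => ?_
      rw [Equiv.swap_apply_of_ne_of_ne]
      · rfl
      · rintro rfl; simp [hz] at hl
      · rintro rfl; simp [hz] at hl
    · exact Equiv.swap_apply_of_ne_of_ne (by rintro rfl; simp at hz) (by rintro rfl; simp at hz)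
  | trans h h' ih1 ih2 =>
    obtain ⟨σ, h1, h2, h3⟩ := ih1 hl
    obtain ⟨τ, h4, h5, h6⟩ := ih2 (h.perm.nodup_iff.1 hl)
    refine ⟨τ * σ, by rw [h4, h1, List.map_map]; rfl, by rw [map_mul, h2, h5, mul_comm],
      fun x hx => ?_⟩
    rw [Equiv.Perm.mul_apply, h3 x hx, h6 x fun hx' => hx (h.perm.mem_iff.2 hx')]

lemma unique [Finite α] (h : SPerm s l l') (h' : SPerm t l l') (hl : l.Nodup) : s = t := by
  have := Fintype.ofFinite α
  obtain ⟨σ, h1, h2, h3⟩ := h.exists_equiv hl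
  obtain ⟨τ, h4, h5, h6⟩ := h'.exists_equiv hl
  rw [← h2, ← h5]
  congr 1
  ext x
  by_cases hx : x ∈ l
  · exact List.map_inj_left.1 (h1.symm.trans h4) x hx
  · rw [h3 x hx, h6 x hx]

lemma of_cons [Finite α] {x : α} (h : SPerm s (x :: l) (x :: l')) (hl : (x :: l).Nodup) :
    SPerm s l l' := by
  obtain ⟨t, ht⟩ := exists_of_perm h.perm.cons_inv
  exact ht.cast ((ht.cons x).unique h hl)

end SPerm

/-! ### Signs as scalars -/

section Sign

variable (k : Type u) [Field k]

/-- A sign as an element of the field. -/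
def sg (s : ℤˣ) : k := ((s : ℤ) : k)

@[simp] lemma sg_one : sg k 1 = 1 := by simp [sg]

@[simp] lemma sg_neg (s : ℤˣ) : sg k (-s) = -sg k s := by simp [sg]

@[simp] lemma sg_mul (s t : ℤˣ) : sg k (s * t) = sg k s * sg k t := by simp [sg]

@[simp] lemma sg_pow (s : ℤˣ) (n : ℕ) : sg k (s ^ n) = sg k s ^ n := by simp [sg]

@[simp] lemma sg_mul_self (s : ℤˣ) : sg k s * sg k s = 1 := by
  rw [← sg_mul, Int.units_mul_self, sg_one]

@[simp] lemma sg_smul_smul {M : Type*} [AddCommGroup M] [Module k M] (s : ℤˣ) (x : M) :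
    sg k s • sg k s • x = x := by
  rw [smul_smul, sg_mul_self, one_smul]

lemma eq_sg_smul_comm {M : Type*} [AddCommGroup M] [Module k M] {s : ℤˣ} {x y : M}
    (h : x = sg k s • y) : y = sg k s • x := by
  rw [h, sg_smul_smul]

end Sign

variable {k : Type u} [Field k] {O : CyclicOperad.{u, v} k}

namespace OGraph

instance finite_V (G : OGraph O) : Finite G.V :=
  Set.finite_univ_iff.1 (G.ord.finite_toSet.subset fun v _ => G.mem_ord v)

lemma card_V (G : OGraph O) : Nat.card G.V = G.ord.length := by
  have := Fintype.ofFinite G.V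
  have h : G.ord.toFinset = Finset.univ := by
    ext v
    simp [G.mem_ord]
  rw [Nat.card_eq_fintype_card, ← List.toFinset_card_of_nodup G.ord_nodup, h, Finset.card_univ]

/-! ### Labels in coordinates -/

/-- The label of `v` is `p`, if the half-edges at `v` are named by `j`. -/
def Lab (G : OGraph O) (v : G.V) {S : Type} [Finite S] (j : S → G.H) (p : O.obj S) : Prop :=
  ∃ e : S ≃ {h // G.vert h = v}, (∀ s, (e s).1 = j s) ∧ O.map e p = G.label v

section Lab

variable {G : OGraph O} {v : G.V} {S T : Type} [Finite S] [Finite T]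

lemma map_symm_map (O : CyclicOperad.{u, v} k) (e : S ≃ T) (p : O.obj S) :
    O.map e.symm (O.map e p) = p := by
  rw [← O.map_trans, Equiv.self_trans_symm, O.map_refl]

lemma map_map_symm (O : CyclicOperad.{u, v} k) (e : S ≃ T) (p : O.obj T) :
    O.map e (O.map e.symm p) = p := by
  rw [← O.map_trans, Equiv.symm_trans_self, O.map_refl]

lemma lab_of_equiv (e : S ≃ {h // G.vert h = v}) :
    G.Lab v (fun s => (e s).1) (O.map e.symm (G.label v)) :=
  ⟨e, fun _ => rfl, map_map_symm O e _⟩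

lemma lab_label (G : OGraph O) (v : G.V) : G.Lab v Subtype.val (G.label v) :=
  ⟨Equiv.refl _, fun _ => rfl, O.map_refl _⟩

lemma lab_map (σ : S ≃ T) {j : T → G.H} {p : O.obj S} :
    G.Lab v j (O.map σ p) ↔ G.Lab v (j ∘ σ) p := by
  constructor
  · rintro ⟨e, he, h⟩
    exact ⟨σ.trans e, fun s => he _, by rw [O.map_trans, h]⟩
  · rintro ⟨e, he, h⟩
    refine ⟨σ.symm.trans e, fun s => ?_, ?_⟩
    · simp [he]
    · rw [O.map_trans, map_symm_map, h]

lemma Lab.mem {j : S → G.H} {p : O.obj S} (h : G.Lab v j p) (s : S) : G.vert (j s) = v := by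
  obtain ⟨e, he, -⟩ := h
  rw [← he s]
  exact (e s).2

lemma Lab.inj {j : S → G.H} {p : O.obj S} (h : G.Lab v j p) : Function.Injective j := by
  obtain ⟨e, he, -⟩ := h
  intro s t hst
  exact e.injective (Subtype.ext (by rw [he, he, hst]))

/-- Any two coordinate systems at a vertex differ by a renaming that carries one operad element to
the other, so labels may be compared in whichever coordinates are convenient. -/
lemma Lab.exists_equiv {j : S → G.H} {p : O.obj S} (h : G.Lab v j p) {j' : T → G.H}
    {q : O.obj T} (h' : G.Lab v j' q) : ∃ σ : T ≃ S, j' = j ∘ σ ∧ p = O.map σ q := by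
  obtain ⟨e, he, hp⟩ := h
  obtain ⟨f, hf, hq⟩ := h'
  refine ⟨f.trans e.symm, ?_, ?_⟩
  · funext t
    rw [← hf t]
    simp [← he]
  · rw [O.map_trans, hq, ← hp, map_symm_map]

lemma Lab.congr {j j' : S → G.H} {p : O.obj S} (h : G.Lab v j p) (e : ∀ s, j' s = j s) :
    G.Lab v j' p := by
  obtain rfl : j' = j := funext e
  exact h

/-- Coordinates adapted to `comp`: the half-edge along which to compose is the leg `none`. -/
lemma exists_lab_option (G : OGraph O) (a : G.H) :
    ∃ (A : Type) (_ : Finite A) (j : Option A → G.H) (p : O.obj (Option A)),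
      j none = a ∧ G.Lab (G.vert a) j p :=
  ⟨{y : {h // G.vert h = G.vert a} // y ≠ ⟨a, rfl⟩}, inferInstance, _, _, by simp,
    lab_of_equiv (Equiv.optionSubtypeNe (⟨a, rfl⟩ : {h // G.vert h = G.vert a}))⟩

/-- Coordinates adapted to `comp_assoc`, for a vertex at which two edges are to be contracted. -/
lemma exists_lab_option_option (G : OGraph O) {a c : G.H} (hac : c ≠ a)
    (hv : G.vert c = G.vert a) :
    ∃ (A : Type) (_ : Finite A) (j : Option (Option A) → G.H) (p : O.obj (Option (Option A))),
      j none = a ∧ j (some none) = c ∧ G.Lab (G.vert a) j p := by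
  let F := {y : {h // G.vert h = G.vert a} // y ≠ ⟨a, rfl⟩}
  let c' : F := ⟨⟨c, hv⟩, fun e => hac (congrArg Subtype.val e)⟩
  exact ⟨{y : F // y ≠ c'}, inferInstance, _, _, rfl, rfl,
    lab_of_equiv ((Equiv.optionSubtypeNe c').optionCongr.trans
      (Equiv.optionSubtypeNe (⟨a, rfl⟩ : {h // G.vert h = G.vert a})))⟩

lemma optionCongr_removeNone {A B : Type} (f : Option A ≃ Option B) (hf : f none = none) :
    (Equiv.removeNone f).optionCongr = f := by
  ext1 x
  rcases x with _ | x
  · simp [hf]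
  · have : f (some x) ≠ none := fun e => by
      have := f.injective (e.trans hf.symm)
      simp at this
    rw [Equiv.optionCongr_apply, Option.map_some, Equiv.removeNone_some f]
    exact Option.ne_none_iff_exists'.1 this

lemma Lab.contract_some {a : G.H} (hl : G.vert a ≠ G.vert (G.inv a)) {j : S → G.H}
    {p : O.obj S} (h : G.Lab v j p) (hv : v ≠ G.vert a ∧ v ≠ G.vert (G.inv a))
    {J : S → G.CH a} (hJ : ∀ s, (J s).1 = j s) :
    (G.contract a hl).Lab (G.cproj a v) J p := by
  have hc : G.cproj a v = some ⟨v, hv⟩ := (G.cproj_eq_some a).2 rfl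
  obtain ⟨e, he, hp⟩ := h
  have key : O.map (e.trans (G.fiberSome a ⟨v, hv⟩)) p = G.clabel a hl (some ⟨v, hv⟩) := by
    rw [O.map_trans, hp, clabel]
  rw [hc]
  refine ⟨e.trans (G.fiberSome a ⟨v, hv⟩), fun s => Subtype.ext ?_, key⟩
  rw [hJ, ← he]
  rfl

/-- By equivariance of the composition (`comp_map`), the label of the new vertex can be computed in
any coordinates that put the contracted edge at `none`. -/
lemma Lab.contract_none {a : G.H} (hl : G.vert a ≠ G.vert (G.inv a)) {A B : Type} [Finite A]
    [Finite B] {j : Option A → G.H} {p : O.obj (Option A)} {j' : Option B → G.H}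
    {q : O.obj (Option B)} (h : G.Lab (G.vert a) j p) (hj : j none = a)
    (h' : G.Lab (G.vert (G.inv a)) j' q) (hj' : j' none = G.inv a) {J : A ⊕ B → G.CH a}
    (hJ : ∀ x, (J (.inl x)).1 = j (some x)) (hJ' : ∀ x, (J (.inr x)).1 = j' (some x)) :
    (G.contract a hl).Lab none J (O.comp p q) := by
  obtain ⟨e, he, hp⟩ := h
  obtain ⟨f, hf, hq⟩ := h'
  -- These bijections compare the given coordinates with those built into `clabel`. They preserve
  -- `none`, hence come from bijections of the remaining legs, as `comp_map` requires.
  let e₁ := e.trans (Equiv.optionSubtypeNe (⟨a, rfl⟩ : {h // G.vert h = G.vert a})).symm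
  let f₁ := f.trans (Equiv.optionSubtypeNe
    (⟨G.inv a, rfl⟩ : {h // G.vert h = G.vert (G.inv a)})).symm
  have he₁ : (Equiv.removeNone e₁).optionCongr = e₁ := by
    refine optionCongr_removeNone _ ?_
    have : e none = ⟨a, rfl⟩ := Subtype.ext ((he none).trans hj)
    simp [e₁, this]
  have hf₁ : (Equiv.removeNone f₁).optionCongr = f₁ := by
    refine optionCongr_removeNone _ ?_
    have : f none = ⟨G.inv a, rfl⟩ := Subtype.ext ((hf none).trans hj')
    simp [f₁, this]
  have key : O.map (((Equiv.removeNone e₁).sumCongr (Equiv.removeNone f₁)).trans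
      (G.fiberNone a hl)) (O.comp p q) = G.clabel a hl none := by
    rw [O.map_trans, ← O.comp_map, he₁, hf₁]
    simp only [e₁, f₁, O.map_trans, hp, hq, clabel]
  refine ⟨((Equiv.removeNone e₁).sumCongr (Equiv.removeNone f₁)).trans (G.fiberNone a hl),
    ?_, key⟩
  · rintro (x | x)
    · refine Subtype.ext ?_
      rw [hJ, ← he]
      have h1 : e (some x) = Equiv.optionSubtypeNe _ (e₁ (some x)) :=
        (Equiv.apply_symm_apply _ _).symm
      rw [h1, ← he₁]
      rfl
    · refine Subtype.ext ?_
      rw [hJ', ← hf]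
      have h1 : f (some x) = Equiv.optionSubtypeNe _ (f₁ (some x)) :=
        (Equiv.apply_symm_apply _ _).symm
      rw [h1, ← hf₁]
      rfl

end Lab

/-! ### Isomorphisms that need not preserve the edges -/

/-- Bijections of vertices and half-edges that are compatible with the incidence of half-edges and
vertices and with the labels, but not necessarily with the edges and the orientations. -/
structure Sim (G G' : OGraph O) where
  onV : G.V ≃ G'.V
  onH : G.H ≃ G'.H
  vert : ∀ h, G'.vert (onH h) = onV (G.vert h)
  lab : ∀ (v : G.V) (S : Type) [Finite S] (j : S → G.H) (p : O.obj S),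
    G.Lab v j p → G'.Lab (onV v) (onH ∘ j) p

/-- It is enough to check the labels in one system of coordinates. -/
def Sim.ofLab {G G' : OGraph O} (onV : G.V ≃ G'.V) (onH : G.H ≃ G'.H)
    (vert : ∀ h, G'.vert (onH h) = onV (G.vert h))
    (lab : ∀ v : G.V, ∃ (S : Type) (_ : Finite S) (j : S → G.H) (p : O.obj S),
      G.Lab v j p ∧ G'.Lab (onV v) (onH ∘ j) p) : Sim G G' where
  onV := onV
  onH := onH
  vert := vert
  lab v T _ i q h := by
    obtain ⟨S, _, j, p, h1, h2⟩ := lab v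
    obtain ⟨σ, rfl, rfl⟩ := h1.exists_equiv h
    exact (lab_map σ).1 h2

lemma cls_iso {G G' : OGraph O} (e : Iso G G') : G'.cls = G.cls :=
  ((Submodule.Quotient.eq _).2 (Submodule.subset_span (Relator.iso e))).symm

lemma cls_reorder (G : OGraph O) [Fintype G.V] (σ : Equiv.Perm G.V) :
    (G.reorder σ).cls = sg k (Equiv.Perm.sign σ) • G.cls := by
  have := (Submodule.Quotient.eq (Submodule.span k {x : OGraph O →₀ k | Relator x})).2
    (Submodule.subset_span (Relator.reorder G σ))
  rw [cls, this, cls, ← Submodule.Quotient.mk_smul, Finsupp.smul_single, smul_eq_mul, mul_one]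
  rfl

/-- A similarity preserving the edges but permuting the vertex order is an isomorphism onto a
reordered copy of the target. -/
lemma cls_sim {G G' : OGraph O} (e : Sim G G') (inv : ∀ h, G'.inv (e.onH h) = e.onH (G.inv h))
    (tail : ∀ h, G'.tail (e.onH h) = G.tail h) {s : ℤˣ}
    (ord : SPerm s (G.ord.map e.onV) G'.ord) : G'.cls = sg k s • G.cls := by
  have := Fintype.ofFinite G'.V
  obtain ⟨σ, h1, h2, -⟩ := ord.symm.exists_equiv G'.ord_nodup
  have i : Iso G (G'.reorder σ) :=
    { onV := e.onV
      onH := e.onH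
      vert := e.vert
      inv := inv
      tail := tail
      ord := h1.symm
      label := fun v => by
        obtain ⟨f, hf, h⟩ := e.lab v _ _ _ (G.lab_label v)
        refine h.symm.trans ?_
        congr 2
        ext s
        exact hf s }
  have h3 := cls_iso i
  rw [cls_reorder, h2] at h3
  exact eq_sg_smul_comm k h3.symm

end OGraph

/-! ### Blocked graphs -/

/-- An oriented labelled graph whose vertices are distributed over a finite set of blocks, such
that no edge joins different blocks.  It stands for the product of the blocks in the graded
symmetric algebra. -/
structure BGraph (O : CyclicOperad.{u, v} k) where
  G : OGraph O
  B : Type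
  [finB : Finite B]
  blk : G.V → B
  blk_inv : ∀ h, blk (G.vert (G.inv h)) = blk (G.vert h)

attribute [instance] BGraph.finB

namespace BGraph

/-- Isomorphism of blocked graphs that changes the order of the vertices by the sign `s`. -/
structure Iso (P Q : BGraph O) (s : ℤˣ) extends OGraph.Sim P.G Q.G where
  inv : ∀ h, Q.G.inv (onH h) = onH (P.G.inv h)
  tail : ∀ h, Q.G.tail (onH h) = P.G.tail h
  onB : P.B ≃ Q.B
  blk : ∀ v, Q.blk (onV v) = onB (P.blk v)
  ord : SPerm s (P.G.ord.map onV) Q.G.ord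

/-- Change of the direction of one edge. -/
def reverse (P : BGraph O) (a : P.G.H) : BGraph O :=
  ⟨P.G.reverse a, P.B, P.blk, P.blk_inv⟩

/-- Change of one label. -/
def setLabel (P : BGraph O) (v : P.G.V) (p : O.obj {h // P.G.vert h = v}) : BGraph O :=
  ⟨P.G.setLabel v p, P.B, P.blk, P.blk_inv⟩

/-- The relations between blocked graphs. -/
inductive Relator : (BGraph O →₀ k) → Prop
  | iso {P Q : BGraph O} {s : ℤˣ} (e : Iso P Q s) :
      Relator (Finsupp.single Q 1 - Finsupp.single P (sg k s))
  | reverse (P : BGraph O) (a : P.G.H) :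
      Relator (Finsupp.single (P.reverse a) 1 + Finsupp.single P 1)
  | add (P : BGraph O) (v : P.G.V) (p q : O.obj {h // P.G.vert h = v}) :
      Relator (Finsupp.single (P.setLabel v (p + q)) 1 -
        Finsupp.single (P.setLabel v p) 1 - Finsupp.single (P.setLabel v q) 1)
  | smul (P : BGraph O) (v : P.G.V) (c : k) (p : O.obj {h // P.G.vert h = v}) :
      Relator (Finsupp.single (P.setLabel v (c • p)) 1 - Finsupp.single (P.setLabel v p) c)

end BGraph

/-- The space spanned by the blocked graphs. -/
abbrev BSpace (O : CyclicOperad.{u, v} k) :=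
  (BGraph O →₀ k) ⧸ Submodule.span k {x : BGraph O →₀ k | BGraph.Relator x}

namespace BGraph

/-- The class of a blocked graph. -/
def cls (P : BGraph O) : BSpace O :=
  Submodule.Quotient.mk (Finsupp.single P 1)

lemma mk_single (P : BGraph O) (c : k) :
    (Submodule.Quotient.mk (Finsupp.single P c) : BSpace O) = c • P.cls := by
  rw [cls, ← Submodule.Quotient.mk_smul, Finsupp.smul_single, smul_eq_mul, mul_one]

lemma Relator.mk_eq_zero {x : BGraph O →₀ k} (h : Relator x) :
    (Submodule.Quotient.mk x : BSpace O) = 0 :=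
  (Submodule.Quotient.mk_eq_zero _).2 (Submodule.subset_span h)

lemma cls_iso {P Q : BGraph O} {s : ℤˣ} (e : Iso P Q s) : Q.cls = sg k s • P.cls := by
  have := (Relator.iso e).mk_eq_zero
  rwa [Submodule.Quotient.mk_sub, mk_single, mk_single, one_smul, sub_eq_zero] at this

lemma cls_reverse (P : BGraph O) (a : P.G.H) : (P.reverse a).cls = -P.cls := by
  have := (Relator.reverse P a).mk_eq_zero
  rwa [Submodule.Quotient.mk_add, mk_single, mk_single, one_smul, one_smul,
    add_eq_zero_iff_eq_neg] at this

lemma isLinearMap_cls (P : BGraph O) (v : P.G.V) :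
    IsLinearMap k fun p => (P.setLabel v p).cls := by
  constructor
  · intro p q
    have := (Relator.add P v p q).mk_eq_zero
    rwa [Submodule.Quotient.mk_sub, Submodule.Quotient.mk_sub, mk_single, mk_single, mk_single,
      one_smul, one_smul, one_smul, sub_sub, sub_eq_zero] at this
  · intro c p
    have := (Relator.smul P v c p).mk_eq_zero
    rwa [Submodule.Quotient.mk_sub, mk_single, mk_single, one_smul, sub_eq_zero] at this

end BGraph

namespace BSpace

variable {M : Type*} [AddCommGroup M] [Module k M]

/-- A linear map on the space of blocked graphs, given on graphs. -/
def lift (f : BGraph O → M)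
    (hiso : ∀ {P Q : BGraph O} {s : ℤˣ} (_ : BGraph.Iso P Q s), f Q = sg k s • f P)
    (hrev : ∀ (P : BGraph O) a, f (P.reverse a) = -f P)
    (hlin : ∀ (P : BGraph O) v, IsLinearMap k fun p => f (P.setLabel v p)) :
    BSpace O →ₗ[k] M :=
  Submodule.liftQ _ (Finsupp.linearCombination k f) (by
    rw [Submodule.span_le]
    rintro _ (e | ⟨P, a⟩ | ⟨P, v, p, q⟩ | ⟨P, v, c, p⟩)
    · simp [hiso e]
    · simp [hrev]
    · simp [(hlin P v).map_add]
    · simp [(hlin P v).map_smul])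

@[simp] lemma lift_cls (f : BGraph O → M) (h1 h2 h3) (P : BGraph O) :
    lift (k := k) f h1 h2 h3 P.cls = f P := by
  simp [lift, BGraph.cls]

lemma span_cls : Submodule.span k (Set.range (BGraph.cls (O := O))) = ⊤ := by
  rw [eq_top_iff]
  rintro x -
  obtain ⟨y, rfl⟩ := Submodule.Quotient.mk_surjective _ x
  induction y using Finsupp.induction_linear with
  | zero => exact Submodule.zero_mem _
  | add a b ha hb => exact Submodule.add_mem _ ha hb
  | single P c =>
    rw [BGraph.mk_single]
    exact Submodule.smul_mem _ _ (Submodule.subset_span ⟨P, rfl⟩)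

lemma hom_ext {f g : BSpace O →ₗ[k] M} (h : ∀ P : BGraph O, f P.cls = g P.cls) : f = g :=
  LinearMap.ext_on span_cls (by rintro _ ⟨P, rfl⟩; exact h P)

end BSpace

namespace OGraph

/-! ### Contraction and similarities -/

section

variable (G : OGraph O) (a : G.H)

/-- As `cproj` is surjective, its fibres describe the contracted vertex set completely; all
comparisons of vertices after contractions are reduced to this relation. -/
lemma cproj_eq_iff {v w : G.V} : G.cproj a v = G.cproj a w ↔
    v = w ∨ ((v = G.vert a ∨ v = G.vert (G.inv a)) ∧ (w = G.vert a ∨ w = G.vert (G.inv a))) := by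
  by_cases hw : w = G.vert a ∨ w = G.vert (G.inv a)
  · rw [(G.cproj_eq_none a).2 hw, cproj_eq_none]
    constructor
    · exact fun h => .inr ⟨h, hw⟩
    · rintro (rfl | h)
      · exact hw
      · exact h.1
  · have hw' : w ≠ G.vert a ∧ w ≠ G.vert (G.inv a) := by tauto
    rw [show G.cproj a w = some ⟨w, hw'⟩ from (G.cproj_eq_some a).2 rfl, cproj_eq_some]
    tauto

lemma cproj_vert : G.cproj a (G.vert a) = none := (G.cproj_eq_none a).2 (.inl rfl)

lemma cproj_surjective : Function.Surjective (G.cproj a)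
  | none => ⟨_, G.cproj_vert a⟩
  | some z => ⟨z.1, (G.cproj_eq_some a).2 rfl⟩

lemma CV_cases (w : G.CV a) :
    w = none ∨ ∃ v, (v ≠ G.vert a ∧ v ≠ G.vert (G.inv a)) ∧ w = G.cproj a v := by
  rcases w with _ | z
  · exact .inl rfl
  · exact .inr ⟨z.1, z.2, ((G.cproj_eq_some a).2 rfl).symm⟩

lemma contract_ord (hl : G.vert a ≠ G.vert (G.inv a)) : (G.contract a hl).ord =
    none :: (G.ord.filter (fun w => w ≠ G.vert a ∧ w ≠ G.vert (G.inv a))).map (G.cproj a) := by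
  change none :: G.ord.filterMap _ = _
  congr 1
  induction G.ord with
  | nil => rfl
  | cons w l ih =>
    by_cases hw : w ≠ G.vert a ∧ w ≠ G.vert (G.inv a)
    · rw [List.filterMap_cons_some (b := some ⟨w, hw⟩) (by simp [hw]), ih,
        List.filter_cons_of_pos (by simpa using hw), List.map_cons,
        (G.cproj_eq_some a (z := ⟨w, hw⟩)).2 rfl]
    · rw [List.filterMap_cons_none (by simp only [dif_neg hw]), ih,
        List.filter_cons_of_neg (by simpa using hw)]

end

lemma sperm_erase {α : Type*} (a : α) : ∀ l : List α, a ∈ l →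
    SPerm ((-1) ^ l.idxOf a) l (a :: l.erase a)
  | [], h => by simp at h
  | x :: l, h => by
    by_cases hx : x = a
    · subst hx
      exact (SPerm.of_eq (by simp)).cast (by simp)
    · have ha : a ∈ l := (List.mem_cons.1 h).resolve_left (Ne.symm hx)
      rw [List.idxOf_cons_ne _ hx, List.erase_cons_tail (by simpa using hx)]
      exact (((sperm_erase a l ha).cons x).trans (.swap a x _)).cast (by simp [pow_succ])

section

variable (G : OGraph O) (a : G.H)

/-- The vertices that are not ends of the edge of `a`, in order. -/
def rest : List G.V := G.ord.filter fun w => w ≠ G.vert a ∧ w ≠ G.vert (G.inv a)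

/-- The sign of moving the ends of the edge of `a` to the front. -/
def endSign : ℤˣ :=
  (-1) ^ (G.ord.idxOf (G.vert a) + (G.ord.erase (G.vert a)).idxOf (G.vert (G.inv a)))

/-- `1` if the edge of `a` is directed away from `a`, and `-1` otherwise. -/
def tau : ℤˣ := if G.tail a then 1 else -1

lemma contractSign_eq : G.contractSign a = sg k (G.tau a * G.endSign a) := by
  rw [contractSign, tau, endSign, sg_mul, sg_pow, sg_neg, sg_one]
  split_ifs <;> simp

lemma tau_inv : G.tau (G.inv a) = -G.tau a := by
  unfold tau
  rw [G.tail_inv]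
  cases G.tail a <;> simp

/-- This turns the exponents in the definition of the contraction sign into a signed permutation,
the form in which such signs can be composed. -/
lemma sperm_ends (hl : G.vert a ≠ G.vert (G.inv a)) :
    SPerm (G.endSign a) G.ord (G.vert a :: G.vert (G.inv a) :: G.rest a) := by
  have h1 := sperm_erase (G.vert a) G.ord (G.mem_ord _)
  have h2 := sperm_erase (G.vert (G.inv a)) (G.ord.erase (G.vert a))
    ((List.mem_erase_of_ne hl.symm).2 (G.mem_ord _))
  have h3 : (G.ord.erase (G.vert a)).erase (G.vert (G.inv a)) = G.rest a := by
    rw [(G.ord_nodup.erase _).erase_eq_filter, G.ord_nodup.erase_eq_filter, List.filter_filter,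
      rest]
    congr 1
    funext w
    simp only [ne_eq, bne, Bool.decide_and, decide_not, Bool.and_comm]
    rfl
  rw [h3] at h2
  exact (h1.trans (h2.cons _)).cast (by rw [endSign, pow_add])

lemma contract_ord' (hl : G.vert a ≠ G.vert (G.inv a)) :
    (G.contract a hl).ord = none :: (G.rest a).map (G.cproj a) := G.contract_ord a hl

lemma exists_lab_contract_none (hl : G.vert a ≠ G.vert (G.inv a)) :
    ∃ (A : Type) (_ : Finite A) (B : Type) (_ : Finite B) (j : Option A → G.H)
      (p : O.obj (Option A)) (j' : Option B → G.H) (q : O.obj (Option B)) (J : A ⊕ B → G.CH a),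
      j none = a ∧ G.Lab (G.vert a) j p ∧ j' none = G.inv a ∧ G.Lab (G.vert (G.inv a)) j' q ∧
      (∀ x, (J (.inl x)).1 = j (some x)) ∧ ∀ x, (J (.inr x)).1 = j' (some x) := by
  obtain ⟨A, _, j, p, hj, h⟩ := G.exists_lab_option a
  obtain ⟨B, _, j', q, hj', h'⟩ := G.exists_lab_option (G.inv a)
  refine ⟨A, inferInstance, B, inferInstance, j, p, j', q, Sum.elim (fun x => ⟨j (some x), ?_, ?_⟩)
    (fun x => ⟨j' (some x), ?_, ?_⟩), hj, h, hj', h', fun x => rfl, fun x => rfl⟩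
  · exact fun e => by simpa using h.inj (e.trans hj.symm)
  · exact fun e => hl (by rw [← h.mem (some x), e])
  · exact fun e => hl (by rw [← h'.mem (some x), e])
  · exact fun e => by simpa using h'.inj (e.trans hj'.symm)

lemma exists_lift_CH {G : OGraph O} (a : G.H) {v : G.V} {S : Type} {j : S → G.H}
    (h : ∀ s, G.vert (j s) = v) (hv : v ≠ G.vert a ∧ v ≠ G.vert (G.inv a)) :
    ∃ J : S → G.CH a, ∀ s, (J s).1 = j s :=
  ⟨fun s => ⟨j s, fun e => hv.1 (by rw [← h s, e]), fun e => hv.2 (by rw [← h s, e])⟩,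
    fun _ => rfl⟩

/-- A similarity from a contracted graph, with the labels given in coordinates of the original
graph. -/
def Sim.ofContract (hl : G.vert a ≠ G.vert (G.inv a)) {G' : OGraph O}
    (onV : G.CV a ≃ G'.V) (onH : G.CH a ≃ G'.H)
    (vert : ∀ x : G.CH a, G'.vert (onH x) = onV (G.cproj a (G.vert x.1)))
    (lab_some : ∀ (w : G.V), w ≠ G.vert a ∧ w ≠ G.vert (G.inv a) →
      ∀ (S : Type) [Finite S] (j : S → G.H) (p : O.obj S) (J : S → G.CH a), G.Lab w j p →
      (∀ s, (J s).1 = j s) → G'.Lab (onV (G.cproj a w)) (onH ∘ J) p)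
    (lab_none : ∀ (A B : Type) [Finite A] [Finite B] (j : Option A → G.H) (p : O.obj (Option A))
      (j' : Option B → G.H) (q : O.obj (Option B)) (J : A ⊕ B → G.CH a),
      j none = a → G.Lab (G.vert a) j p → j' none = G.inv a → G.Lab (G.vert (G.inv a)) j' q →
      (∀ x, (J (.inl x)).1 = j (some x)) → (∀ x, (J (.inr x)).1 = j' (some x)) →
      G'.Lab (onV none) (onH ∘ J) (O.comp p q)) :
    Sim (G.contract a hl) G' :=
  Sim.ofLab (G := G.contract a hl) onV onH vert (fun w => by
    rcases G.CV_cases a w with rfl | ⟨v, hv, rfl⟩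
    · obtain ⟨A, _, B, _, j, p, j', q, J, h1, h2, h3, h4, h5, h6⟩ := G.exists_lab_contract_none a hl
      exact ⟨A ⊕ B, inferInstance, J, O.comp p q, h2.contract_none hl h1 h4 h3 h5 h6,
        lab_none A B j p j' q J h1 h2 h3 h4 h5 h6⟩
    · have h := G.lab_label v
      obtain ⟨J, hJ⟩ := exists_lift_CH a h.mem hv
      exact ⟨_, inferInstance, J, G.label v, h.contract_some hl hv hJ,
        lab_some v hv _ _ _ J h hJ⟩)

end

section

variable {G G' : OGraph O} (e : Sim G G') {a : G.H}

lemma Sim.vert_inv (hinv : e.onH (G.inv a) = G'.inv (e.onH a)) :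
    G'.vert (G'.inv (e.onH a)) = e.onV (G.vert (G.inv a)) := by
  rw [← hinv, e.vert]

variable (hinv : e.onH (G.inv a) = G'.inv (e.onH a))

/-- The similarity between contracted graphs induced by a similarity. -/
def Sim.contract (hl : G.vert a ≠ G.vert (G.inv a))
    (hl' : G'.vert (e.onH a) ≠ G'.vert (G'.inv (e.onH a))) :
    Sim (G.contract a hl) (G'.contract (e.onH a) hl') :=
  Sim.ofContract G a hl (G' := G'.contract (e.onH a) hl')
    (Equiv.optionCongr (e.onV.subtypeEquiv fun w => by
      rw [e.vert_inv hinv, e.vert, e.onV.injective.ne_iff, e.onV.injective.ne_iff]))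
    (e.onH.subtypeEquiv fun x => by
      rw [← hinv, e.onH.injective.ne_iff, e.onH.injective.ne_iff])
    (fun x => by
      change G'.cproj (e.onH a) (G'.vert (e.onH x.1)) = _
      rw [e.vert]
      by_cases hx : G.vert x.1 ≠ G.vert a ∧ G.vert x.1 ≠ G.vert (G.inv a)
      · rw [(G.cproj_eq_some a (z := ⟨_, hx⟩)).2 rfl]
        exact (G'.cproj_eq_some _).2 rfl
      · rw [(G.cproj_eq_none a).2 (by tauto), (G'.cproj_eq_none _).2]
        · rfl
        · rw [e.vert_inv hinv, e.vert, e.onV.injective.eq_iff, e.onV.injective.eq_iff]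
          tauto)
    (fun w hw S _ j p J h hJ => by
      have hw' : e.onV w ≠ G'.vert (e.onH a) ∧ e.onV w ≠ G'.vert (G'.inv (e.onH a)) := by
        rw [e.vert_inv hinv, e.vert, Ne, Ne, e.onV.injective.eq_iff, e.onV.injective.eq_iff]
        exact hw
      have h2 := (e.lab _ _ _ _ h).contract_some hl' hw' (J := e.onH.subtypeEquiv (fun x => by
        rw [← hinv, e.onH.injective.ne_iff, e.onH.injective.ne_iff]) ∘ J)
        (fun s => congrArg e.onH (hJ s))
      convert h2 using 1
      rw [(G.cproj_eq_some a (z := ⟨_, hw⟩)).2 rfl, (G'.cproj_eq_some _ (z := ⟨_, hw'⟩)).2 rfl]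
      rfl)
    (fun A B _ _ j p j' q J hj h hj' h' hJ hJ' => by
      have h2 := e.lab _ _ _ _ h
      have h3 := e.lab _ _ _ _ h'
      rw [← e.vert] at h2 h3
      rw [hinv] at h3
      exact h2.contract_none hl' (by simp [hj]) h3 (by simp [hj', hinv])
        (fun s => congrArg e.onH (hJ s)) (fun s => congrArg e.onH (hJ' s)))

lemma Sim.contract_onV (hl hl') (w : G.V) :
    (e.contract hinv hl hl').onV (G.cproj a w) = G'.cproj (e.onH a) (e.onV w) := by
  by_cases hw : w ≠ G.vert a ∧ w ≠ G.vert (G.inv a)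
  · have hw' : e.onV w ≠ G'.vert (e.onH a) ∧ e.onV w ≠ G'.vert (G'.inv (e.onH a)) := by
      rw [e.vert_inv hinv, e.vert, Ne, Ne, e.onV.injective.eq_iff, e.onV.injective.eq_iff]
      exact hw
    rw [(G.cproj_eq_some a (z := ⟨_, hw⟩)).2 rfl, (G'.cproj_eq_some _ (z := ⟨_, hw'⟩)).2 rfl]
    rfl
  · rw [(G.cproj_eq_none a).2 (by tauto), (G'.cproj_eq_none _).2]
    · rfl
    · rw [e.vert_inv hinv, e.vert, e.onV.injective.eq_iff, e.onV.injective.eq_iff]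
      tauto

end

end OGraph

/-! ### Dependence of a contraction on directions and labels -/

namespace OGraph

/-- Replace the edges, their directions, and the labels. -/
def wire (G : OGraph O) (i : Equiv.Perm G.H) (t : G.H → Bool)
    (L : ∀ v, O.obj {h // G.vert h = v}) (h1 : ∀ h, i (i h) = h)
    (h2 : ∀ h, i h ≠ h) (h3 : ∀ h, t (i h) = !t h) : OGraph O :=
  { G with
    inv := i
    inv_inv := h1
    inv_ne := h2
    tail := t
    tail_inv := h3
    label := L }

lemma clabel_reverse (G : OGraph O) (a b : G.H) (hl : G.vert a ≠ G.vert (G.inv a)) :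
    (G.reverse b).clabel a hl = G.clabel a hl := by
  funext w
  cases w <;> rfl

/-- Replace the labels. -/
def withLabel (G : OGraph O) (L : ∀ v, O.obj {h // G.vert h = v}) : OGraph O :=
  { G with label := L }

/-- Only the vertex under `v` notices a change of the label at `v`, and it does so linearly because
`comp` is bilinear and `map` is linear. -/
lemma contract_setLabel (G : OGraph O) (a : G.H) (hl : G.vert a ≠ G.vert (G.inv a)) (v : G.V)
    (w : (G.contract a hl).V) (hw : w = G.cproj a v) :
    ∃ T : O.obj {h // G.vert h = v} →ₗ[k] O.obj {x // (G.contract a hl).vert x = w},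
      ∀ p, (G.setLabel v p).contract a hl = (G.contract a hl).setLabel w (T p) := by
  suffices h : ∃ T : O.obj {h // G.vert h = v} →ₗ[k] O.obj {x // (G.contract a hl).vert x = w},
      ∀ p, (G.setLabel v p).clabel a hl w = T p ∧
        ∀ z, z ≠ w → (G.setLabel v p).clabel a hl z = G.clabel a hl z by
    obtain ⟨T, hT⟩ := h
    exact ⟨T, fun p => congrArg (G.contract a hl).withLabel
      ((@Function.eq_update_iff _ _ (fun _ _ => Classical.propDecidable _) _ _ _ _).2 (hT p))⟩
  rcases w with _ | z
  -- Here `v` is an end of the contracted edge, and `T` composes with the fixed label of the other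
  -- end. The ends are distinct, so that label is not updated.
  · rcases (G.cproj_eq_none a).1 hw.symm with rfl | rfl
    · refine ⟨O.map (G.fiberNone a hl) ∘ₗ O.comp.flip (O.map (Equiv.optionSubtypeNe
        (⟨G.inv a, rfl⟩ : {h // G.vert h = G.vert (G.inv a)})).symm (G.label (G.vert (G.inv a)))) ∘ₗ
        O.map (Equiv.optionSubtypeNe (⟨a, rfl⟩ : {h // G.vert h = G.vert a})).symm,
        fun p => ⟨?_, ?_⟩⟩
      · change O.map (G.fiberNone a hl) (O.comp (O.map _ (Function.update G.label _ p (G.vert a)))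
          (O.map _ (Function.update G.label _ p (G.vert (G.inv a))))) = _
        rw [Function.update_self, Function.update_of_ne hl.symm]
        rfl
      · rintro (_ | z) hz
        · exact absurd rfl hz
        exact congrArg (O.map (G.fiberSome a z)) (Function.update_of_ne z.2.1 _ _)
    · refine ⟨O.map (G.fiberNone a hl) ∘ₗ O.comp (O.map (Equiv.optionSubtypeNe
        (⟨a, rfl⟩ : {h // G.vert h = G.vert a})).symm (G.label (G.vert a))) ∘ₗ
        O.map (Equiv.optionSubtypeNe
          (⟨G.inv a, rfl⟩ : {h // G.vert h = G.vert (G.inv a)})).symm,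
        fun p => ⟨?_, ?_⟩⟩
      · change O.map (G.fiberNone a hl) (O.comp (O.map _ (Function.update G.label _ p (G.vert a)))
          (O.map _ (Function.update G.label _ p (G.vert (G.inv a))))) = _
        rw [Function.update_self, Function.update_of_ne hl]
        rfl
      · rintro (_ | z) hz
        · exact absurd rfl hz
        exact congrArg (O.map (G.fiberSome a z)) (Function.update_of_ne z.2.2 _ _)
  · obtain rfl := (G.cproj_eq_some a).1 hw.symm
    refine ⟨O.map (G.fiberSome a z), fun p => ⟨?_, ?_⟩⟩
    · have : Function.update G.label z.1 p z.1 = p := Function.update_self _ _ _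
      exact congrArg (O.map (G.fiberSome a z)) this
    rintro (_ | y) hy
    · change O.map (G.fiberNone a hl) (O.comp (O.map _ (Function.update G.label _ p (G.vert a)))
          (O.map _ (Function.update G.label _ p (G.vert (G.inv a))))) = _
      rw [Function.update_of_ne z.2.1.symm, Function.update_of_ne z.2.2.symm]
      rfl
    · exact congrArg (O.map (G.fiberSome a y))
        (Function.update_of_ne (fun e => hy (congrArg some (Subtype.ext e))) _ _)

lemma map_contract_ord (G : OGraph O) (a : G.H) (hl : G.vert a ≠ G.vert (G.inv a)) {X : Type}
    (f : (G.contract a hl).V → X) : (G.contract a hl).ord.map f =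
      f (G.cproj a (G.vert a)) :: (G.rest a).map fun w => f (G.cproj a w) := by
  have h := congrArg (List.map f) (G.contract_ord' a hl)
  rw [cproj_vert]
  exact h.trans (congrArg _ (List.map_map ..))

end OGraph

/-! ### Contraction of an edge in a blocked graph -/

namespace BGraph

open OGraph

/-- Replace the edges, their directions, and the labels. -/
def wire (P : BGraph O) (i : Equiv.Perm P.G.H) (t : P.G.H → Bool)
    (L : ∀ v, O.obj {h // P.G.vert h = v}) (h1 : ∀ h, i (i h) = h)
    (h2 : ∀ h, i h ≠ h) (h3 : ∀ h, t (i h) = !t h)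
    (h4 : ∀ h, P.blk (P.G.vert (i h)) = P.blk (P.G.vert h)) : BGraph O :=
  ⟨P.G.wire i t L h1 h2 h3, P.B, P.blk, h4⟩

/-- Graphs differing only in edges, directions and labels share the types on which these data live,
so their equality can be checked field by field. -/
lemma wire_congr (P : BGraph O) {i i' : Equiv.Perm P.G.H} {t t' : P.G.H → Bool}
    {L L' : ∀ v, O.obj {h // P.G.vert h = v}} (hi : i = i') (ht : t = t') (hL : L = L')
    (h1 h2 h3 h4 h1' h2' h3' h4') :
    P.wire i t L h1 h2 h3 h4 = P.wire i' t' L' h1' h2' h3' h4' := by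
  subst hi ht hL
  rfl

section Contract

variable (P : BGraph O) (a : P.G.H)

/-- Contraction of an edge that is not a loop. -/
def contr (hl : P.G.vert a ≠ P.G.vert (P.G.inv a)) : BGraph O where
  G := P.G.contract a hl
  B := P.B
  blk := fun o : P.G.CV a => o.elim (P.blk (P.G.vert a)) fun z => P.blk z.1
  blk_inv := by
    have h : ∀ w : P.G.V, ((P.G.cproj a w : P.G.CV a).elim (P.blk (P.G.vert a))
        fun z => P.blk z.1) = P.blk w := by
      intro w
      unfold cproj
      split_ifs with hw
      · rfl
      · by_cases h : w = P.G.vert a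
        · rw [h]; rfl
        · have : w = P.G.vert (P.G.inv a) := by tauto
          rw [this, P.blk_inv]; rfl
    intro x
    exact (h _).trans ((P.blk_inv x.1).trans (h _).symm)

lemma contr_blk (hl) (w : P.G.V) : (P.contr a hl).blk (P.G.cproj a w) = P.blk w := by
  change ((P.G.cproj a w : P.G.CV a).elim (P.blk (P.G.vert a)) fun z => P.blk z.1) = P.blk w
  unfold cproj
  split_ifs with hw
  · rfl
  · by_cases h : w = P.G.vert a
    · rw [h]; rfl
    · have : w = P.G.vert (P.G.inv a) := by tauto
      rw [this, P.blk_inv]; rfl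

/-- The class of the contraction of an edge, with its sign; it is `0` for a loop. -/
def pcontract : BSpace O :=
  if hl : P.G.vert a = P.G.vert (P.G.inv a) then 0
  else P.G.contractSign a • (P.contr a hl).cls

lemma pcontract_of_loop (hl : P.G.vert a = P.G.vert (P.G.inv a)) : P.pcontract a = 0 :=
  dif_pos hl

lemma pcontract_of_ne (hl : P.G.vert a ≠ P.G.vert (P.G.inv a)) :
    P.pcontract a = sg k (P.G.tau a * P.G.endSign a) • (P.contr a hl).cls := by
  rw [pcontract, dif_neg hl, contractSign_eq]

/-- The remaining vertices may be listed in any convenient order `l`; the sign records the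
difference from the order used by the contraction. -/
lemma contr_ord {hl} {s : ℤˣ} {l : List P.G.V}
    (hs : SPerm s P.G.ord (P.G.vert a :: P.G.vert (P.G.inv a) :: l))
    {X : Type} (f : (P.contr a hl).G.V → X) :
    SPerm (P.G.endSign a * s) ((P.contr a hl).G.ord.map f)
      (f (P.G.cproj a (P.G.vert a)) :: l.map fun w => f (P.G.cproj a w)) := by
  have h1 := (P.G.sperm_ends a hl).symm.trans hs
  have hn := (P.G.sperm_ends a hl).perm.nodup_iff.1 P.G.ord_nodup
  have h2 : SPerm _ (P.G.rest a) l := (h1.of_cons hn).of_cons (List.nodup_cons.1 hn).2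
  exact ((SPerm.of_eq (map_contract_ord P.G a hl f)).trans ((h2.map _).cons _)).cast (one_mul _)

variable {P a} in
/-- A similarity from a contracted graph as an isomorphism of blocked graphs. -/
def isoOfContract (hl : P.G.vert a ≠ P.G.vert (P.G.inv a)) {Q : BGraph O}
    (e : Sim (P.G.contract a hl) Q.G)
    (inv : ∀ x, Q.G.inv (e.onH x) = e.onH ((P.G.contract a hl).inv x))
    (tail : ∀ x, Q.G.tail (e.onH x) = (P.G.contract a hl).tail x) (onB : P.B ≃ Q.B)
    (blk : ∀ w : P.G.V, Q.blk (e.onV (P.G.cproj a w)) = onB (P.blk w)) {s t : ℤˣ}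
    {l : List P.G.V}
    (hs : SPerm s P.G.ord (P.G.vert a :: P.G.vert (P.G.inv a) :: l))
    (ht : SPerm t (e.onV (P.G.cproj a (P.G.vert a)) ::
      l.map fun w => e.onV (P.G.cproj a w)) Q.G.ord) :
    Iso (P.contr a hl) Q (P.G.endSign a * s * t) where
  toSim := e
  inv := inv
  tail := tail
  onB := onB
  blk w := by
    obtain ⟨w, rfl⟩ := P.G.cproj_surjective a w
    exact (blk w).trans (congrArg onB (P.contr_blk a hl w).symm)
  ord := (P.contr_ord a hs e.onV).trans ht

variable {P a} in
-- The position-dependent `endSign` occurs in the contraction sign and again in the comparison with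
-- `Q`, and cancels.
lemma pcontract_eq {hl : P.G.vert a ≠ P.G.vert (P.G.inv a)} {Q : BGraph O} {s : ℤˣ}
    (e : Iso (P.contr a hl) Q (P.G.endSign a * s)) :
    P.pcontract a = sg k (P.G.tau a * s) • Q.cls := by
  rw [P.pcontract_of_ne a hl, eq_sg_smul_comm k (cls_iso e), smul_smul, ← sg_mul]
  congr 2
  have := Int.units_mul_self (P.G.endSign a)
  calc _ = P.G.tau a * (P.G.endSign a * P.G.endSign a) * s := by ac_rfl
    _ = _ := by rw [this, mul_one]

/-- The isomorphism of contracted graphs induced by an isomorphism. -/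
def Iso.contr {P Q : BGraph O} {s : ℤˣ} (e : Iso P Q s) {a : P.G.H}
    (hl : P.G.vert a ≠ P.G.vert (P.G.inv a))
    (hl' : Q.G.vert (e.onH a) ≠ Q.G.vert (Q.G.inv (e.onH a))) :
    Iso (P.contr a hl) (Q.contr (e.onH a) hl')
      (P.G.endSign a * s * Q.G.endSign (e.onH a)) where
  toSim := e.toSim.contract (e.inv a).symm hl hl'
  inv x := Subtype.ext (e.inv x.1)
  tail x := e.tail x.1
  onB := e.onB
  blk w := by
    obtain ⟨w, rfl⟩ := P.G.cproj_surjective a w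
    refine (congrArg (Q.contr (e.onH a) hl').blk
      (e.toSim.contract_onV (e.inv a).symm hl hl' w)).trans ?_
    rw [contr_blk]
    exact (e.blk w).trans (congrArg e.onB (P.contr_blk a hl w).symm)
  ord := by
    have hab : e.onV (P.G.vert (P.G.inv a)) = Q.G.vert (Q.G.inv (e.onH a)) := by
      rw [e.inv, e.vert]
    have h1 := (((P.G.sperm_ends a hl).map e.onV).symm.trans e.ord).trans
      (Q.G.sperm_ends (e.onH a) hl')
    rw [List.map_cons, List.map_cons, hab, ← e.vert] at h1
    have hn := h1.symm.perm.nodup_iff.1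
      ((Q.G.sperm_ends (e.onH a) hl').perm.nodup_iff.1 Q.G.ord_nodup)
    have h2 := ((h1.of_cons hn).of_cons (List.nodup_cons.1 hn).2).map (Q.G.cproj (e.onH a))
    refine SPerm.trans (s := 1) (SPerm.of_eq ?_) ((h2.cons (none : Q.G.CV (e.onH a))).trans
      (SPerm.of_eq (contract_ord' Q.G _ hl').symm)) |>.cast (by simp)
    refine (map_contract_ord P.G a hl (e.toSim.contract (e.inv a).symm hl hl').onV).trans ?_
    rw [List.map_map]
    refine congrArg₂ _ ?_ (List.map_congr_left fun w _ =>
      e.toSim.contract_onV (e.inv a).symm hl hl' w)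
    rw [cproj_vert]
    rfl

lemma Iso.loop_iff {P Q : BGraph O} {s : ℤˣ} (e : Iso P Q s) (a : P.G.H) :
    Q.G.vert (e.onH a) = Q.G.vert (Q.G.inv (e.onH a)) ↔
      P.G.vert a = P.G.vert (P.G.inv a) := by
  rw [e.inv, e.vert, e.vert, e.onV.injective.eq_iff]

lemma Iso.tau {P Q : BGraph O} {s : ℤˣ} (e : Iso P Q s) (a : P.G.H) :
    Q.G.tau (e.onH a) = P.G.tau a := by
  rw [OGraph.tau, OGraph.tau, e.tail]

/-- The contracted graphs differ by `s` times both signs of moving the ends to the front, and these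
two are absorbed by the signs in the two contraction classes. -/
lemma pcontract_iso {P Q : BGraph O} {s : ℤˣ} (e : Iso P Q s) (a : P.G.H) :
    Q.pcontract (e.onH a) = sg k s • P.pcontract a := by
  by_cases hl : P.G.vert a = P.G.vert (P.G.inv a)
  · rw [P.pcontract_of_loop a hl, Q.pcontract_of_loop _ ((e.loop_iff a).2 hl), smul_zero]
  · have hl' := (e.loop_iff a).not.2 hl
    rw [P.pcontract_of_ne a hl, Q.pcontract_of_ne _ hl', cls_iso (e.contr hl hl'), smul_smul,
      smul_smul, ← sg_mul, ← sg_mul, e.tau]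
    congr 2
    have := Int.units_mul_self (Q.G.endSign (e.onH a))
    calc _ = s * (P.G.tau a * P.G.endSign a) *
          (Q.G.endSign (e.onH a) * Q.G.endSign (e.onH a)) := by ac_rfl
      _ = _ := by rw [this, mul_one]

lemma pcontract_reverse (b : P.G.H) : (P.reverse b).pcontract a = -P.pcontract a := by
  by_cases hl : P.G.vert a = P.G.vert (P.G.inv a)
  · rw [P.pcontract_of_loop a hl, (P.reverse b).pcontract_of_loop a hl, neg_zero]
  · rw [P.pcontract_of_ne a hl, (P.reverse b).pcontract_of_ne a hl]
    have hE : (P.reverse b).G.endSign a = P.G.endSign a := rfl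
    rw [hE]
    -- Reversing the contracted edge changes only `tau`; reversing any other edge survives as a
    -- reversal in the contracted graph.
    by_cases hb : b = a ∨ b = P.G.inv a
    · have hab : a = b ∨ a = P.G.inv b :=
        hb.imp Eq.symm fun h => by rw [h, P.G.inv_inv]
      have hT : (P.reverse b).G.tau a = -P.G.tau a := by
        change (if (if a = b ∨ a = P.G.inv b then !P.G.tail a else P.G.tail a) = true
          then 1 else -1) = -(if P.G.tail a = true then (1 : ℤˣ) else -1)
        rw [if_pos hab]
        cases P.G.tail a <;> simp
      have hc : (P.reverse b).contr a hl = P.contr a hl := by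
        refine wire_congr (P.contr a hl) (i := (P.contr a hl).G.inv) rfl ?_
          (P.G.clabel_reverse a b hl) (P.contr a hl).G.inv_inv
          (P.contr a hl).G.inv_ne ((P.reverse b).contr a hl).G.tail_inv
          (P.contr a hl).blk_inv (P.contr a hl).G.inv_inv
          (P.contr a hl).G.inv_ne (P.contr a hl).G.tail_inv (P.contr a hl).blk_inv
        funext x
        refine if_neg ?_
        rcases hb with rfl | rfl
        · exact fun h => h.elim x.2.1 x.2.2
        · rw [P.G.inv_inv]
          exact fun h => h.elim x.2.2 x.2.1
      rw [hT, hc, neg_mul, sg_neg, neg_smul]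
    · have hba : b ≠ a ∧ b ≠ P.G.inv a := by tauto
      have hT : (P.reverse b).G.tau a = P.G.tau a := by
        change (if (if a = b ∨ a = P.G.inv b then !P.G.tail a else P.G.tail a) = true
          then 1 else -1) = (if P.G.tail a = true then (1 : ℤˣ) else -1)
        rw [if_neg (c := a = b ∨ a = P.G.inv b)]
        rintro (h | h)
        · exact hba.1 h.symm
        · exact hba.2 (by rw [h, P.G.inv_inv])
      have hc : (P.reverse b).contr a hl = (P.contr a hl).reverse (⟨b, hba⟩ : P.G.CH a) := by
        refine wire_congr (P.contr a hl) (i := (P.contr a hl).G.inv) rfl ?_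
          (P.G.clabel_reverse a b hl) (P.contr a hl).G.inv_inv
          (P.contr a hl).G.inv_ne ((P.reverse b).contr a hl).G.tail_inv
          (P.contr a hl).blk_inv (P.contr a hl).G.inv_inv
          (P.contr a hl).G.inv_ne
          ((P.contr a hl).reverse (⟨b, hba⟩ : P.G.CH a)).G.tail_inv (P.contr a hl).blk_inv
        funext x
        refine if_congr ?_ rfl rfl
        exact or_congr ⟨fun h => Subtype.ext h, fun h => congrArg Subtype.val h⟩
          ⟨fun h => Subtype.ext h, fun h => congrArg Subtype.val h⟩
      rw [hT, hc]
      exact (congrArg _ (cls_reverse _ _)).trans (smul_neg _ _)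

lemma isLinearMap_pcontract (v : P.G.V) :
    IsLinearMap k fun p => (P.setLabel v p).pcontract a := by
  by_cases hl : P.G.vert a = P.G.vert (P.G.inv a)
  · have : (fun p => (P.setLabel v p).pcontract a) = fun _ => 0 :=
      funext fun p => (P.setLabel v p).pcontract_of_loop a hl
    rw [this]
    exact (0 : _ →ₗ[k] BSpace O).isLinear
  · obtain ⟨T, hT⟩ := P.G.contract_setLabel a hl v _ rfl
    have h : ∀ p, (P.setLabel v p).contr a hl = (P.contr a hl).setLabel (P.G.cproj a v) (T p) := by
      intro p
      have key : ∀ (G' G'' : OGraph O) (e : G' = G'') (f' : G'.V → P.B) (f'' : G''.V → P.B)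
          (_ : HEq f' f'') (h' h''), BGraph.mk G' P.B f' h' = BGraph.mk G'' P.B f'' h'' := by
        rintro G' _ rfl f' _ ⟨⟩ _ _
        rfl
      exact key _ _ (hT p) _ _ HEq.rfl _ _
    have : (fun p => (P.setLabel v p).pcontract a) = fun p =>
        sg k (P.G.tau a * P.G.endSign a) • ((isLinearMap_cls (P.contr a hl) _).mk' _ ∘ₗ T) p := by
      funext p
      rw [(P.setLabel v p).pcontract_of_ne a hl, h]
      rfl
    rw [this]
    exact (sg k (P.G.tau a * P.G.endSign a) •
      ((isLinearMap_cls (P.contr a hl) (P.G.cproj a v)).mk' _ ∘ₗ T)).isLinear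

/-- The two contractions of an edge, at its two half-edges, are isomorphic. -/
lemma exists_iso_contr_inv (hl : P.G.vert a ≠ P.G.vert (P.G.inv a))
    (hl' : P.G.vert (P.G.inv a) ≠ P.G.vert (P.G.inv (P.G.inv a))) :
    ∃ e : Iso (P.contr a hl) (P.contr (P.G.inv a) hl')
        (P.G.endSign a * -P.G.endSign (P.G.inv a)),
      ∀ x : P.G.CH a, (e.onH x : P.G.CH (P.G.inv a)).1 = x.1 := by
  have hb := P.G.inv_inv a
  have hV : ∀ w, w ≠ P.G.vert a ∧ w ≠ P.G.vert (P.G.inv a) ↔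
      w ≠ P.G.vert (P.G.inv a) ∧ w ≠ P.G.vert (P.G.inv (P.G.inv a)) := by
    intro w
    rw [hb, and_comm]
  have hH : ∀ x, x ≠ a ∧ x ≠ P.G.inv a ↔ x ≠ P.G.inv a ∧ x ≠ P.G.inv (P.G.inv a) := by
    intro w
    rw [hb, and_comm]
  have hproj : ∀ w, (Equiv.subtypeEquivRight hV).optionCongr (P.G.cproj a w) =
      P.G.cproj (P.G.inv a) w := by
    intro w
    by_cases hw : w ≠ P.G.vert a ∧ w ≠ P.G.vert (P.G.inv a)
    · rw [(P.G.cproj_eq_some a (z := ⟨w, hw⟩)).2 rfl]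
      exact ((P.G.cproj_eq_some (P.G.inv a) (z := ⟨w, (hV w).1 hw⟩)).2 rfl).symm
    · rw [(P.G.cproj_eq_none a).2 (by tauto),
        (P.G.cproj_eq_none (P.G.inv a)).2 (by rw [hb]; tauto)]
      rfl
  let e : Sim (P.G.contract a hl) (P.contr (P.G.inv a) hl').G :=
    Sim.ofContract P.G a hl (G' := P.G.contract (P.G.inv a) hl')
      (Equiv.subtypeEquivRight hV).optionCongr (Equiv.subtypeEquivRight hH)
      (fun x => (hproj _).symm)
      (fun w hw S _ j p J h hJ => by
        have := h.contract_some hl' ((hV w).1 hw)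
          (J := Equiv.subtypeEquivRight hH ∘ J) (fun s => hJ s)
        rw [← hproj] at this
        exact this)
      (fun A B _ _ j p j' q J hj h hj' h' hJ hJ' => by
        have h2 : P.G.Lab (P.G.vert (P.G.inv (P.G.inv a))) j p := by rwa [hb]
        have := h'.contract_none hl' hj' h2 (by rw [hj, hb])
          (J := Equiv.subtypeEquivRight hH ∘ J ∘ Equiv.sumComm B A)
          (fun x => hJ' x) (fun x => hJ x)
        rw [O.comp_comm] at this
        have h3 := (OGraph.lab_map _).1 this
        refine h3.congr fun x => ?_
        exact congrArg (Equiv.subtypeEquivRight hH ∘ J) (Sum.swap_swap x).symm)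
  -- The minus sign is the transposition of the two ends, which stand at the front in opposite
  -- orders.
  have hs : SPerm (-P.G.endSign (P.G.inv a)) P.G.ord
      (P.G.vert a :: P.G.vert (P.G.inv a) :: P.G.rest (P.G.inv a)) := by
    have := P.G.sperm_ends (P.G.inv a) hl'
    rw [hb] at this
    exact (this.trans (.swap _ _ _)).cast (by simp)
  exact ⟨{ toSim := e, inv := fun x => rfl, tail := fun x => rfl, onB := Equiv.refl _
           blk := fun w => by
            obtain ⟨w, rfl⟩ := P.G.cproj_surjective a w
            exact ((congrArg (P.contr (P.G.inv a) hl').blk (hproj w)).trans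
              (P.contr_blk _ hl' w)).trans (P.contr_blk a hl w).symm
           ord := ((P.contr_ord a hs e.onV).trans (SPerm.of_eq (by
            change _ = (P.G.contract (P.G.inv a) hl').ord
            rw [contract_ord']
            refine congrArg₂ _ ?_ (List.map_congr_left fun w _ => hproj w)
            rw [cproj_vert]
            rfl))).cast (mul_one _) }, fun x => rfl⟩

lemma loop_inv : P.G.vert (P.G.inv a) = P.G.vert (P.G.inv (P.G.inv a)) ↔
    P.G.vert a = P.G.vert (P.G.inv a) := by
  rw [P.G.inv_inv, eq_comm]

/-- Passing to the opposite half-edge transposes the two ends and turns the direction around; the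
two signs cancel, so the contraction depends on the edge only. -/
lemma pcontract_inv : P.pcontract (P.G.inv a) = P.pcontract a := by
  by_cases hl : P.G.vert a = P.G.vert (P.G.inv a)
  · rw [P.pcontract_of_loop a hl, P.pcontract_of_loop _ ((P.loop_inv a).2 hl)]
  · have hl' := (P.loop_inv a).not.2 hl
    obtain ⟨e, -⟩ := P.exists_iso_contr_inv a hl hl'
    rw [pcontract_eq e, P.pcontract_of_ne _ hl', tau_inv, neg_mul, mul_neg]

end Contract

end BGraph

/-! ### Two successive contractions -/

/-- Two surjections with the same fibres have the same target. -/
def equivOfSurjective {X Y Z : Type*} (f : X → Y) (g : X → Z) (hf : f.Surjective)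
    (hg : g.Surjective) (h : ∀ x y, f x = f y ↔ g x = g y) : Y ≃ Z where
  toFun y := g (Function.surjInv hf y)
  invFun z := f (Function.surjInv hg z)
  left_inv y := by
    rw [← Function.surjInv_eq hf y]
    refine (h _ _).2 ?_
    rw [Function.surjInv_eq hg, Function.surjInv_eq hf]
  right_inv z := by
    rw [← Function.surjInv_eq hg z]
    refine (h _ _).1 ?_
    rw [Function.surjInv_eq hg, Function.surjInv_eq hf]

lemma equivOfSurjective_apply {X Y Z : Type*} {f : X → Y} {g : X → Z} {hf : f.Surjective}
    {hg : g.Surjective} {h : ∀ x y, f x = f y ↔ g x = g y} (x : X) :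
    equivOfSurjective f g hf hg h (f x) = g x :=
  (h _ _).1 (Function.surjInv_eq hf _)

lemma exists_sperm_append {α : Type*} {l m : List α} (hm : m.Nodup) (h : ∀ x ∈ m, x ∈ l) :
    ∃ s r, SPerm s l (m ++ r) := by
  obtain ⟨s, hs⟩ := SPerm.exists_of_perm
    (List.subperm_append_diff_self_of_count_le (l₁ := m) (l₂ := l) fun x hx => by
      rw [List.count_eq_one_of_mem hm hx]
      exact List.count_pos_iff.2 (h x hx)).symm
  exact ⟨s, _, hs⟩

namespace OGraph

section Double

variable (G : OGraph O) (a c : G.H) (hl : G.vert a ≠ G.vert (G.inv a))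
  (hc : c ≠ a ∧ c ≠ G.inv a)

/-- The image of a half-edge in a contracted graph. -/
def toC : (G.contract a hl).H := (⟨c, hc⟩ : G.CH a)

/-- The image of a vertex under two contractions. -/
def proj2 (w : G.V) : (G.contract a hl).CV (G.toC a c hl hc) :=
  (G.contract a hl).cproj (G.toC a c hl hc) (G.cproj a w)

lemma proj2_surjective : Function.Surjective (G.proj2 a c hl hc) :=
  ((G.contract a hl).cproj_surjective _).comp (G.cproj_surjective a)

lemma proj2_eq_iff (v w : G.V) : G.proj2 a c hl hc v = G.proj2 a c hl hc w ↔
    G.cproj a v = G.cproj a w ∨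
    ((G.cproj a v = G.cproj a (G.vert c) ∨ G.cproj a v = G.cproj a (G.vert (G.inv c))) ∧
     (G.cproj a w = G.cproj a (G.vert c) ∨ G.cproj a w = G.cproj a (G.vert (G.inv c)))) :=
  (G.contract a hl).cproj_eq_iff _

/-- Identifying the ends of one edge and then those of the other generates the same equivalence
relation in either order. The roles are symmetric, so one implication is enough. -/
lemma merge_merge_comm {α : Type*} {x₁ x₂ y₁ y₂ v w : α}
    (h : (v = w ∨ (v = x₁ ∨ v = x₂) ∧ (w = x₁ ∨ w = x₂)) ∨
      ((v = y₁ ∨ (v = x₁ ∨ v = x₂) ∧ (y₁ = x₁ ∨ y₁ = x₂)) ∨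
        (v = y₂ ∨ (v = x₁ ∨ v = x₂) ∧ (y₂ = x₁ ∨ y₂ = x₂))) ∧
      ((w = y₁ ∨ (w = x₁ ∨ w = x₂) ∧ (y₁ = x₁ ∨ y₁ = x₂)) ∨
        (w = y₂ ∨ (w = x₁ ∨ w = x₂) ∧ (y₂ = x₁ ∨ y₂ = x₂)))) :
    (v = w ∨ (v = y₁ ∨ v = y₂) ∧ (w = y₁ ∨ w = y₂)) ∨
      ((v = x₁ ∨ (v = y₁ ∨ v = y₂) ∧ (x₁ = y₁ ∨ x₁ = y₂)) ∨
        (v = x₂ ∨ (v = y₁ ∨ v = y₂) ∧ (x₂ = y₁ ∨ x₂ = y₂))) ∧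
      ((w = x₁ ∨ (w = y₁ ∨ w = y₂) ∧ (x₁ = y₁ ∨ x₁ = y₂)) ∨
        (w = x₂ ∨ (w = y₁ ∨ w = y₂) ∧ (x₂ = y₁ ∨ x₂ = y₂))) := by
  rcases h with (h | ⟨h1, h2⟩) | ⟨(h1 | ⟨h1, h2⟩) | (h1 | ⟨h1, h2⟩),
    (h3 | ⟨h3, h4⟩) | (h3 | ⟨h3, h4⟩)⟩
  · exact .inl (.inl h)
  · exact .inr ⟨h1.imp .inl .inl, h2.imp .inl .inl⟩
  all_goals first
    | exact .inl (.inr ⟨by tauto, by tauto⟩)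
    | exact .inr ⟨h1.imp .inl .inl, h3.imp .inl .inl⟩
    | (refine .inr ⟨?_, h3.imp .inl .inl⟩
       exact h4.imp (fun e => .inr ⟨by tauto, by tauto⟩) (fun e => .inr ⟨by tauto, by tauto⟩))
    | (refine .inr ⟨h1.imp .inl .inl, ?_⟩
       exact h2.imp (fun e => .inr ⟨by tauto, by tauto⟩) (fun e => .inr ⟨by tauto, by tauto⟩))

/-- Both double projections have the same fibres, which is what `equivOfSurjective` needs to
identify the vertices of the two doubly contracted graphs. -/
lemma proj2_eq_iff_comm (hl' : G.vert c ≠ G.vert (G.inv c)) (ha : a ≠ c ∧ a ≠ G.inv c)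
    (v w : G.V) : G.proj2 a c hl hc v = G.proj2 a c hl hc w ↔
      G.proj2 c a hl' ha v = G.proj2 c a hl' ha w := by
  simp only [proj2_eq_iff, cproj_eq_iff]
  exact ⟨merge_merge_comm, merge_merge_comm⟩

lemma avoid_symm {G : OGraph O} {a c : G.H} (hc : c ≠ a ∧ c ≠ G.inv a) :
    a ≠ c ∧ a ≠ G.inv c :=
  ⟨hc.1.symm, fun h => hc.2 (by rw [h, G.inv_inv])⟩

/-- Half-edges that remain after two contractions. -/
def CH2 (x : G.H) : Prop := (x ≠ a ∧ x ≠ G.inv a) ∧ x ≠ c ∧ x ≠ G.inv c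

/-- A half-edge in a graph that is contracted twice. -/
def toC2 (x : G.H) (hx : G.CH2 a c x) : (G.contract a hl).CH (G.toC a c hl hc) :=
  ⟨(⟨x, hx.1⟩ : G.CH a), fun e => hx.2.1 (congrArg Subtype.val e),
    fun e => hx.2.2 (congrArg Subtype.val e)⟩

variable {G a c hl hc} in
lemma CH2_of (x : (G.contract a hl).CH (G.toC a c hl hc)) : G.CH2 a c (x.1 : G.CH a).1 :=
  ⟨(x.1 : G.CH a).2, fun e => x.2.1 (Subtype.ext e), fun e => x.2.2 (Subtype.ext e)⟩

variable {G a c} in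
/-- The similarity between the contractions of two edges in the two possible orders. -/
def dSim (hl' : G.vert c ≠ G.vert (G.inv c)) (ha : a ≠ c ∧ a ≠ G.inv c)
    (h12 : (G.contract a hl).vert (G.toC a c hl hc) ≠
      (G.contract a hl).vert ((G.contract a hl).inv (G.toC a c hl hc)))
    (h21 : (G.contract c hl').vert (G.toC c a hl' ha) ≠
      (G.contract c hl').vert ((G.contract c hl').inv (G.toC c a hl' ha)))
    (lab : ∀ w : G.V, ∃ (S : Type) (_ : Finite S) (j : S → G.H) (p : O.obj S)
      (hj : ∀ s, G.CH2 a c (j s)) (hj' : ∀ s, G.CH2 c a (j s)),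
      ((G.contract a hl).contract _ h12).Lab (G.proj2 a c hl hc w)
        (fun s => G.toC2 a c hl hc (j s) (hj s)) p ∧
      ((G.contract c hl').contract _ h21).Lab (G.proj2 c a hl' ha w)
        (fun s => G.toC2 c a hl' ha (j s) (hj' s)) p) :
    Sim ((G.contract a hl).contract _ h12) ((G.contract c hl').contract _ h21) :=
  Sim.ofLab (G := (G.contract a hl).contract _ h12) (G' := (G.contract c hl').contract _ h21)
    (equivOfSurjective (G.proj2 a c hl hc) (G.proj2 c a hl' ha) (G.proj2_surjective a c hl hc)
      (G.proj2_surjective c a hl' ha) (G.proj2_eq_iff_comm a c hl hc hl' ha))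
    { toFun := fun x => G.toC2 c a hl' ha _ (And.symm (CH2_of x))
      invFun := fun x => G.toC2 a c hl hc _ (And.symm (CH2_of x))
      left_inv := fun x => rfl
      right_inv := fun x => rfl }
    (fun x => (equivOfSurjective_apply (f := G.proj2 a c hl hc) (g := G.proj2 c a hl' ha)
      (hf := G.proj2_surjective a c hl hc) (hg := G.proj2_surjective c a hl' ha)
      (h := G.proj2_eq_iff_comm a c hl hc hl' ha) (G.vert (x.1 : G.CH a).1)).symm)
    (fun w => by
      obtain ⟨w, rfl⟩ := G.proj2_surjective a c hl hc w
      obtain ⟨S, _, j, p, hj, hj', h1, h2⟩ := lab w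
      refine ⟨S, inferInstance, _, p, h1, ?_⟩
      have h3 : equivOfSurjective (G.proj2 a c hl hc) (G.proj2 c a hl' ha)
        (G.proj2_surjective a c hl hc) (G.proj2_surjective c a hl' ha)
        (G.proj2_eq_iff_comm a c hl hc hl' ha) (G.proj2 a c hl hc w) = G.proj2 c a hl' ha w :=
        equivOfSurjective_apply w
      rw [← h3] at h2
      exact h2)

lemma dSim_onV (hl' ha h12 h21 lab) (w : G.V) :
    (dSim hl hc hl' ha h12 h21 lab).onV (G.proj2 a c hl hc w) = G.proj2 c a hl' ha w :=
  equivOfSurjective_apply (f := G.proj2 a c hl hc) (g := G.proj2 c a hl' ha)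
    (hf := G.proj2_surjective a c hl hc) (hg := G.proj2_surjective c a hl' ha)
    (h := G.proj2_eq_iff_comm a c hl hc hl' ha) w

end Double

section Labels

variable {G : OGraph O} {a c : G.H} {hl : G.vert a ≠ G.vert (G.inv a)}
  {hc : c ≠ a ∧ c ≠ G.inv a}
  (h12 : (G.contract a hl).vert (G.toC a c hl hc) ≠
      (G.contract a hl).vert ((G.contract a hl).inv (G.toC a c hl hc)))

lemma Lab.double_of_ne {w : G.V} {S : Type} [Finite S] {j : S → G.H} {p : O.obj S}
    (h : G.Lab w j p) (h1 : w ≠ G.vert a ∧ w ≠ G.vert (G.inv a))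
    (h2 : w ≠ G.vert c ∧ w ≠ G.vert (G.inv c)) (hj : ∀ s, G.CH2 a c (j s)) :
    ((G.contract a hl).contract _ h12).Lab (G.proj2 a c hl hc w)
        (fun s => G.toC2 a c hl hc (j s) (hj s)) p := by
  have h3 := h.contract_some hl h1 (J := fun s => ⟨j s, (hj s).1⟩) (fun s => rfl)
  refine h3.contract_some h12 ?_ (fun s => rfl)
  constructor
  · exact fun e => (((G.cproj_eq_iff a).1 e).elim h2.1 fun e => e.1.elim h1.1 h1.2)
  · exact fun e => (((G.cproj_eq_iff a).1 e).elim h2.2 fun e => e.1.elim h1.1 h1.2)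

/-- The vertex obtained by the first contraction, if it is not an end of the second edge. -/
lemma Lab.double_first {A B : Type} [Finite A] [Finite B] {j : Option A → G.H}
    {p : O.obj (Option A)} {j' : Option B → G.H} {q : O.obj (Option B)}
    (hp : G.Lab (G.vert a) j p) (hj : j none = a) (hq : G.Lab (G.vert (G.inv a)) j' q)
    (hj' : j' none = G.inv a)
    (h1 : G.vert c ≠ G.vert a ∧ G.vert c ≠ G.vert (G.inv a))
    (h2 : G.vert (G.inv c) ≠ G.vert a ∧ G.vert (G.inv c) ≠ G.vert (G.inv a))
    (hJ : ∀ s, G.CH2 a c (Sum.elim (j ∘ some) (j' ∘ some) s)) :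
    ((G.contract a hl).contract _ h12).Lab (G.proj2 a c hl hc (G.vert a))
      (fun s => G.toC2 a c hl hc _ (hJ s)) (O.comp p q) := by
  have h3 := hp.contract_none hl hj hq hj' (J := fun s => ⟨_, (hJ s).1⟩) (fun s => rfl)
    (fun s => rfl)
  rw [← G.cproj_vert a] at h3
  refine h3.contract_some h12 ?_ (fun s => rfl)
  constructor
  · exact fun e => (((G.cproj_eq_iff a).1 e).elim h1.1.symm fun e => e.2.elim h1.1 h1.2)
  · exact fun e => (((G.cproj_eq_iff a).1 e).elim h2.1.symm fun e => e.2.elim h2.1 h2.2)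

/-- The vertex obtained by the second contraction, if the edges have no common end. -/
lemma Lab.double_second {A B : Type} [Finite A] [Finite B] {j : Option A → G.H}
    {p : O.obj (Option A)} {j' : Option B → G.H} {q : O.obj (Option B)}
    (hp : G.Lab (G.vert c) j p) (hj : j none = c) (hq : G.Lab (G.vert (G.inv c)) j' q)
    (hj' : j' none = G.inv c)
    (h1 : G.vert c ≠ G.vert a ∧ G.vert c ≠ G.vert (G.inv a))
    (h2 : G.vert (G.inv c) ≠ G.vert a ∧ G.vert (G.inv c) ≠ G.vert (G.inv a))
    (hJ : ∀ s, G.CH2 a c (Sum.elim (j ∘ some) (j' ∘ some) s)) :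
    ((G.contract a hl).contract _ h12).Lab (G.proj2 a c hl hc (G.vert c))
      (fun s => G.toC2 a c hl hc _ (hJ s)) (O.comp p q) := by
  obtain ⟨J1, hJ1⟩ := exists_lift_CH a hp.mem h1
  obtain ⟨J2, hJ2⟩ := exists_lift_CH a hq.mem h2
  have h3 := hp.contract_some hl h1 hJ1
  have h4 := hq.contract_some hl h2 hJ2
  have h5 := Lab.contract_none h12 h3 (Subtype.ext ((hJ1 none).trans hj)) h4
    (Subtype.ext ((hJ2 none).trans hj')) (J := fun s => G.toC2 a c hl hc _ (hJ s))
    (fun s => Subtype.ext (hJ1 _).symm) (fun s => Subtype.ext (hJ2 _).symm)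
  have h6 : G.proj2 a c hl hc (G.vert c) = none := (G.contract a hl).cproj_vert _
  rw [h6]
  exact h5

/-- The vertex obtained by contracting two edges with a common end. -/
lemma Lab.double_shared {A B C : Type} [Finite A] [Finite B] [Finite C]
    {j : Option (Option A) → G.H} {p : O.obj (Option (Option A))} {j' : Option B → G.H}
    {q : O.obj (Option B)} {j'' : Option C → G.H} {r : O.obj (Option C)}
    (hp : G.Lab (G.vert a) j p) (hj : j none = a) (hj0 : j (some none) = c)
    (hq : G.Lab (G.vert (G.inv a)) j' q) (hj' : j' none = G.inv a)
    (hr : G.Lab (G.vert (G.inv c)) j'' r) (hj'' : j'' none = G.inv c)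
    (h1 : G.vert c = G.vert a)
    (h2 : G.vert (G.inv c) ≠ G.vert a ∧ G.vert (G.inv c) ≠ G.vert (G.inv a))
    (hJ : ∀ s, G.CH2 a c (Sum.elim (Sum.elim (j ∘ some ∘ some) (j' ∘ some)) (j'' ∘ some) s)) :
    ((G.contract a hl).contract _ h12).Lab (G.proj2 a c hl hc (G.vert c))
      (fun s => G.toC2 a c hl hc _ (hJ s))
      (O.comp (O.map (optionSum A B) (O.comp p q)) r) := by
  -- Half-edges at the vertex made by the first contraction, with `c` as the leg `none` for the
  -- second one; `optionSum` translates between these names and those produced by `comp p q`.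
  let J1 : Option (A ⊕ B) → G.CH a := fun x =>
    match x with
    | none => ⟨c, hc⟩
    | some x => ⟨_, (hJ (.inl x)).1⟩
  have h3 : (G.contract a hl).Lab none (J1 ∘ optionSum A B) (O.comp p q) := by
    refine hp.contract_none hl hj hq hj' ?_ ?_
    · rintro (_ | x)
      · exact hj0.symm
      · rfl
    · rintro x
      rfl
  have h4 : (G.contract a hl).Lab ((G.contract a hl).vert (G.toC a c hl hc)) J1
      (O.map (optionSum A B) (O.comp p q)) := by
    have : (G.contract a hl).vert (G.toC a c hl hc) = none :=
      (G.cproj_eq_none a).2 (.inl h1)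
    rw [this]
    exact (lab_map _).2 h3
  obtain ⟨J2, hJ2⟩ := exists_lift_CH a hr.mem h2
  have h5 := hr.contract_some hl h2 hJ2
  have h6 := Lab.contract_none h12 h4 rfl h5
    (Subtype.ext ((hJ2 none).trans hj'')) (J := fun s => G.toC2 a c hl hc _ (hJ s))
    (fun s => rfl) (fun s => Subtype.ext (hJ2 _).symm)
  have h7 : G.proj2 a c hl hc (G.vert c) = none := (G.contract a hl).cproj_vert _
  rw [h7]
  exact h6

end Labels

end OGraph

/-! ### Labels after contracting two edges in either order -/

namespace OGraph

section

variable {G : OGraph O} {a c : G.H} (hl : G.vert a ≠ G.vert (G.inv a))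
  (hc : c ≠ a ∧ c ≠ G.inv a) (hl' : G.vert c ≠ G.vert (G.inv c)) (ha : a ≠ c ∧ a ≠ G.inv c)
  (h12 : (G.contract a hl).vert (G.toC a c hl hc) ≠
      (G.contract a hl).vert ((G.contract a hl).inv (G.toC a c hl hc)))
  (h21 : (G.contract c hl').vert (G.toC c a hl' ha) ≠
      (G.contract c hl').vert ((G.contract c hl').inv (G.toC c a hl' ha)))

/-- The labels after contracting two edges do not depend on the order. -/
def DoubleLab : Prop := ∀ w : G.V, ∃ (S : Type) (_ : Finite S) (j : S → G.H) (p : O.obj S)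
  (hj : ∀ s, G.CH2 a c (j s)) (hj' : ∀ s, G.CH2 c a (j s)),
  ((G.contract a hl).contract _ h12).Lab (G.proj2 a c hl hc w)
    (fun s => G.toC2 a c hl hc (j s) (hj s)) p ∧
  ((G.contract c hl').contract _ h21).Lab (G.proj2 c a hl' ha w)
    (fun s => G.toC2 c a hl' ha (j s) (hj' s)) p

lemma CH2.symm {x : G.H} (h : G.CH2 a c x) : G.CH2 c a x := And.symm h

lemma CH2_of_vert {x : G.H} (h1 : G.vert x ≠ G.vert a ∧ G.vert x ≠ G.vert (G.inv a))
    (h2 : G.vert x ≠ G.vert c ∧ G.vert x ≠ G.vert (G.inv c)) : G.CH2 a c x :=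
  ⟨⟨fun e => h1.1 (by rw [e]), fun e => h1.2 (by rw [e])⟩,
    fun e => h2.1 (by rw [e]), fun e => h2.2 (by rw [e])⟩

lemma proj2_congr {v w : G.V} (h : G.cproj a v = G.cproj a w) :
    G.proj2 a c hl hc v = G.proj2 a c hl hc w :=
  (proj2_eq_iff ..).2 (.inl h)

lemma ne_of_option {A : Type} [Finite A] {j : Option A → G.H} {p : O.obj (Option A)} {v : G.V}
    (h : G.Lab v j p) {a : G.H} (hj : j none = a) (x : A) : j (some x) ≠ a :=
  fun e => by simpa using h.inj (e.trans hj.symm)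

lemma doubleLab_of_other {w : G.V} (h1 : w ≠ G.vert a ∧ w ≠ G.vert (G.inv a))
    (h2 : w ≠ G.vert c ∧ w ≠ G.vert (G.inv c)) :
    ∃ (S : Type) (_ : Finite S) (j : S → G.H) (p : O.obj S)
    (hj : ∀ s, G.CH2 a c (j s)) (hj' : ∀ s, G.CH2 c a (j s)),
    ((G.contract a hl).contract _ h12).Lab (G.proj2 a c hl hc w)
      (fun s => G.toC2 a c hl hc (j s) (hj s)) p ∧
    ((G.contract c hl').contract _ h21).Lab (G.proj2 c a hl' ha w)
      (fun s => G.toC2 c a hl' ha (j s) (hj' s)) p := by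
  have h := G.lab_label w
  have hJ : ∀ s : {h // G.vert h = w}, G.CH2 a c s.1 :=
    fun s => CH2_of_vert (by rwa [s.2]) (by rwa [s.2])
  exact ⟨_, inferInstance, _, _, hJ, fun s => (hJ s).symm, h.double_of_ne h12 h1 h2 hJ,
    h.double_of_ne h21 h2 h1 fun s => (hJ s).symm⟩

/-- Each merged vertex is created by one contraction and left alone by the other, so the same
composition appears in both orders. -/
lemma doubleLab_of_disjoint (h1 : G.vert c ≠ G.vert a ∧ G.vert c ≠ G.vert (G.inv a))
    (h2 : G.vert (G.inv c) ≠ G.vert a ∧ G.vert (G.inv c) ≠ G.vert (G.inv a)) :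
    DoubleLab hl hc hl' ha h12 h21 := by
  intro w
  have h3 : G.vert a ≠ G.vert c ∧ G.vert a ≠ G.vert (G.inv c) := ⟨h1.1.symm, h2.1.symm⟩
  have h4 : G.vert (G.inv a) ≠ G.vert c ∧ G.vert (G.inv a) ≠ G.vert (G.inv c) :=
    ⟨h1.2.symm, h2.2.symm⟩
  by_cases hwa : w = G.vert a ∨ w = G.vert (G.inv a)
  · obtain ⟨A, _, j, p, hj, hp⟩ := G.exists_lab_option a
    obtain ⟨B, _, j', q, hj', hq⟩ := G.exists_lab_option (G.inv a)
    have hJ : ∀ s, G.CH2 a c (Sum.elim (j ∘ some) (j' ∘ some) s) := by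
      rintro (x | x)
      · exact ⟨⟨ne_of_option hp hj x, fun e => hl (by rw [← hp.mem (some x)]; exact congrArg _ e)⟩,
          fun e => h3.1 (by rw [← hp.mem (some x)]; exact congrArg _ e),
          fun e => h3.2 (by rw [← hp.mem (some x)]; exact congrArg _ e)⟩
      · exact ⟨⟨fun e => hl.symm (by rw [← hq.mem (some x)]; exact congrArg _ e),
          ne_of_option hq hj' x⟩,
          fun e => h4.1 (by rw [← hq.mem (some x)]; exact congrArg _ e),
          fun e => h4.2 (by rw [← hq.mem (some x)]; exact congrArg _ e)⟩
    have e1 : G.proj2 a c hl hc w = G.proj2 a c hl hc (G.vert a) :=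
      proj2_congr hl hc ((G.cproj_eq_iff a).2 (.inr ⟨hwa, .inl rfl⟩))
    have e2 : G.proj2 c a hl' ha w = G.proj2 c a hl' ha (G.vert a) := by
      rw [proj2_eq_iff]
      refine .inr ⟨?_, .inl rfl⟩
      exact hwa.imp (fun e => by rw [e]) (fun e => by rw [e])
    rw [e1, e2]
    exact ⟨_, inferInstance, _, _, hJ, fun s => (hJ s).symm,
      hp.double_first h12 hj hq hj' h1 h2 hJ,
      hp.double_second h21 hj hq hj' h3 h4 fun s => (hJ s).symm⟩
  by_cases hwc : w = G.vert c ∨ w = G.vert (G.inv c)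
  · obtain ⟨A, _, j, p, hj, hp⟩ := G.exists_lab_option c
    obtain ⟨B, _, j', q, hj', hq⟩ := G.exists_lab_option (G.inv c)
    have hJ : ∀ s, G.CH2 c a (Sum.elim (j ∘ some) (j' ∘ some) s) := by
      rintro (x | x)
      · exact ⟨⟨ne_of_option hp hj x, fun e => hl' (by rw [← hp.mem (some x)]; exact congrArg _ e)⟩,
          fun e => h1.1 (by rw [← hp.mem (some x)]; exact congrArg _ e),
          fun e => h1.2 (by rw [← hp.mem (some x)]; exact congrArg _ e)⟩
      · exact ⟨⟨fun e => hl'.symm (by rw [← hq.mem (some x)]; exact congrArg _ e),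
          ne_of_option hq hj' x⟩,
          fun e => h2.1 (by rw [← hq.mem (some x)]; exact congrArg _ e),
          fun e => h2.2 (by rw [← hq.mem (some x)]; exact congrArg _ e)⟩
    have e1 : G.proj2 c a hl' ha w = G.proj2 c a hl' ha (G.vert c) :=
      proj2_congr hl' ha ((G.cproj_eq_iff c).2 (.inr ⟨hwc, .inl rfl⟩))
    have e2 : G.proj2 a c hl hc w = G.proj2 a c hl hc (G.vert c) := by
      rw [proj2_eq_iff]
      refine .inr ⟨?_, .inl rfl⟩
      exact hwc.imp (fun e => by rw [e]) (fun e => by rw [e])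
    rw [e1, e2]
    exact ⟨_, inferInstance, _, _, fun s => (hJ s).symm, hJ,
      hp.double_second h12 hj hq hj' h1 h2 fun s => (hJ s).symm,
      hp.double_first h21 hj hq hj' h3 h4 hJ⟩
  exact doubleLab_of_other hl hc hl' ha h12 h21 (by tauto) (by tauto)

/-- At the vertex formed from three, the two orders of composition agree by `comp_assoc`. Parallel
edges are excluded, as one would become a loop. -/
lemma doubleLab_of_shared (h1 : G.vert c = G.vert a)
    (h2 : G.vert (G.inv c) ≠ G.vert (G.inv a)) :
    DoubleLab hl hc hl' ha h12 h21 := by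
  intro w
  have h3 : G.vert (G.inv c) ≠ G.vert a := fun e => hl' (h1.trans e.symm)
  have h4 : G.vert (G.inv a) ≠ G.vert c := fun e => hl (by rw [e, h1])
  by_cases hw : (w = G.vert a ∨ w = G.vert (G.inv a)) ∨ w = G.vert (G.inv c)
  · obtain ⟨A, _, j, p, hj, hj0, hp⟩ := G.exists_lab_option_option hc.1 h1
    obtain ⟨B, _, j', q, hj', hq⟩ := G.exists_lab_option (G.inv a)
    obtain ⟨C, _, j'', r, hj'', hr⟩ := G.exists_lab_option (G.inv c)
    have hJ : ∀ s, G.CH2 a c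
        (Sum.elim (Sum.elim (j ∘ some ∘ some) (j' ∘ some)) (j'' ∘ some) s) := by
      rintro ((x | x) | x)
      · have hm := hp.mem (some (some x))
        refine ⟨⟨fun e => ?_, fun e => hl (by rw [← hm]; exact congrArg _ e)⟩,
          fun e => ?_, fun e => h3.symm (by rw [← hm]; exact congrArg _ e)⟩
        · simpa using hp.inj (e.trans hj.symm)
        · simpa using hp.inj (e.trans hj0.symm)
      · have hm := hq.mem (some x)
        exact ⟨⟨fun e => hl.symm (by rw [← hm]; exact congrArg _ e), ne_of_option hq hj' x⟩,
          fun e => h4 (by rw [← hm]; exact congrArg _ e),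
          fun e => h2.symm (by rw [← hm]; exact congrArg _ e)⟩
      · have hm := hr.mem (some x)
        exact ⟨⟨fun e => h3 (by rw [← hm]; exact congrArg _ e),
          fun e => h2 (by rw [← hm]; exact congrArg _ e)⟩,
          fun e => hl'.symm (by rw [← hm]; exact congrArg _ e), ne_of_option hr hj'' x⟩
    have e1 : G.proj2 a c hl hc w = G.proj2 a c hl hc (G.vert c) := by
      rw [proj2_eq_iff]
      rcases hw with hw | rfl
      · exact .inl ((G.cproj_eq_iff a).2 (.inr ⟨hw, .inl h1⟩))
      · exact .inr ⟨.inr rfl, .inl rfl⟩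
    have e2 : G.proj2 c a hl' ha w = G.proj2 c a hl' ha (G.vert a) := by
      rw [proj2_eq_iff]
      rcases hw with (rfl | rfl) | rfl
      · exact .inl rfl
      · exact .inr ⟨.inr rfl, .inl rfl⟩
      · exact .inl ((G.cproj_eq_iff c).2 (.inr ⟨.inr rfl, .inl h1.symm⟩))
    rw [e1, e2]
    refine ⟨_, inferInstance, _, _, hJ, fun s => (hJ s).symm,
      hp.double_shared h12 hj hj0 hq hj' hr hj'' h1 ⟨h3, h2⟩ hJ, ?_⟩
    -- When `c` is contracted first it must occupy the outer leg `none`; this is the role of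
    -- `optionSwap` in the associativity axiom.
    have hp' : G.Lab (G.vert c) (j ∘ optionSwap A) (O.map (optionSwap A) p) := by
      rw [lab_map, h1]
      exact hp.congr fun s => congrArg j ((optionSwap A).left_inv s)
    have hJ' : ∀ s, G.CH2 c a (Sum.elim (Sum.elim ((j ∘ optionSwap A) ∘ some ∘ some)
        (j'' ∘ some)) (j' ∘ some) s) := by
      rintro ((x | x) | x)
      · exact (hJ (.inl (.inl x))).symm
      · exact (hJ (.inr x)).symm
      · exact (hJ (.inl (.inr x))).symm
    have key := hp'.double_shared h21 hj0 hj hr hj'' hq hj' h1.symm ⟨h4, h2.symm⟩ hJ'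
    rw [O.comp_assoc] at key
    refine ((lab_map _).1 key).congr ?_
    rintro ((x | x) | x) <;> rfl
  exact doubleLab_of_other hl hc hl' ha h12 h21 (by tauto) (by rw [h1]; tauto)

end

end OGraph

/-! ### Antisymmetry of the double contraction -/

namespace BGraph

open OGraph

section

variable (P : BGraph O) (a c : P.G.H)

/-- The class obtained by contracting first the edge of `a` and then the edge of `c`, with its
sign. -/
def K2 : BSpace O :=
  if h : P.G.vert a ≠ P.G.vert (P.G.inv a) ∧ c ≠ a ∧ c ≠ P.G.inv a then
    sg k (P.G.tau a * P.G.endSign a) • (P.contr a h.1).pcontract (P.G.toC a c h.1 h.2)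
  else 0

lemma K2_of_pos (hl) (hc) : P.K2 a c =
    sg k (P.G.tau a * P.G.endSign a) • (P.contr a hl).pcontract (P.G.toC a c hl hc) :=
  dif_pos ⟨hl, hc⟩

lemma K2_of_loop (hl : P.G.vert a = P.G.vert (P.G.inv a)) : P.K2 a c = 0 :=
  dif_neg fun h => h.1 hl

/-- After the first contraction the second edge is a loop, and loops contract to zero. -/
lemma K2_of_parallel (h : P.G.cproj a (P.G.vert c) = P.G.cproj a (P.G.vert (P.G.inv c))) :
    P.K2 a c = 0 := by
  unfold K2
  split_ifs with h'
  · exact (congrArg _ (pcontract_of_loop (P.contr a h'.1) (P.G.toC a c h'.1 h'.2) h)).trans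
      (smul_zero _)
  · rfl

lemma K2_of_mem (h : c = a ∨ c = P.G.inv a) : P.K2 a c = 0 :=
  dif_neg fun h' => h.elim h'.2.1 h'.2.2

/-- This zero comes from the definition and not from antisymmetry, so later cancellations are valid
in characteristic two. -/
lemma K2_self : P.K2 a a = 0 := P.K2_of_mem a a (.inl rfl)

variable {P a c} in
lemma K2_iso {Q : BGraph O} {s : ℤˣ} (e : Iso P Q s) :
    Q.K2 (e.onH a) (e.onH c) = sg k s • P.K2 a c := by
  by_cases hl : P.G.vert a = P.G.vert (P.G.inv a)
  · rw [P.K2_of_loop a c hl, Q.K2_of_loop _ _ ((e.loop_iff a).2 hl), smul_zero]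
  by_cases hc : c = a ∨ c = P.G.inv a
  · rw [P.K2_of_mem a c hc, Q.K2_of_mem, smul_zero]
    rw [e.inv]
    exact hc.imp (congrArg _) (congrArg _)
  have hl' := (e.loop_iff a).not.2 hl
  have hc1 : c ≠ a ∧ c ≠ P.G.inv a := by tauto
  have hc' : e.onH c ≠ e.onH a ∧ e.onH c ≠ Q.G.inv (e.onH a) := by
    rw [e.inv, e.onH.injective.ne_iff, e.onH.injective.ne_iff]
    exact hc1
  rw [P.K2_of_pos a c hl hc1, Q.K2_of_pos _ _ hl' hc']
  have := pcontract_iso (e.contr hl hl') (P.G.toC a c hl hc1)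
  rw [show (e.contr hl hl').onH (P.G.toC a c hl hc1) = Q.G.toC _ _ hl' hc' from rfl] at this
  rw [this, smul_smul, smul_smul, ← sg_mul, ← sg_mul, e.tau]
  congr 2
  have := Int.units_mul_self (Q.G.endSign (e.onH a))
  calc _ = s * (P.G.tau a * P.G.endSign a) *
        (Q.G.endSign (e.onH a) * Q.G.endSign (e.onH a)) := by ac_rfl
    _ = _ := by rw [this, mul_one]

/-- Together with `K2_inv_left` this shows that only the two edges matter. A common end may
therefore be assumed to lie at the half-edges `a` and `c`. -/
lemma K2_inv_right : P.K2 a (P.G.inv c) = P.K2 a c := by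
  have hi : P.G.inv c = a ↔ c = P.G.inv a :=
    ⟨fun e => by rw [← e, P.G.inv_inv], fun e => by rw [e, P.G.inv_inv]⟩
  by_cases hl : P.G.vert a = P.G.vert (P.G.inv a)
  · rw [P.K2_of_loop a _ hl, P.K2_of_loop a _ hl]
  by_cases hc : c = a ∨ c = P.G.inv a
  · rw [P.K2_of_mem a c hc, P.K2_of_mem]
    rw [hi, P.G.inv.injective.eq_iff]
    exact hc.symm
  have hc1 : c ≠ a ∧ c ≠ P.G.inv a := by tauto
  have hc2 : P.G.inv c ≠ a ∧ P.G.inv c ≠ P.G.inv a := by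
    rw [Ne, Ne, hi, P.G.inv.injective.eq_iff]
    tauto
  rw [P.K2_of_pos a c hl hc1, P.K2_of_pos a _ hl hc2,
    ← (P.contr a hl).pcontract_inv (P.G.toC a c hl hc1)]
  rfl

lemma K2_inv_left : P.K2 (P.G.inv a) c = P.K2 a c := by
  by_cases hl : P.G.vert a = P.G.vert (P.G.inv a)
  · rw [P.K2_of_loop a _ hl, P.K2_of_loop _ _ ((P.loop_inv a).2 hl)]
  by_cases hc : c = a ∨ c = P.G.inv a
  · rw [P.K2_of_mem a c hc, P.K2_of_mem]
    rw [P.G.inv_inv]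
    exact hc.symm
  have hc1 : c ≠ a ∧ c ≠ P.G.inv a := by tauto
  have hc2 : c ≠ P.G.inv a ∧ c ≠ P.G.inv (P.G.inv a) := by
    rw [P.G.inv_inv]
    exact hc1.symm
  have hl' := (P.loop_inv a).not.2 hl
  obtain ⟨e, he⟩ := P.exists_iso_contr_inv a hl hl'
  have := pcontract_iso e (P.G.toC a c hl hc1)
  rw [show e.onH (P.G.toC a c hl hc1) = P.G.toC _ c hl' hc2 from
    Subtype.ext (he (P.G.toC a c hl hc1))] at this
  rw [P.K2_of_pos a c hl hc1, P.K2_of_pos _ c hl' hc2, this, smul_smul, ← sg_mul, tau_inv]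
  congr 2
  have := Int.units_mul_self (P.G.endSign (P.G.inv a))
  calc _ = P.G.tau a * P.G.endSign a *
        (P.G.endSign (P.G.inv a) * P.G.endSign (P.G.inv a)) := by
          simp only [neg_mul, mul_neg, neg_neg]; ac_rfl
    _ = _ := by rw [this, mul_one]

-- The sign bookkeeping common to all nonzero cases. The hypotheses `h1`, `h1'` bring the ends to
-- the front at the two stages in one order of contraction, `h2`, `h2'` do so in the other order,
-- and `h3` compares the final vertex lists. Directions and position-dependent signs cancel, so the
-- total is the product in `hr`.
variable {P a c} in
lemma K2_antisymm_of_lab (hl : P.G.vert a ≠ P.G.vert (P.G.inv a))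
    (hc : c ≠ a ∧ c ≠ P.G.inv a) (hl' : P.G.vert c ≠ P.G.vert (P.G.inv c))
    (ha : a ≠ c ∧ a ≠ P.G.inv c)
    (h12 : (P.G.contract a hl).vert (P.G.toC a c hl hc) ≠
      (P.G.contract a hl).vert ((P.G.contract a hl).inv (P.G.toC a c hl hc)))
    (h21 : (P.G.contract c hl').vert (P.G.toC c a hl' ha) ≠
      (P.G.contract c hl').vert ((P.G.contract c hl').inv (P.G.toC c a hl' ha)))
    (lab : DoubleLab hl hc hl' ha h12 h21) {l m n m' : List P.G.V} {s s' t t' r : ℤˣ}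
    (h1 : SPerm s P.G.ord (P.G.vert a :: P.G.vert (P.G.inv a) :: l))
    (h1' : SPerm s' (P.G.cproj a (P.G.vert a) :: l.map (P.G.cproj a))
      (P.G.cproj a (P.G.vert c) :: P.G.cproj a (P.G.vert (P.G.inv c)) :: m.map (P.G.cproj a)))
    (h2 : SPerm t P.G.ord (P.G.vert c :: P.G.vert (P.G.inv c) :: n))
    (h2' : SPerm t' (P.G.cproj c (P.G.vert c) :: n.map (P.G.cproj c))
      (P.G.cproj c (P.G.vert a) :: P.G.cproj c (P.G.vert (P.G.inv a)) :: m'.map (P.G.cproj c)))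
    (h3 : SPerm r (P.G.proj2 c a hl' ha (P.G.vert c) :: m.map (P.G.proj2 c a hl' ha))
      (P.G.proj2 c a hl' ha (P.G.vert a) :: m'.map (P.G.proj2 c a hl' ha)))
    (hr : s * s' * (t * t') * r = -1) : P.K2 a c = -P.K2 c a := by
  let e := dSim hl hc hl' ha h12 h21 lab
  have o1 : SPerm _ (P.contr a hl).G.ord _ :=
    ((SPerm.of_eq (List.map_id _).symm).trans (P.contr_ord a h1 (hl := hl) id)).trans h1'
  have o2 : SPerm _ (P.contr c hl').G.ord _ :=
    ((SPerm.of_eq (List.map_id _).symm).trans (P.contr_ord c h2 (hl := hl') id)).trans h2'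
  have o3 := ((SPerm.of_eq (List.map_id _).symm).trans
    ((P.contr c hl').contr_ord (P.G.toC c a hl' ha) (hl := h21) o2 id)).symm
  let i := isoOfContract (P := P.contr a hl) (a := P.G.toC a c hl hc) h12
    (Q := (P.contr c hl').contr (P.G.toC c a hl' ha) h21) e (fun x => rfl) (fun x => rfl)
    (Equiv.refl _) (fun w => by
      obtain ⟨w, rfl⟩ := P.G.cproj_surjective a w
      refine (congrArg _ (dSim_onV P.G a c hl hc hl' ha h12 h21 lab w)).trans ?_
      refine ((P.contr c hl').contr_blk _ h21 _).trans ?_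
      exact (P.contr_blk c hl' w).trans (P.contr_blk a hl w).symm) o1
    (t := r * (1 * ((P.contr c hl').G.endSign (P.G.toC c a hl' ha) *
        (1 * (P.G.endSign c * t) * t')))) (by
      refine SPerm.trans ?_ o3
      refine ((SPerm.of_eq ?_).trans h3 |>.trans (SPerm.of_eq ?_)).cast
        (by rw [mul_one, one_mul])
      · exact congrArg₂ _ (dSim_onV P.G a c hl hc hl' ha h12 h21 lab _)
          ((List.map_map ..).trans
            (List.map_congr_left fun w _ => dSim_onV P.G a c hl hc hl' ha h12 h21 lab w))
      · exact congrArg₂ _ rfl (List.map_map ..).symm)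
  have k1 := pcontract_eq (s := 1 * (P.G.endSign a * s) * s' *
    (r * (1 * ((P.contr c hl').G.endSign (P.G.toC c a hl' ha) *
        (1 * (P.G.endSign c * t) * t'))))) (by
      rw [← mul_assoc]
      exact i)
  rw [P.K2_of_pos a c hl hc, P.K2_of_pos c a hl' ha, k1,
    (P.contr c hl').pcontract_of_ne _ h21, smul_smul, smul_smul, ← sg_mul, ← sg_mul, ← neg_smul,
    ← sg_neg]
  congr 2
  have t1 : (P.contr a hl).G.tau (P.G.toC a c hl hc) = P.G.tau c := rfl
  have t2 : (P.contr c hl').G.tau (P.G.toC c a hl' ha) = P.G.tau a := rfl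
  rw [t1, t2]
  generalize (P.contr c hl').G.endSign (P.G.toC c a hl' ha) = x
  have := Int.units_mul_self (P.G.endSign a)
  calc _ = P.G.tau a * P.G.tau c * P.G.endSign c * x * (P.G.endSign a * P.G.endSign a) *
          (s * s' * (t * t') * r) := by simp only [one_mul]; ac_rfl
    _ = _ := by rw [this, hr, mul_one, mul_neg_one]; congr 1; ac_rfl

variable {P a c} in
lemma sperm_rotate {α : Type*} (x y z : α) (l : List α) :
    SPerm 1 (x :: y :: z :: l) (y :: z :: x :: l) :=
  ((SPerm.swap y x (z :: l)).trans ((SPerm.swap z x l).cons y)).cast (by simp)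

/-- Exchanging the two pairs of ends is even, and so is moving a merged vertex past a pair. What
remains is one transposition: the two new vertices end up in opposite orders. -/
lemma K2_antisymm_of_disjoint (hl : P.G.vert a ≠ P.G.vert (P.G.inv a))
    (hl' : P.G.vert c ≠ P.G.vert (P.G.inv c))
    (h1 : P.G.vert c ≠ P.G.vert a ∧ P.G.vert c ≠ P.G.vert (P.G.inv a))
    (h2 : P.G.vert (P.G.inv c) ≠ P.G.vert a ∧ P.G.vert (P.G.inv c) ≠ P.G.vert (P.G.inv a)) :
    P.K2 a c = -P.K2 c a := by
  have hc : c ≠ a ∧ c ≠ P.G.inv a := ⟨fun e => h1.1 (by rw [e]), fun e => h1.2 (by rw [e])⟩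
  have ha := avoid_symm hc
  have h12 : (P.G.contract a hl).vert (P.G.toC a c hl hc) ≠
      (P.G.contract a hl).vert ((P.G.contract a hl).inv (P.G.toC a c hl hc)) :=
    fun e => ((P.G.cproj_eq_iff a).1 e).elim hl' fun e => e.1.elim h1.1 h1.2
  have h21 : (P.G.contract c hl').vert (P.G.toC c a hl' ha) ≠
      (P.G.contract c hl').vert ((P.G.contract c hl').inv (P.G.toC c a hl' ha)) :=
    fun e => ((P.G.cproj_eq_iff c).1 e).elim hl fun e => e.1.elim h1.1.symm h2.1.symm
  obtain ⟨s, r, hs⟩ := exists_sperm_append (l := P.G.ord)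
    (m := [P.G.vert a, P.G.vert (P.G.inv a), P.G.vert c, P.G.vert (P.G.inv c)])
    (by simp [hl, hl', h1.1.symm, h1.2.symm, h2.1.symm, h2.2.symm])
    (fun x _ => P.G.mem_ord x)
  have hs' : SPerm s P.G.ord (P.G.vert c :: P.G.vert (P.G.inv c) ::
      P.G.vert a :: P.G.vert (P.G.inv a) :: r) :=
    (hs.trans ((SPerm.append_comm [P.G.vert c, P.G.vert (P.G.inv c)]
      [P.G.vert a, P.G.vert (P.G.inv a)]).append_right r)).cast (by norm_num)
  refine K2_antisymm_of_lab hl hc hl' ha h12 h21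
    (doubleLab_of_disjoint hl hc hl' ha h12 h21 h1 h2) (m := P.G.vert a :: r)
    (m' := P.G.vert c :: r) hs (sperm_rotate _ _ _ _) hs' (sperm_rotate _ _ _ _)
    (SPerm.swap _ _ _) ?_
  simp

/-- Three vertices become one. The sign is the transposition of the two ends that are not shared. -/
lemma K2_antisymm_of_shared (hl : P.G.vert a ≠ P.G.vert (P.G.inv a))
    (hl' : P.G.vert c ≠ P.G.vert (P.G.inv c)) (hca : c ≠ a)
    (h1 : P.G.vert c = P.G.vert a) (h2 : P.G.vert (P.G.inv c) ≠ P.G.vert (P.G.inv a)) :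
    P.K2 a c = -P.K2 c a := by
  have h3 : P.G.vert (P.G.inv c) ≠ P.G.vert a := fun e => hl' (h1.trans e.symm)
  have h4 : P.G.vert (P.G.inv a) ≠ P.G.vert c := fun e => hl (by rw [e, h1])
  have hc : c ≠ a ∧ c ≠ P.G.inv a := ⟨hca, fun e => h4 (by rw [e])⟩
  have ha := avoid_symm hc
  have h12 : (P.G.contract a hl).vert (P.G.toC a c hl hc) ≠
      (P.G.contract a hl).vert ((P.G.contract a hl).inv (P.G.toC a c hl hc)) :=
    fun e => ((P.G.cproj_eq_iff a).1 e).elim hl' fun e => e.2.elim h3 h2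
  have h21 : (P.G.contract c hl').vert (P.G.toC c a hl' ha) ≠
      (P.G.contract c hl').vert ((P.G.contract c hl').inv (P.G.toC c a hl' ha)) :=
    fun e => ((P.G.cproj_eq_iff c).1 e).elim hl fun e => e.2.elim h4 h2.symm
  obtain ⟨s, r, hs⟩ := exists_sperm_append (l := P.G.ord)
    (m := [P.G.vert a, P.G.vert (P.G.inv a), P.G.vert (P.G.inv c)])
    (by simp [hl, h3.symm, h2.symm])
    (fun x _ => P.G.mem_ord x)
  have hs' : SPerm (-s) P.G.ord (P.G.vert c :: P.G.vert (P.G.inv c) ::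
      P.G.vert (P.G.inv a) :: r) := by
    rw [h1]
    exact (hs.trans ((SPerm.swap _ _ _).cons _)).cast (by simp)
  refine K2_antisymm_of_lab hl hc hl' ha h12 h21
    (doubleLab_of_shared hl hc hl' ha h12 h21 h1 h2) (m := r)
    (m' := r) hs (SPerm.of_eq ?_) hs' (SPerm.of_eq ?_) (SPerm.of_eq ?_) ?_
  · rw [h1]; rfl
  · rw [h1]; rfl
  · rw [h1]
  · simp

/-- If the edges coincide, or one is a loop, or they are parallel, both sides vanish: a loop stays a
loop and a parallel edge becomes one. Otherwise the edges share exactly one end or none. -/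
lemma K2_antisymm : P.K2 a c = -P.K2 c a := by
  by_cases hc : c = a ∨ c = P.G.inv a
  · rw [P.K2_of_mem a c hc, P.K2_of_mem c a, neg_zero]
    exact hc.imp Eq.symm fun e => by rw [e, P.G.inv_inv]
  have hc1 : c ≠ a ∧ c ≠ P.G.inv a := by tauto
  have ha1 := avoid_symm hc1
  by_cases hl : P.G.vert a = P.G.vert (P.G.inv a)
  · rw [P.K2_of_loop a c hl, P.K2_of_parallel c a (by rw [hl]), neg_zero]
  by_cases hl' : P.G.vert c = P.G.vert (P.G.inv c)
  · rw [P.K2_of_loop c a hl', neg_zero, P.K2_of_parallel a c (by rw [hl'])]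
  by_cases hp : (P.G.vert c = P.G.vert a ∨ P.G.vert c = P.G.vert (P.G.inv a)) ∧
      (P.G.vert (P.G.inv c) = P.G.vert a ∨ P.G.vert (P.G.inv c) = P.G.vert (P.G.inv a))
  · rw [P.K2_of_parallel a c, P.K2_of_parallel c a, neg_zero]
    · refine (P.G.cproj_eq_iff c).2 (.inr ?_)
      obtain ⟨h | h, h' | h'⟩ := hp
      · exact absurd (h.trans h'.symm) hl'
      · exact ⟨.inl h.symm, .inr h'.symm⟩
      · exact ⟨.inr h'.symm, .inl h.symm⟩
      · exact absurd (h.trans h'.symm) hl'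
    · exact (P.G.cproj_eq_iff a).2 (.inr hp)
  have ii := P.G.inv_inv
  -- Four possible positions of a common end; the last three are brought to the first by passing to
  -- opposite half-edges.
  by_cases s1 : P.G.vert c = P.G.vert a
  · exact P.K2_antisymm_of_shared a c hl hl' hc1.1 s1 fun e => hp ⟨.inl s1, .inr e⟩
  by_cases s2 : P.G.vert c = P.G.vert (P.G.inv a)
  · rw [← K2_inv_left, ← K2_inv_right P c a]
    refine P.K2_antisymm_of_shared _ c ((P.loop_inv a).not.2 hl) hl' hc1.2 s2 fun e =>
      hp ⟨.inr s2, .inl ?_⟩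
    rwa [ii] at e
  by_cases s3 : P.G.vert (P.G.inv c) = P.G.vert a
  · rw [← K2_inv_right, ← K2_inv_left P c a]
    refine P.K2_antisymm_of_shared a _ hl ((P.loop_inv c).not.2 hl') ha1.2.symm s3 fun e =>
      hp ⟨.inr ?_, .inl s3⟩
    rwa [ii] at e
  by_cases s4 : P.G.vert (P.G.inv c) = P.G.vert (P.G.inv a)
  · rw [← K2_inv_right, ← K2_inv_left P c a, ← K2_inv_left, ← K2_inv_right P _ a]
    refine P.K2_antisymm_of_shared _ _ ((P.loop_inv a).not.2 hl) ((P.loop_inv c).not.2 hl')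
      (fun e => hc1.1 (P.G.inv.injective e)) s4 fun e => hp ⟨.inl ?_, .inr s4⟩
    rwa [ii, ii] at e
  exact P.K2_antisymm_of_disjoint a c hl hl' ⟨s1, s2⟩ ⟨s3, s4⟩

end

end BGraph

/-! ### Cyclic permutations -/

section Cyc

variable {α : Type*} {n : ℕ} {h : Fin n → α}

lemma formPerm_ofFn_apply [NeZero n] (hh : Function.Injective h) (l : Fin n) :
    (List.ofFn h).formPerm (h l) = h (l + 1) := by
  have hl : l.1 < (List.ofFn h).length := by simp
  have := List.formPerm_apply_getElem (List.ofFn h) (List.nodup_ofFn.2 hh) l.1 hl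
  simp only [List.getElem_ofFn, List.length_ofFn] at this
  refine this.trans (congrArg h (Fin.ext ?_))
  rw [Fin.val_add, Fin.val_one', Nat.add_mod_mod]

lemma formPerm_ofFn_of_notMem {x : α} (hx : ∀ l, h l ≠ x) : (List.ofFn h).formPerm x = x :=
  List.formPerm_apply_of_notMem (by simpa [List.mem_ofFn] using hx)

lemma formPerm_ofFn_mem (h : Fin n → α) (l : Fin n) : ∃ m, (List.ofFn h).formPerm (h l) = h m := by
  have := List.formPerm_apply_mem_of_mem (l := List.ofFn h) (x := h l) (by simp [List.mem_ofFn])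
  obtain ⟨m, hm⟩ := (List.mem_ofFn' _ _).1 this
  exact ⟨m, hm.symm⟩

lemma formPerm_ofFn_map {β : Type*} (e : α ≃ β) (hh : Function.Injective h) (x : α) :
    (List.ofFn (e ∘ h)).formPerm (e x) = e ((List.ofFn h).formPerm x) := by
  rcases Nat.eq_zero_or_pos n with rfl | hn
  · simp
  have : NeZero n := ⟨hn.ne'⟩
  by_cases hx : ∃ l, h l = x
  · obtain ⟨l, rfl⟩ := hx
    rw [formPerm_ofFn_apply hh]
    exact formPerm_ofFn_apply (e.injective.comp hh) l
  · push Not at hx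
    rw [formPerm_ofFn_of_notMem hx, formPerm_ofFn_of_notMem (h := e ∘ h)
      fun l hl => hx l (e.injective hl)]

lemma formPerm_ofFn_rotate [NeZero n] (hh : Function.Injective h) (c : Fin n) :
    (List.ofFn fun l => h (l + c)).formPerm = (List.ofFn h).formPerm := by
  ext x
  by_cases hx : ∃ l, h l = x
  · obtain ⟨l, rfl⟩ := hx
    have hc : Function.Injective fun l => h (l + c) := hh.comp (add_left_injective c)
    have := formPerm_ofFn_apply hc (l - c)
    simp only [sub_add_cancel] at this
    rw [formPerm_ofFn_apply hh, this]
    congr 1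
    abel
  · push Not at hx
    rw [formPerm_ofFn_of_notMem hx, formPerm_ofFn_of_notMem fun l => hx _]

/-- `List.formPerm` is the product of the transpositions of neighbours, so it can be cut at any
entry that is kept in both halves. -/
lemma formPerm_append_cons (x : α) (m : List α) : ∀ l : List α,
    (l ++ x :: m).formPerm = (l ++ [x]).formPerm * (x :: m).formPerm
  | [] => by simp
  | [y] => by simp
  | y :: z :: l => by
    have := formPerm_append_cons x m (z :: l)
    simp only [List.cons_append, List.formPerm_cons_cons] at this ⊢
    rw [this, mul_assoc]

/-- Two cycles meeting in the single point `x` multiply to one cycle. This is the permutation form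
of attaching a polygon to a side of another one. -/
lemma formPerm_cons_append (x : α) (l m : List α) (hn : (x :: l ++ m).Nodup) :
    (x :: l ++ m).formPerm = (x :: m).formPerm * (x :: l).formPerm := by
  -- The list is rotated until `x` separates the two parts, and then cut there.
  have h1 : (x :: l ++ m).formPerm = (m ++ x :: l).formPerm :=
    List.formPerm_eq_of_isRotated hn ⟨(x :: l).length, by rw [List.rotate_append_length_eq]⟩
  have hm : (m ++ [x]).Nodup := by
    have := (List.perm_append_comm.nodup_iff.1 hn)
    refine this.sublist ?_
    simp
  rw [h1, formPerm_append_cons]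
  congr 1
  exact List.formPerm_eq_of_isRotated hm ⟨m.length, by rw [List.rotate_append_length_eq]; rfl⟩

end Cyc

/-! ### Gluing polygons in blocked graphs -/

/-- The equivalence relation that identifies the elements of `T`. -/
def merge {B : Type*} (T : Set B) : Setoid B where
  r a b := a = b ∨ (a ∈ T ∧ b ∈ T)
  iseqv := ⟨fun _ => .inl rfl, by rintro a b (rfl | h); exacts [.inl rfl, .inr h.symm], by
    rintro a b c (rfl | h) (rfl | h')
    exacts [.inl rfl, .inr h', .inr h, .inr ⟨h.1, h'.2⟩]⟩

lemma merge_iff {B : Type*} {T : Set B} {a b : B} : merge T a b ↔ a = b ∨ (a ∈ T ∧ b ∈ T) :=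
  Iff.rfl

namespace BGraph

open OGraph

/-- The block of a half-edge. -/
def hblk (P : BGraph O) (x : P.G.H) : P.B := P.blk (P.G.vert x)

lemma hblk_inv (P : BGraph O) (x : P.G.H) : P.hblk (P.G.inv x) = P.hblk x := P.blk_inv x

lemma Iso.hblk {P Q : BGraph O} {s : ℤˣ} (e : Iso P Q s) (x : P.G.H) :
    Q.hblk (e.onH x) = e.onB (P.hblk x) := by
  rw [BGraph.hblk, e.vert, e.blk, BGraph.hblk]

lemma rewire_inv_apply (G : OGraph O) (g : Equiv.Perm G.H) (x : G.H) :
    (G.rewire g).inv (g x) = g (G.inv x) := by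
  change g (G.inv (g⁻¹ (g x))) = _
  rw [show g⁻¹ (g x) = x from g.symm_apply_apply x]

lemma rewire_tail_apply (G : OGraph O) (g : Equiv.Perm G.H) (x : G.H) :
    (G.rewire g).tail (g x) = G.tail x := by
  change G.tail (g⁻¹ (g x)) = _
  rw [show g⁻¹ (g x) = x from g.symm_apply_apply x]

/-- Rewire the edges by `g` and identify blocks by `r`. -/
def mod (P : BGraph O) (r : Setoid P.B) (g : Equiv.Perm P.G.H)
    (hg : ∀ y, r (P.hblk (g y)) (P.hblk y)) : BGraph O where
  G := P.G.rewire g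
  B := Quotient r
  blk v := Quotient.mk r (P.blk v)
  blk_inv y := by
    obtain ⟨z, rfl⟩ := g.surjective y
    rw [rewire_inv_apply]
    refine Quotient.sound (r.trans (hg _) ?_)
    rw [hblk_inv]
    exact r.symm (hg _)

section Mod

variable {P Q : BGraph O}

/-- The direction of an edge is transported along `g` together with the edge, so the edge at `a`
corresponds to the one at `g a`. -/
lemma mod_reverse (r : Setoid P.B) (g : Equiv.Perm P.G.H) (a : P.G.H) (hg) :
    (P.reverse a).mod r g hg = (P.mod r g hg).reverse (g a) := by
  refine wire_congr (P.mod r g hg) (i := (P.mod r g hg).G.inv) rfl ?_ rfl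
    (P.mod r g hg).G.inv_inv (P.mod r g hg).G.inv_ne ((P.reverse a).mod r g hg).G.tail_inv
    (P.mod r g hg).blk_inv (P.mod r g hg).G.inv_inv (P.mod r g hg).G.inv_ne
    ((P.mod r g hg).reverse (g a)).G.tail_inv (P.mod r g hg).blk_inv
  funext x
  obtain ⟨x, rfl⟩ := g.surjective x
  change (if g⁻¹ (g x) = a ∨ g⁻¹ (g x) = P.G.inv a then !P.G.tail (g⁻¹ (g x))
    else P.G.tail (g⁻¹ (g x))) =
    if g x = g a ∨ g x = (P.G.rewire g).inv (g a) then !P.G.tail (g⁻¹ (g x))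
    else P.G.tail (g⁻¹ (g x))
  rw [rewire_inv_apply]
  simp

/-- The identity on the underlying graph as a similarity. -/
def _root_.Fusion.OGraph.simRewire (G : OGraph O) (g : Equiv.Perm G.H) : Sim G (G.rewire g) where
  onV := Equiv.refl _
  onH := Equiv.refl _
  vert _ := rfl
  lab _ _ _ _ _ h := h

/-- The isomorphism of rewired graphs induced by an isomorphism. -/
def Iso.mod {s : ℤˣ} (e : Iso P Q s) {r : Setoid P.B} {r' : Setoid Q.B} {g g'} (hg hg')
    (hr : ∀ a b, r a b ↔ r' (e.onB a) (e.onB b)) (hgg : ∀ x, g' (e.onH x) = e.onH (g x)) :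
    Iso (P.mod r g hg) (Q.mod r' g' hg') s where
  toSim := { e.toSim with }
  inv x := by
    obtain ⟨x, rfl⟩ := g.surjective x
    change (Q.G.rewire g').inv (e.onH (g x)) = e.onH ((P.G.rewire g).inv (g x))
    rw [rewire_inv_apply, ← hgg, rewire_inv_apply, e.inv, hgg]
  tail x := by
    obtain ⟨x, rfl⟩ := g.surjective x
    change (Q.G.rewire g').tail (e.onH (g x)) = (P.G.rewire g).tail (g x)
    rw [rewire_tail_apply, ← hgg, rewire_tail_apply, e.tail]
  onB := Quotient.congr e.onB hr
  blk v := congrArg (Quotient.mk r') (e.blk v)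
  ord := e.ord

/-- Two successive rewirings. -/
def isoModMod (r : Setoid P.B) (g hg) (r' : Setoid (P.mod r g hg).B) (g' : Equiv.Perm P.G.H) (hg')
    (r'' : Setoid P.B) (hr : ∀ a b, r'' a b ↔ r' (Quotient.mk r a) (Quotient.mk r b)) (hg'') :
    Iso (P.mod r'' (g' * g) hg'') ((P.mod r g hg).mod r' g' hg') 1 where
  onV := Equiv.refl _
  onH := Equiv.refl _
  vert _ := rfl
  lab _ _ _ _ _ h := h
  inv _ := rfl
  tail _ := rfl
  onB := equivOfSurjective (Quotient.mk r'') (fun a => Quotient.mk r' (Quotient.mk r a))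
    Quotient.mk_surjective (Quotient.mk_surjective.comp Quotient.mk_surjective)
    (fun a b => Quotient.eq.trans ((hr a b).trans Quotient.eq.symm))
  blk _ := (equivOfSurjective_apply (f := Quotient.mk r'')
    (g := fun a => Quotient.mk r' (Quotient.mk r a)) ..).symm
  ord := (SPerm.of_eq (List.map_id _))

end Mod

section Glue

variable (P : BGraph O) {n : ℕ}

/-- The blocks of a tuple of half-edges are merged. -/
def mergeBlocks (h : Fin n → P.G.H) : Setoid P.B := merge (Set.range fun l => P.hblk (h l))

variable {P} in
lemma mergeBlocks_cyc (h : Fin n → P.G.H) (y : P.G.H) :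
    P.mergeBlocks h (P.hblk (P.G.cyc h y)) (P.hblk y) := by
  by_cases hy : ∃ l, h l = y
  · obtain ⟨l, rfl⟩ := hy
    obtain ⟨m, hm⟩ := formPerm_ofFn_mem h l
    rw [OGraph.cyc, hm]
    exact .inr ⟨⟨m, rfl⟩, ⟨l, rfl⟩⟩
  · push Not at hy
    rw [OGraph.cyc, formPerm_ofFn_of_notMem hy]

/-- Gluing a polygon to edges, and merging the blocks of these edges. -/
def glueB (h : Fin n → P.G.H) : BGraph O :=
  P.mod (P.mergeBlocks h) (P.G.cyc h) (mergeBlocks_cyc h)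

variable {P} in
/-- The isomorphism of glued graphs induced by an isomorphism. -/
def Iso.glueB {Q : BGraph O} {s : ℤˣ} (e : Iso P Q s) {h : Fin n → P.G.H}
    (hh : Function.Injective h) : Iso (P.glueB h) (Q.glueB (e.onH ∘ h)) s :=
  e.mod _ _ (fun a b => by
    rw [mergeBlocks, mergeBlocks, merge_iff, merge_iff, e.onB.injective.eq_iff]
    simp only [Set.mem_range, Function.comp, e.hblk, e.onB.injective.eq_iff])
    (fun x => formPerm_ofFn_map e.onH hh x)

/-- Half-edges in different blocks. -/
def InDiff (h : Fin n → P.G.H) : Prop :=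
  Function.Injective fun l => P.hblk (h l)

variable {P} in
lemma InDiff.injective {h : Fin n → P.G.H} (hh : P.InDiff h) : Function.Injective h :=
  fun _ _ e => hh (congrArg P.hblk e)

variable {P} in
lemma InDiff.inv_ne {h : Fin n → P.G.H} (hh : P.InDiff h) (l m : Fin n) :
    P.G.inv (h l) ≠ h m := by
  intro e
  obtain rfl : l = m := hh (((congrArg P.hblk e).symm.trans (P.hblk_inv _)).symm)
  exact P.G.inv_ne _ e

lemma Iso.inDiff {P Q : BGraph O} {s : ℤˣ} (e : Iso P Q s)
    (h : Fin n → P.G.H) : Q.InDiff (e.onH ∘ h) ↔ P.InDiff h := by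
  simp only [InDiff, Function.comp, e.hblk]
  exact e.onB.injective.of_comp_iff _

variable [NeZero n]

/-- Gluing a polygon and contracting the first new edge. -/
def fterm (h : Fin n → P.G.H) : BSpace O := (P.glueB h).pcontract (P.G.cyc h (h 0))

lemma fterm_iso {P Q : BGraph O} {s : ℤˣ} (e : Iso P Q s) {h : Fin n → P.G.H}
    (hh : Function.Injective h) : Q.fterm (e.onH ∘ h) = sg k s • P.fterm h := by
  have := pcontract_iso (e.glueB hh) (P.G.cyc h (h 0))
  rw [fterm, fterm, ← this]
  exact congrArg _ (formPerm_ofFn_map e.onH hh (h 0))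

lemma fterm_reverse (a : P.G.H) (h : Fin n → P.G.H) : (P.reverse a).fterm h = -P.fterm h := by
  refine Eq.trans ?_ ((P.glueB h).pcontract_reverse (P.G.cyc h (h 0)) (P.G.cyc h a))
  have key : ∀ (P' P'' : BGraph O) (_ : P' = P'') (c : P'.G.H) (c' : P''.G.H) (_ : HEq c c'),
      P'.pcontract c = P''.pcontract c' := by
    rintro P' _ rfl c _ ⟨⟩
    rfl
  exact key _ _ (mod_reverse (P.mergeBlocks h) (P.G.cyc h) a (mergeBlocks_cyc h)) _ _ HEq.rfl

lemma isLinearMap_fterm (h : Fin n → P.G.H) (v : P.G.V) :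
    IsLinearMap k fun p => (P.setLabel v p).fterm h :=
  (P.glueB h).isLinearMap_pcontract (P.G.cyc h (h 0)) v

/-- The sum over all tuples of directed edges in different blocks. -/
def fsum (n : ℕ) [NeZero n] (P : BGraph O) : BSpace O :=
  ∑ h : Fin n → P.G.H with P.InDiff h, P.fterm h

end Glue

end BGraph

/-- The fusion operation on blocked graphs. -/
def fusion (O : CyclicOperad.{u, v} k) (n : ℕ) [NeZero n] : Module.End k (BSpace O) :=
  BSpace.lift (BGraph.fsum n)
    (fun {P Q s} e => by
      rw [BGraph.fsum, BGraph.fsum, Finset.smul_sum]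
      refine (Finset.sum_bij (fun h _ => e.onH ∘ h) ?_ ?_ ?_ ?_).symm
      · simp [e.inDiff]
      · exact fun h _ h' _ hh => funext fun l => e.onH.injective (congrFun hh l)
      · intro h hh
        refine ⟨e.onH.symm ∘ h, ?_, ?_⟩
        · rw [Finset.mem_filter] at hh ⊢
          refine ⟨Finset.mem_univ _, (e.inDiff _).1 ?_⟩
          convert hh.2
          ext l
          simp
        · ext l
          simp
      · intro h hh
        exact (BGraph.fterm_iso e (Finset.mem_filter.1 hh).2.injective).symm)
    (fun P a => by
      rw [BGraph.fsum, BGraph.fsum, ← Finset.sum_neg_distrib]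
      exact Finset.sum_congr rfl fun h _ => P.fterm_reverse a h)
    (fun P v => by
      have : (fun p => (P.setLabel v p).fsum n) = fun p =>
          (∑ h : Fin n → P.G.H with P.InDiff h, (P.isLinearMap_fterm h v).mk') p := by
        funext p
        rw [LinearMap.sum_apply]
        rfl
      rw [this]
      exact LinearMap.isLinear _)

lemma fusion_cls (n : ℕ) [NeZero n] (P : BGraph O) :
    fusion O n P.cls = ∑ h : Fin n → P.G.H with P.InDiff h, P.fterm h :=
  BSpace.lift_cls _ _ _ _ P

/-! ### Reversal of a polygon -/

namespace BGraph

open OGraph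

section Reversal

variable {P : BGraph O} {n : ℕ}

lemma pcontract_congr {P' P'' : BGraph O} (e : P' = P'') {c : P'.G.H} {c' : P''.G.H}
    (h : HEq c c') : P'.pcontract c = P''.pcontract c' := by
  subst e
  cases h
  rfl

lemma mod_congr_inv {r r' : Setoid P.B} {g g' : Equiv.Perm P.G.H} (hr : r = r') (hg hg')
    (hi : ∀ x, (P.G.rewire g).inv x = (P.G.rewire g').inv x)
    (ht : ∀ x, (P.G.rewire g).tail x = (P.G.rewire g').tail x) :
    P.mod r g hg = P.mod r' g' hg' := by
  subst hr
  exact wire_congr (P.mod r g hg) (i' := (P.G.rewire g').inv) (Equiv.ext hi) (funext ht) rfl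
    (P.mod r g hg).G.inv_inv (P.mod r g hg).G.inv_ne (P.mod r g hg).G.tail_inv
    (P.mod r g hg).blk_inv (P.mod r g' hg').G.inv_inv (P.mod r g' hg').G.inv_ne
    (P.mod r g' hg').G.tail_inv (P.mod r g' hg').blk_inv

/-- Opposite half-edges lie in the same block, so no `inv (h l)` occurs in the tuple: the cycle
moves only one half of each chosen edge. -/
lemma InDiff.cyc_inv {h : Fin n → P.G.H} (hh : P.InDiff h) (l : Fin n) :
    P.G.cyc h (P.G.inv (h l)) = P.G.inv (h l) :=
  formPerm_ofFn_of_notMem fun m => (hh.inv_ne l m).symm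

lemma glue_inv_of_ne {h : Fin n → P.G.H} {x : P.G.H} (h1 : ∀ l, h l ≠ x)
    (h2 : ∀ l, h l ≠ P.G.inv x) : (P.G.rewire (P.G.cyc h)).inv x = P.G.inv x := by
  have e1 : P.G.cyc h x = x := formPerm_ofFn_of_notMem h1
  have e2 : P.G.cyc h (P.G.inv x) = P.G.inv x := formPerm_ofFn_of_notMem h2
  have := rewire_inv_apply P.G (P.G.cyc h) x
  rwa [e1, e2] at this

lemma glue_tail_of_ne {h : Fin n → P.G.H} {x : P.G.H} (h1 : ∀ l, h l ≠ x) :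
    (P.G.rewire (P.G.cyc h)).tail x = P.G.tail x := by
  have e1 : P.G.cyc h x = x := formPerm_ofFn_of_notMem h1
  have := rewire_tail_apply P.G (P.G.cyc h) x
  rwa [e1] at this

variable [NeZero n]

lemma InDiff.cyc_apply {h : Fin n → P.G.H} (hh : P.InDiff h) (l : Fin n) :
    P.G.cyc h (h l) = h (l + 1) := formPerm_ofFn_apply hh.injective l

lemma InDiff.glue_inv {h : Fin n → P.G.H} (hh : P.InDiff h) (l : Fin n) :
    (P.G.rewire (P.G.cyc h)).inv (h (l + 1)) = P.G.inv (h l) := by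
  rw [← hh.cyc_apply, rewire_inv_apply, hh.cyc_inv]

lemma InDiff.glue_inv_inv {h : Fin n → P.G.H} (hh : P.InDiff h) (l : Fin n) :
    (P.G.rewire (P.G.cyc h)).inv (P.G.inv (h l)) = h (l + 1) := by
  rw [← hh.glue_inv]
  exact (P.G.rewire (P.G.cyc h)).inv_inv _

lemma InDiff.glue_tail {h : Fin n → P.G.H} (hh : P.InDiff h) (l : Fin n) :
    (P.G.rewire (P.G.cyc h)).tail (h (l + 1)) = P.G.tail (h l) := by
  rw [← hh.cyc_apply, rewire_tail_apply]

/-- The same edges with the opposite directions, in the opposite cyclic order. -/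
def rev (P : BGraph O) (h : Fin n → P.G.H) (l : Fin n) : P.G.H := P.G.inv (h (1 - l))

lemma rev_rev (h : Fin n → P.G.H) : P.rev (P.rev h) = h := by
  funext l
  rw [rev, rev, P.G.inv_inv, sub_sub_cancel]

lemma InDiff.rev {h : Fin n → P.G.H} (hh : P.InDiff h) : P.InDiff (P.rev h) := by
  intro l m e
  have e' : P.hblk (P.G.inv (h (1 - l))) = P.hblk (P.G.inv (h (1 - m))) := e
  rw [hblk_inv, hblk_inv] at e'
  exact sub_right_injective (hh e')

lemma mergeBlocks_rev (h : Fin n → P.G.H) : P.mergeBlocks (P.rev h) = P.mergeBlocks h := by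
  unfold mergeBlocks
  congr 1
  ext b
  constructor
  · rintro ⟨l, rfl⟩
    exact ⟨1 - l, (P.hblk_inv _).symm⟩
  · rintro ⟨l, rfl⟩
    refine ⟨1 - l, ?_⟩
    change P.hblk (P.G.inv (h (1 - (1 - l)))) = _
    rw [hblk_inv, sub_sub_cancel]

/-- When every `h l` is a tail, both tuples give the same new edges with the same directions. The
index `1 - l` in `rev` is chosen so that the marked new edge is also the same: it is seen from `h 1`
in one case and from the opposite half-edge `inv (h 0)` in the other. -/
lemma fterm_rev_of_tail {h : Fin n → P.G.H} (hh : P.InDiff h) (ht : ∀ l, P.G.tail (h l) = true) :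
    P.fterm (P.rev h) = P.fterm h := by
  have hr := hh.rev
  have e0 : ∀ l, P.rev h (1 - l) = P.G.inv (h l) := fun l => by rw [BGraph.rev, sub_sub_cancel]
  have cases : ∀ x : P.G.H, (∃ l, x = h (l + 1)) ∨ (∃ l, x = P.G.inv (h l)) ∨
      ((∀ l, h l ≠ x) ∧ (∀ l, h l ≠ P.G.inv x)) := by
    intro x
    by_cases h1 : ∃ l, h l = x
    · obtain ⟨l, rfl⟩ := h1
      exact .inl ⟨l - 1, by rw [sub_add_cancel]⟩
    by_cases h2 : ∃ l, h l = P.G.inv x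
    · obtain ⟨l, hl⟩ := h2
      exact .inr (.inl ⟨l, by rw [hl, P.G.inv_inv]⟩)
    push Not at h1 h2
    exact .inr (.inr ⟨h1, h2⟩)
  have hmod : P.glueB (P.rev h) = P.glueB h := by
    refine mod_congr_inv (mergeBlocks_rev h) _ _ (fun x : P.G.H => ?_) (fun x : P.G.H => ?_)
    · rcases cases x with ⟨l, rfl⟩ | ⟨l, rfl⟩ | ⟨h1, h2⟩
      · rw [hh.glue_inv]
        have := hr.glue_inv_inv (1 - (l + 1))
        rw [e0, P.G.inv_inv] at this
        rw [this, ← e0]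
        congr 1
        abel
      · rw [hh.glue_inv_inv]
        have := hr.glue_inv (1 - l - 1)
        rw [sub_add_cancel, e0] at this
        rw [this, BGraph.rev, P.G.inv_inv]
        congr 1
        abel
      · exact (glue_inv_of_ne
          (fun l hl => h2 (1 - l) (by rw [← hl]; exact (P.G.inv_inv _).symm))
          (fun l hl => h1 (1 - l) (P.G.inv.injective hl))).trans (glue_inv_of_ne h1 h2).symm
    · rcases cases x with ⟨l, rfl⟩ | ⟨l, rfl⟩ | ⟨h1, h2⟩
      · rw [hh.glue_tail, ht, glue_tail_of_ne, ht]
        exact fun m => hh.inv_ne _ _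
      · rw [glue_tail_of_ne fun m => (hh.inv_ne l m).symm]
        have := hr.glue_tail (1 - l - 1)
        rw [sub_add_cancel, e0] at this
        rw [this, BGraph.rev, P.G.tail_inv, P.G.tail_inv, ht, ht]
      · exact (glue_tail_of_ne
          (fun l hl => h2 (1 - l) (by rw [← hl]; exact (P.G.inv_inv _).symm))).trans
          (glue_tail_of_ne h1).symm
  have e1 : P.G.cyc (P.rev h) (P.rev h 0) = (P.glueB h).G.inv (P.G.cyc h (h 0)) := by
    rw [hr.cyc_apply, hh.cyc_apply]
    refine Eq.trans ?_ (hh.glue_inv 0).symm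
    rw [BGraph.rev, zero_add, sub_self]
  exact (pcontract_congr hmod (heq_of_eq e1)).trans ((P.glueB h).pcontract_inv _)

/-- Reversing an edge of `P` changes the sign of both sides, so the edges directed against `h` can
be turned one at a time; their number is the induction variable. -/
lemma fterm_rev {h : Fin n → P.G.H} (hh : P.InDiff h) : P.fterm (P.rev h) = P.fterm h := by
  induction hm : (Finset.univ.filter fun l => P.G.tail (h l) = false).card using
    Nat.strong_induction_on generalizing P with
  | _ m ih =>
    by_cases h0 : ∃ l, P.G.tail (h l) = false
    · obtain ⟨l, hl⟩ := h0
      have ht : ∀ x, (P.reverse (h l)).G.tail (h x) = if x = l then true else P.G.tail (h x) := by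
        intro x
        change (if h x = h l ∨ h x = P.G.inv (h l) then !P.G.tail (h x) else P.G.tail (h x)) = _
        by_cases hx : x = l
        · subst hx
          simp [hl]
        · rw [if_neg hx, if_neg]
          rintro (e | e)
          · exact hx (hh.injective e)
          · exact hh.inv_ne _ _ e.symm
      have := ih _ ?_ (P := P.reverse (h l)) hh rfl
      · rw [P.fterm_reverse] at this
        have h2 : (P.reverse (h l)).fterm ((P.reverse (h l)).rev h) = -P.fterm (P.rev h) :=
          P.fterm_reverse (h l) (P.rev h)
        exact neg_injective (h2.symm.trans this)
      · rw [← hm]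
        refine Finset.card_lt_card ⟨fun x hx => ?_, fun hs => ?_⟩
        · simp only [Finset.mem_filter, Finset.mem_univ, true_and, ht] at hx ⊢
          split_ifs at hx
          exact hx
        · have := hs (Finset.mem_filter.2 ⟨Finset.mem_univ l, hl⟩)
          simp [ht] at this
    · push Not at h0
      exact fterm_rev_of_tail hh fun l => by simpa using h0 l

end Reversal

/-! ### Gluing after a contraction -/

section ContrGlue

variable {Q : BGraph O} {a : Q.G.H} {n : ℕ}

/-- Half-edges that do not belong to the edge of `a`. -/
def Avoids (Q : BGraph O) (a : Q.G.H) (h : Fin n → Q.G.H) : Prop :=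
  ∀ l, h l ≠ a ∧ h l ≠ Q.G.inv a

lemma Avoids.inv_eq {h : Fin n → Q.G.H} (hh : Q.Avoids a h) :
    (Q.G.rewire (Q.G.cyc h)).inv a = Q.G.inv a :=
  glue_inv_of_ne (fun l => (hh l).1) (fun l => (hh l).2)

/-- Gluing a polygon commutes with the contraction of an edge that is not involved. -/
lemma exists_iso_contr_glue (hl : Q.G.vert a ≠ Q.G.vert (Q.G.inv a)) (h : Fin n → Q.G.CH a)
    (hi : Function.Injective h)
    (hl' : (Q.glueB fun l => (h l).1).G.vert a ≠
      (Q.glueB fun l => (h l).1).G.vert ((Q.glueB fun l => (h l).1).G.inv a)) :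
    ∃ e : Iso ((Q.contr a hl).glueB (n := n) h) ((Q.glueB fun l => (h l).1).contr a hl') 1,
      ∀ x : Q.G.CH a, (e.onH x : (Q.glueB fun l => (h l).1).G.CH a).1 = x.1 := by
  have hav : Q.Avoids a fun l => (h l).1 := fun l => (h l).2
  let σ : Sim Q.G (Q.glueB fun l => (h l).1).G := Q.G.simRewire _
  have hinv : σ.onH (Q.G.inv a) = (Q.glueB fun l => (h l).1).G.inv (σ.onH a) := hav.inv_eq.symm
  let S := σ.contract hinv hl hl'
  -- The cycle of the contracted graph is the restriction of the cycle of `Q`, since the tuple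
  -- avoids the contracted edge.
  have hcyc : ∀ x : Q.G.CH a, ((Q.contr a hl).G.cyc h x : Q.G.CH a).1 =
      Q.G.cyc (fun l => (h l).1) x.1 := by
    intro x
    rcases Nat.eq_zero_or_pos n with rfl | hn
    · exact congrArg Subtype.val (formPerm_ofFn_of_notMem fun l => l.elim0)
    have : NeZero n := ⟨hn.ne'⟩
    have hi' : Function.Injective fun l => (h l).1 := Subtype.val_injective.comp hi
    by_cases hx : ∃ l, h l = x
    · obtain ⟨l, rfl⟩ := hx
      exact (congrArg Subtype.val (formPerm_ofFn_apply hi l)).trans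
        (formPerm_ofFn_apply hi' l).symm
    · push Not at hx
      exact (congrArg Subtype.val (formPerm_ofFn_of_notMem hx)).trans
        (formPerm_ofFn_of_notMem fun l e => hx l (Subtype.ext e)).symm
  have hSH : ∀ x : Q.G.CH a, (S.onH x : (Q.glueB fun l => (h l).1).G.CH a).1 = x.1 := fun _ => rfl
  have hSV : ∀ w : Q.G.V, S.onV (Q.G.cproj a w) = (Q.glueB fun l => (h l).1).G.cproj a w :=
    σ.contract_onV hinv hl hl'
  refine ⟨{ onV := S.onV, onH := S.onH, vert := S.vert, lab := S.lab, inv := ?_, tail := ?_,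
            onB := Quotient.congr (Equiv.refl _) ?_, blk := ?_, ord := ?_ }, hSH⟩
  · intro x
    obtain ⟨x, rfl⟩ := ((Q.contr a hl).G.cyc h).surjective x
    have e2 : ((Q.contr a hl).glueB h).G.inv ((Q.contr a hl).G.cyc h x) =
        (Q.contr a hl).G.cyc h ((Q.contr a hl).G.inv x) :=
      rewire_inv_apply (Q.contr a hl).G ((Q.contr a hl).G.cyc h) x
    rw [e2]
    refine Subtype.ext ?_
    change (Q.glueB fun l => (h l).1).G.inv ((Q.contr a hl).G.cyc h x : Q.G.CH a).1 =
      ((Q.contr a hl).G.cyc h ((Q.contr a hl).G.inv x) : Q.G.CH a).1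
    exact ((congrArg _ (hcyc x)).trans (rewire_inv_apply Q.G _ _)).trans
      (hcyc ((Q.contr a hl).G.inv x)).symm
  · intro x
    obtain ⟨x, rfl⟩ := ((Q.contr a hl).G.cyc h).surjective x
    refine Eq.trans ?_ (rewire_tail_apply (Q.contr a hl).G ((Q.contr a hl).G.cyc h) x).symm
    change (Q.glueB fun l => (h l).1).G.tail ((Q.contr a hl).G.cyc h x : Q.G.CH a).1 = _
    exact (congrArg _ (hcyc x)).trans (rewire_tail_apply Q.G _ _)
  · have hr : (Q.contr a hl).mergeBlocks h = Q.mergeBlocks fun l => (h l).1 := by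
      refine congrArg merge (congrArg Set.range (funext fun l => ?_))
      exact Q.contr_blk a hl _
    intro b c
    exact iff_of_eq (congrArg (fun r : Setoid Q.B => r b c) hr)
  · intro w
    obtain ⟨w, rfl⟩ := Q.G.cproj_surjective a w
    refine (congrArg ((Q.glueB fun l => (h l).1).contr a hl').blk (hSV w)).trans
      ((contr_blk _ _ hl' w).trans ?_)
    exact congrArg (Quotient.mk _) (Q.contr_blk a hl w).symm
  · refine SPerm.of_eq ((map_contract_ord Q.G a hl S.onV).trans
      (Eq.trans ?_ (contract_ord' (Q.glueB fun l => (h l).1).G a hl').symm))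
    refine congrArg₂ List.cons ?_ ?_
    · exact (hSV _).trans (cproj_vert (Q.glueB fun l => (h l).1).G a)
    · refine (List.map_congr_left fun w _ => hSV w).trans (congrArg (List.map _) ?_)
      change Q.G.ord.filter _ = Q.G.ord.filter _
      congr 1
      funext w
      have : (Q.glueB fun l => (h l).1).G.inv a = Q.G.inv a := hav.inv_eq
      rw [this]
      rfl

variable [NeZero n]

/-- Postponing the contraction of `a` until after the gluing turns gluing in the contracted graph
into a double contraction, to which antisymmetry applies. -/
lemma fterm_contr (hl : Q.G.vert a ≠ Q.G.vert (Q.G.inv a)) (h : Fin n → Q.G.CH a)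
    (hi : Function.Injective h) :
    sg k (Q.G.tau a * Q.G.endSign a) • (Q.contr a hl).fterm h =
      (Q.glueB fun l => (h l).1).K2 a (Q.G.cyc (fun l => (h l).1) (h 0).1) := by
  have hav : Q.Avoids a fun l => (h l).1 := fun l => (h l).2
  have hi' : Function.Injective fun l => (h l).1 := Subtype.val_injective.comp hi
  have hia : (Q.glueB fun l => (h l).1).G.inv a = Q.G.inv a := hav.inv_eq
  have hl' : (Q.glueB fun l => (h l).1).G.vert a ≠
      (Q.glueB fun l => (h l).1).G.vert ((Q.glueB fun l => (h l).1).G.inv a) := by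
    rw [hia]
    exact hl
  obtain ⟨e, he⟩ := exists_iso_contr_glue hl h hi hl'
  have hc : Q.G.cyc (fun l => (h l).1) (h 0).1 = (h (0 + 1)).1 := formPerm_ofFn_apply hi' 0
  have hc' : (Q.contr a hl).G.cyc h (h 0) = h (0 + 1) := formPerm_ofFn_apply hi 0
  have hc2 : Q.G.cyc (fun l => (h l).1) (h 0).1 ≠ a ∧
      Q.G.cyc (fun l => (h l).1) (h 0).1 ≠ (Q.glueB fun l => (h l).1).G.inv a := by
    rw [hc, hia]
    exact hav _
  rw [K2_of_pos _ _ _ hl' hc2]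
  have := pcontract_iso e ((Q.contr a hl).G.cyc h (h 0))
  rw [sg_one, one_smul] at this
  refine (congrArg _ this.symm).trans ?_
  -- The polygon does not use the edge of `a`, so its direction, its ends and hence its contraction
  -- sign are unchanged.
  have htau : (Q.glueB fun l => (h l).1).G.tau a = Q.G.tau a := by
    have : (Q.glueB fun l => (h l).1).G.tail a = Q.G.tail a :=
      glue_tail_of_ne fun l => (hav l).1
    exact congrArg (fun b : Bool => if b = true then (1 : ℤˣ) else -1) this
  have hend : (Q.glueB fun l => (h l).1).G.endSign a = Q.G.endSign a := by
    exact congrArg (fun x : Q.G.H => (-1 : ℤˣ) ^ (Q.G.ord.idxOf (Q.G.vert a) +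
      (Q.G.ord.erase (Q.G.vert a)).idxOf (Q.G.vert x))) hia
  rw [htau, hend]
  refine congrArg _ (congrArg _ (Subtype.ext ((he _).trans ?_)))
  exact (congrArg Subtype.val hc').trans hc.symm

/-- Half-edges of the contraction are those of `Q` off the edge of `a`, in the same blocks. If the
edge is a loop it remains one after gluing, and every term on the right is zero. -/
lemma fusion_pcontract : fusion O n (Q.pcontract a) =
    ∑ h : Fin n → Q.G.H with Q.InDiff h ∧ Q.Avoids a h,
      (Q.glueB h).K2 a (Q.G.cyc h (h 0)) := by
  by_cases hl : Q.G.vert a = Q.G.vert (Q.G.inv a)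
  · rw [Q.pcontract_of_loop a hl, map_zero]
    refine (Finset.sum_eq_zero fun h hh => K2_of_loop _ _ _ ?_).symm
    have := (Finset.mem_filter.1 hh).2.2.inv_eq
    exact hl.trans (congrArg Q.G.vert this.symm)
  · rw [Q.pcontract_of_ne a hl, map_smul, fusion_cls, Finset.smul_sum]
    refine Finset.sum_bij (fun (h : Fin n → Q.G.CH a) _ l => (h l).1) ?_ ?_ ?_ ?_
    · intro h hh
      refine Finset.mem_filter.2 ⟨Finset.mem_univ _, ?_, fun l => (h l).2⟩
      intro l m e
      refine (Finset.mem_filter.1 hh).2 (((Q.contr_blk a hl _).trans ?_).trans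
        (Q.contr_blk a hl _).symm)
      exact e
    · intro h _ h' _ e
      exact funext fun l => Subtype.ext (congrFun e l)
    · intro h hh
      obtain ⟨-, h1, h2⟩ := Finset.mem_filter.1 hh
      refine ⟨fun l => (⟨h l, h2 l⟩ : Q.G.CH a), Finset.mem_filter.2 ⟨Finset.mem_univ _, ?_⟩, rfl⟩
      intro l m e
      exact h1 (((Q.contr_blk a hl _).symm.trans e).trans (Q.contr_blk a hl _))
    · intro h hh
      exact fterm_contr hl h (Finset.mem_filter.1 hh).2.injective

lemma K2_glue_rev {h : Fin n → Q.G.H} (hh : Q.InDiff h) (hav : Q.Avoids a h) :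
    (Q.glueB (Q.rev h)).K2 a (Q.G.cyc (Q.rev h) (Q.rev h 0)) =
      (Q.glueB h).K2 a (Q.G.cyc h (h 0)) := by
  have hav' : Q.Avoids a (Q.rev h) := fun l =>
    ⟨fun e => (hav (1 - l)).2 (by rw [← e, rev, Q.G.inv_inv]),
      fun e => (hav (1 - l)).1 (Q.G.inv.injective e)⟩
  by_cases hl : Q.G.vert a = Q.G.vert (Q.G.inv a)
  · have h1 := congrArg Q.G.vert hav.inv_eq
    have h2 := congrArg Q.G.vert hav'.inv_eq
    exact (K2_of_loop (Q.glueB (Q.rev h)) a _ (hl.trans h2.symm)).trans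
      (K2_of_loop (Q.glueB h) a _ (hl.trans h1.symm)).symm
  · have hd : (Q.contr a hl).InDiff (fun l => (⟨h l, hav l⟩ : Q.G.CH a)) := by
      intro l m e
      exact hh (((Q.contr_blk a hl _).symm.trans e).trans (Q.contr_blk a hl _))
    have h1 := fterm_contr hl (fun l => (⟨h l, hav l⟩ : Q.G.CH a)) hd.injective
    have h2 := fterm_contr hl (fun l => (⟨Q.rev h l, hav' l⟩ : Q.G.CH a)) hd.rev.injective
    have h3 : (Q.contr a hl).fterm (fun l => (⟨Q.rev h l, hav' l⟩ : Q.G.CH a)) =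
        (Q.contr a hl).fterm fun l => (⟨h l, hav l⟩ : Q.G.CH a) :=
      (congrArg (Q.contr a hl).fterm (funext fun l => Subtype.ext rfl :
        (fun l => (⟨Q.rev h l, hav' l⟩ : Q.G.CH a)) =
          (Q.contr a hl).rev fun l => (⟨h l, hav l⟩ : Q.G.CH a))).trans (fterm_rev hd)
    exact (h2.symm.trans (congrArg (sg k (Q.G.tau a * Q.G.endSign a) • ·) h3)).trans h1

end ContrGlue

end BGraph

/-! ### Two successive gluings -/

lemma merge_mono {B : Type*} {T T' : Set B} (h : T ⊆ T') : merge T ≤ merge T' := by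
  rintro a b (rfl | hab)
  · exact .inl rfl
  · exact .inr ⟨h hab.1, h hab.2⟩

/-- Merging after `r` only joins the `r`-classes that meet `T`, so no chains of arbitrary length are
needed to describe the join. -/
lemma sup_merge_iff {B : Type*} (r : Setoid B) (T : Set B) (a b : B) :
    (r ⊔ merge T) a b ↔ r a b ∨ (∃ t ∈ T, r t a) ∧ ∃ t ∈ T, r t b := by
  constructor
  -- Merging on the quotient, pulled back to `B`, is an equivalence relation above both terms of the
  -- join, and it has the required explicit form.
  · let s : Setoid B := (merge (Quotient.mk r '' T)).comap (Quotient.mk r)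
    have hs : ∀ a b, s a b → r a b ∨ (∃ t ∈ T, r t a) ∧ ∃ t ∈ T, r t b := by
      rintro a b (h | ⟨⟨t, ht, h⟩, ⟨t', ht', h'⟩⟩)
      · exact .inl (Quotient.exact h)
      · exact .inr ⟨⟨t, ht, Quotient.exact h⟩, ⟨t', ht', Quotient.exact h'⟩⟩
    have h : r ⊔ merge T ≤ s := by
      refine sup_le (fun a b h => .inl (Quotient.sound h)) ?_
      rintro a b (rfl | h)
      · exact .inl rfl
      · exact .inr ⟨⟨a, h.1, rfl⟩, ⟨b, h.2, rfl⟩⟩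
    exact fun hab => hs a b (h hab)
  · have h1 : r ≤ r ⊔ merge T := le_sup_left
    have h2 : merge T ≤ r ⊔ merge T := le_sup_right
    rintro (h | ⟨⟨t, ht, h⟩, ⟨t', ht', h'⟩⟩)
    · exact h1 h
    · exact (r ⊔ merge T).trans ((r ⊔ merge T).symm (h1 h))
        ((r ⊔ merge T).trans (h2 (.inr ⟨ht, ht'⟩)) (h1 h'))

lemma sum_alternating {ι M : Type*} [AddCommGroup M] (s : Finset ι) (f : ι → ι → M)
    (h1 : ∀ a b, f a b = -f b a) (h2 : ∀ a, f a a = 0) : ∑ a ∈ s, ∑ b ∈ s, f a b = 0 := by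
  rw [← Finset.sum_product']
  refine Finset.sum_involution (fun p _ => p.swap) ?_ ?_ ?_ ?_
  · rintro ⟨a, b⟩ -
    change f a b + f b a = 0
    rw [h1 a b, neg_add_cancel]
  · rintro ⟨a, b⟩ - hne e
    obtain rfl : b = a := congrArg Prod.fst e
    exact hne (h2 b)
  · rintro ⟨a, b⟩ h
    simpa [and_comm] using h
  · rintro ⟨a, b⟩ -
    rfl

namespace BGraph

open OGraph

variable (P : BGraph O) {m n : ℕ}

/-- Rewire a graph and contract two edges; it is `0` if blocks are not respected. -/
def modK2 (r : Setoid P.B) (g : Equiv.Perm P.G.H) (a c : P.G.H) : BSpace O :=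
  if hg : ∀ y, r (P.hblk (g y)) (P.hblk y) then (P.mod r g hg).K2 a c else 0

lemma modK2_of {r : Setoid P.B} {g : Equiv.Perm P.G.H} (hg) (a c : P.G.H) :
    P.modK2 r g a c = (P.mod r g hg).K2 a c := dif_pos hg

lemma modK2_antisymm (r : Setoid P.B) (g : Equiv.Perm P.G.H) (a c : P.G.H) :
    P.modK2 r g a c = -P.modK2 r g c a := by
  by_cases hg : ∀ y, r (P.hblk (g y)) (P.hblk y)
  · rw [modK2_of P hg, modK2_of P hg]
    exact K2_antisymm _ _ _
  · rw [modK2, modK2, dif_neg hg, dif_neg hg, neg_zero]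

lemma modK2_self (r : Setoid P.B) (g : Equiv.Perm P.G.H) (a : P.G.H) :
    P.modK2 r g a a = 0 := by
  by_cases hg : ∀ y, r (P.hblk (g y)) (P.hblk y)
  · rw [modK2_of P hg]
    exact K2_self _ _
  · rw [modK2, dif_neg hg]

/-- Both gluings become a single rewiring of `P`, depending only on the product of the cycles and
the join of the block relations. Different pairs of polygons can then be compared. -/
lemma K2_glue_glue (h : Fin m → P.G.H) (h' : Fin n → P.G.H) (a c : P.G.H) :
    ((P.glueB h).glueB h').K2 a c =
      P.modK2 (P.mergeBlocks h ⊔ P.mergeBlocks h') (P.G.cyc h' * P.G.cyc h) a c := by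
  have hg : ∀ y, (P.mergeBlocks h ⊔ P.mergeBlocks h') (P.hblk ((P.G.cyc h' * P.G.cyc h) y))
      (P.hblk y) := fun y =>
    (P.mergeBlocks h ⊔ P.mergeBlocks h').trans
      ((show P.mergeBlocks h' ≤ P.mergeBlocks h ⊔ P.mergeBlocks h' from le_sup_right)
        (mergeBlocks_cyc h' _))
      ((show P.mergeBlocks h ≤ P.mergeBlocks h ⊔ P.mergeBlocks h' from le_sup_left)
        (mergeBlocks_cyc h y))
  rw [modK2_of P hg]
  have hr : ∀ a b, (P.mergeBlocks h ⊔ P.mergeBlocks h') a b ↔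
      (P.glueB h).mergeBlocks h' (Quotient.mk (P.mergeBlocks h) a)
        (Quotient.mk (P.mergeBlocks h) b) := by
    intro a b
    refine (sup_merge_iff _ _ a b).trans (or_congr Quotient.eq.symm (and_congr ?_ ?_))
    all_goals
      constructor
      · rintro ⟨_, ⟨l, rfl⟩, hl⟩
        exact ⟨l, Quotient.sound hl⟩
      · rintro ⟨l, hl⟩
        exact ⟨_, ⟨l, rfl⟩, Quotient.exact hl⟩
  have := K2_iso (P := P.mod _ _ hg) (a := a) (c := c)
    (isoModMod (P.mergeBlocks h) (P.G.cyc h) (mergeBlocks_cyc h)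
    ((P.glueB h).mergeBlocks h') (P.G.cyc h') (mergeBlocks_cyc (P := P.glueB h) h') _ hr hg)
  rw [sg_one, one_smul] at this
  exact this

/-- Tuples of half-edges whose successive gluing merges different blocks. -/
def Compat (h : Fin m → P.G.H) (h' : Fin n → P.G.H) : Prop :=
  P.InDiff h ∧ P.InDiff h' ∧ ∀ l l' q q', P.hblk (h' l) = P.hblk (h q) →
    P.hblk (h' l') = P.hblk (h q') → l = l'

variable {P}

lemma Compat.symm {h : Fin m → P.G.H} {h' : Fin n → P.G.H} (H : P.Compat h h') :
    P.Compat h' h := by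
  refine ⟨H.2.1, H.1, fun l l' q q' e e' => ?_⟩
  obtain rfl := H.2.2 _ _ _ _ e.symm e'.symm
  exact H.1 (e.trans e'.symm)

/-- The first gluing fuses all blocks met by `h` into one, so the second tuple may meet at most one
of them. -/
lemma inDiff_glue {h : Fin m → P.G.H} (hh : P.InDiff h) (h' : Fin n → P.G.H) :
    (P.glueB h).InDiff h' ↔ P.Compat h h' := by
  have key : ∀ l l', (P.glueB h).hblk (h' l) = (P.glueB h).hblk (h' l') ↔
      P.hblk (h' l) = P.hblk (h' l') ∨
        ((∃ q, P.hblk (h q) = P.hblk (h' l)) ∧ ∃ q, P.hblk (h q) = P.hblk (h' l')) :=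
    fun l l' => Quotient.eq
  constructor
  · intro H
    refine ⟨hh, fun l l' e => H ((key l l').2 (.inl e)), fun l l' q q' e e' => ?_⟩
    exact H ((key l l').2 (.inr ⟨⟨q, e.symm⟩, ⟨q', e'.symm⟩⟩))
  · rintro ⟨-, h1, h2⟩ l l' e
    rcases (key l l').1 e with e | ⟨⟨q, e⟩, ⟨q', e'⟩⟩
    · exact h1 e
    · exact h2 _ _ _ _ e.symm e'.symm

/-! ### Contracting two edges of one polygon -/

section Rotation

lemma InDiff.rotate {x : Fin n → P.G.H} (hx : P.InDiff x) (c : Fin n) :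
    P.InDiff fun l => x (l + c) :=
  fun _ _ e => add_left_injective c (hx e)

variable [NeZero n]

/-- Gluing one polygon and contracting two of the new edges. -/
def glueK2 (x : Fin n → P.G.H) (a b : Fin n) : BSpace O :=
  P.modK2 (P.mergeBlocks x) (P.G.cyc x) (x a) (x b)

lemma mergeBlocks_rotate (h : Fin n → P.G.H) (c : Fin n) :
    P.mergeBlocks (fun l => h (l + c)) = P.mergeBlocks h := by
  refine congrArg merge (Set.Subset.antisymm ?_ ?_)
  · rintro _ ⟨l, rfl⟩
    exact ⟨_, rfl⟩
  · rintro _ ⟨l, rfl⟩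
    exact ⟨l - c, by simp⟩

lemma glueK2_rotate {x : Fin n → P.G.H} (hx : P.InDiff x) (a b c : Fin n) :
    glueK2 (fun l => x (l + c)) a b = glueK2 x (a + c) (b + c) := by
  have h2 : P.G.cyc (fun l => x (l + c)) = P.G.cyc x := formPerm_ofFn_rotate hx.injective c
  rw [glueK2, glueK2, mergeBlocks_rotate, h2]

lemma sum_rotate {M : Type*} [AddCommMonoid M] (f : (Fin n → P.G.H) → M) (c : Fin n) :
    ∑ x : Fin n → P.G.H with P.InDiff x, f (fun l => x (l + c)) =
      ∑ x : Fin n → P.G.H with P.InDiff x, f x := by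
  refine Finset.sum_bij' (fun x _ l => x (l + c)) (fun x _ l => x (l - c)) ?_ ?_ ?_ ?_ ?_
  · intro x hx
    exact Finset.mem_filter.2 ⟨Finset.mem_univ _, (Finset.mem_filter.1 hx).2.rotate c⟩
  · intro x hx
    simp only [sub_eq_add_neg]
    exact Finset.mem_filter.2 ⟨Finset.mem_univ _, (Finset.mem_filter.1 hx).2.rotate (-c)⟩
  · intro x _
    simp
  · intro x _
    simp
  · intro x _
    rfl

/-- Rotating the tuple by `c` and replacing `c` by `-c` exchanges the two contracted edges, hence
reverses the sign. A fixed point has `c = 0`, where the term is itself zero. -/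
lemma sum_glueK2_zero :
    ∑ x : Fin n → P.G.H with P.InDiff x, ∑ c, glueK2 x 0 c = 0 := by
  rw [Finset.sum_sigma']
  refine Finset.sum_involution (fun p _ => ⟨fun l => p.1 (l + p.2), -p.2⟩) ?_ ?_ ?_ ?_
  · rintro ⟨x, c⟩ hx
    have hx' := (Finset.mem_filter.1 (Finset.mem_sigma.1 hx).1).2
    change glueK2 x 0 c + glueK2 (fun l => x (l + c)) 0 (-c) = 0
    rw [glueK2_rotate hx', zero_add, neg_add_cancel, glueK2, glueK2, modK2_antisymm,
      neg_add_cancel]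
  · rintro ⟨x, c⟩ hx hne e
    have hx' := (Finset.mem_filter.1 (Finset.mem_sigma.1 hx).1).2
    have e1 : (fun l => x (l + c)) = x := (Sigma.mk.inj e).1
    have e2 := congrFun e1 0
    rw [zero_add] at e2
    obtain rfl : c = 0 := hx'.injective e2
    exact hne (P.modK2_self _ _ _)
  · rintro ⟨x, c⟩ hx
    have hx' := (Finset.mem_filter.1 (Finset.mem_sigma.1 hx).1).2
    exact Finset.mem_sigma.2 ⟨Finset.mem_filter.2 ⟨Finset.mem_univ _, hx'.rotate c⟩,
      Finset.mem_univ _⟩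
  · rintro ⟨x, c⟩ _
    simp

/-- The part with both edges in `J` cancels by antisymmetry, so the second edge may run over the
whole polygon. After summation over all tuples, rotation makes the result independent of the first
edge, which may then be taken at 0. -/
lemma sum_glueK2_compl (J : Finset (Fin n)) :
    ∑ x : Fin n → P.G.H with P.InDiff x, ∑ a ∈ J, ∑ b ∈ Jᶜ, glueK2 x a b = 0 := by
  have h1 : ∀ x : Fin n → P.G.H, ∑ a ∈ J, ∑ b ∈ Jᶜ, glueK2 x a b =
      ∑ a ∈ J, ∑ b, glueK2 x a b := by
    intro x
    have h2 : ∑ a ∈ J, ∑ b ∈ J, glueK2 x a b = 0 :=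
      sum_alternating J _ (fun a b => P.modK2_antisymm _ _ _ _) (fun a => P.modK2_self _ _ _)
    rw [← add_zero (∑ a ∈ J, ∑ b ∈ Jᶜ, glueK2 x a b), ← h2, ← Finset.sum_add_distrib]
    exact Finset.sum_congr rfl fun a _ => Finset.sum_compl_add_sum J _
  simp only [h1]
  rw [Finset.sum_comm]
  refine Finset.sum_eq_zero fun a _ => ?_
  refine Eq.trans ?_ ((sum_rotate (P := P) (fun x => ∑ c, glueK2 x 0 c) a).trans sum_glueK2_zero)
  refine Finset.sum_congr rfl fun x hx => ?_
  rw [← Equiv.sum_comp (Equiv.addRight a)]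
  refine Finset.sum_congr rfl fun c _ => ?_
  rw [glueK2_rotate (Finset.mem_filter.1 hx).2, zero_add]
  rfl

end Rotation

end BGraph

/-! ### A polygon glued to a side of another polygon -/

namespace BGraph

open OGraph

variable {P : BGraph O}

section Overlap

variable {i j : ℕ}

/-- The positions, in a polygon with `i + j + 1` edges, of a second polygon glued to the first one
at its first edge. -/
def secondPart (i j : ℕ) : Fin (i + 1) → Fin (j + 1 + i) :=
  Fin.cons (Fin.castAdd i 0) (Fin.natAdd (j + 1))

lemma secondPart_zero : secondPart i j 0 = Fin.castAdd i 0 := rfl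

lemma secondPart_succ (b : Fin i) : secondPart i j b.succ = Fin.natAdd (j + 1) b := rfl

/-- The positions of the two smaller polygons have only the shared edge, at position 0, in common.
-/
lemma secondPart_eq_castAdd {p : Fin (i + 1)} {q : Fin (j + 1)}
    (h : secondPart i j p = Fin.castAdd i q) : p = 0 ∧ q = 0 := by
  have h' := congrArg Fin.val h
  induction p using Fin.cases with
  | zero =>
    refine ⟨rfl, Fin.ext ?_⟩
    simpa [secondPart_zero] using h'.symm
  | succ b =>
    have := q.2
    simp only [secondPart_succ, Fin.val_natAdd, Fin.val_castAdd] at h'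
    omega

lemma secondPart_injective : Function.Injective (secondPart i j) := by
  intro p p' h
  induction p using Fin.cases with
  | zero => exact (secondPart_eq_castAdd h.symm).1.symm
  | succ b =>
    induction p' using Fin.cases with
    | zero => exact (secondPart_eq_castAdd h).1
    | succ b' =>
      have := congrArg Fin.val h
      simp only [secondPart_succ, Fin.val_natAdd] at this
      exact congrArg _ (Fin.ext (by omega))

lemma compl_image_castAdd :
    ((Finset.univ.filter fun q : Fin (j + 1) => q ≠ 0).image (Fin.castAdd i))ᶜ =
      Finset.univ.image (secondPart i j) := by
  ext x
  induction x using Fin.addCases with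
  | left q =>
    simp only [Finset.mem_compl, Finset.mem_image, Finset.mem_filter, Finset.mem_univ, true_and,
      Fin.castAdd_inj, exists_eq_right, not_not]
    constructor
    · rintro rfl
      exact ⟨0, rfl⟩
    · rintro ⟨p, hp⟩
      exact (secondPart_eq_castAdd hp).2
  | right b =>
    simp only [Finset.mem_compl, Finset.mem_image, Finset.mem_filter, Finset.mem_univ, true_and]
    refine iff_of_true ?_ ⟨b.succ, rfl⟩
    rintro ⟨q, -, hq⟩
    have := congrArg Fin.val hq
    have := q.2
    simp only [Fin.val_natAdd, Fin.val_castAdd] at *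
    omega

/-- The cycle of the second gluing is the left factor, matching the order in which `K2_glue_glue`
composes them. -/
lemma cyc_overlap {x : Fin (j + 1 + i) → P.G.H} (hx : Function.Injective x) :
    P.G.cyc (x ∘ secondPart i j) * P.G.cyc (x ∘ Fin.castAdd i) = P.G.cyc x := by
  have h1 : List.ofFn x = x (Fin.castAdd i 0) ::
      (List.ofFn fun q : Fin j => x (Fin.castAdd i q.succ)) ++
      List.ofFn fun b => x (Fin.natAdd (j + 1) b) := by
    rw [List.ofFn_add, List.ofFn_succ]
    rfl
  have hn := List.nodup_ofFn.2 hx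
  rw [OGraph.cyc, OGraph.cyc, OGraph.cyc, h1, formPerm_cons_append _ _ _ (h1 ▸ hn),
    List.ofFn_succ, List.ofFn_succ]
  rfl

lemma mergeBlocks_overlap (x : Fin (j + 1 + i) → P.G.H) :
    P.mergeBlocks (x ∘ Fin.castAdd i) ⊔ P.mergeBlocks (x ∘ secondPart i j) = P.mergeBlocks x := by
  have h1 : P.mergeBlocks (x ∘ Fin.castAdd i) ≤
    P.mergeBlocks (x ∘ Fin.castAdd i) ⊔ P.mergeBlocks (x ∘ secondPart i j) := le_sup_left
  have h2 : P.mergeBlocks (x ∘ secondPart i j) ≤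
    P.mergeBlocks (x ∘ Fin.castAdd i) ⊔ P.mergeBlocks (x ∘ secondPart i j) := le_sup_right
  refine le_antisymm (sup_le (merge_mono ?_) (merge_mono ?_)) ?_
  · rintro _ ⟨l, rfl⟩
    exact ⟨_, rfl⟩
  · rintro _ ⟨l, rfl⟩
    exact ⟨_, rfl⟩
  · have h0 : ∀ l, (P.mergeBlocks (x ∘ Fin.castAdd i) ⊔ P.mergeBlocks (x ∘ secondPart i j))
        (P.hblk (x (Fin.castAdd i 0))) (P.hblk (x l)) := by
      intro l
      induction l using Fin.addCases with
      | left q => exact h1 (.inr ⟨⟨0, rfl⟩, ⟨q, rfl⟩⟩)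
      | right b => exact h2 (.inr ⟨⟨0, rfl⟩, ⟨b.succ, rfl⟩⟩)
    rintro a b (rfl | ⟨⟨l, rfl⟩, ⟨l', rfl⟩⟩)
    · exact Setoid.refl' _ _
    · exact Setoid.trans' _ (Setoid.symm' _ (h0 l)) (h0 l')

end Overlap

section Pairs

variable {i j : ℕ} [NeZero i] [NeZero j]

/-- Gluing two polygons and contracting the first new edge of each. -/
def glueGlue (h : Fin j → P.G.H) (g : Fin i → P.G.H) : BSpace O :=
  P.modK2 (P.mergeBlocks h ⊔ P.mergeBlocks g) (P.G.cyc g * P.G.cyc h) (h 1) (g 1)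

/-- The second polygon uses one of the half-edges `h` of the first one. -/
def Overlap (h : Fin j → P.G.H) (g : Fin i → P.G.H) : Prop :=
  P.Compat h g ∧ ∃ l m, m ≠ 1 ∧ g l = h m

/-- The edges of the polygons are different. -/
def EdgeDisjoint (h : Fin j → P.G.H) (h' : Fin i → P.G.H) : Prop :=
  P.Compat h h' ∧ ∀ l m, h' l ≠ h m ∧ h' l ≠ P.G.inv (h m)

/-- A pair with `h' l = h m` amounts to one tuple `x` for the large polygon, read off from this
common half-edge, together with `l` and `m`. The two contracted edges lie in complementary sets of
positions of `x`, so `sum_glueK2_compl` applies. -/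
lemma sum_overlap : ∑ p : (Fin j → P.G.H) × (Fin i → P.G.H) with Overlap p.1 p.2,
    glueGlue p.1 p.2 = 0 := by
  obtain ⟨i, rfl⟩ := Nat.exists_eq_succ_of_ne_zero (NeZero.ne i)
  obtain ⟨j, rfl⟩ := Nat.exists_eq_succ_of_ne_zero (NeZero.ne j)
  -- With `i` and `j` lowered by one, the large polygon has `j + 1 + i` edges. `J` consists of the
  -- positions of the first polygon without the shared one.
  let J : Finset (Fin (j + 1 + i)) :=
    (Finset.univ.filter fun q : Fin (j + 1) => q ≠ 0).image (Fin.castAdd i)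
  have : NeZero (j + 1 + i) := ⟨by omega⟩
  have key := sum_glueK2_compl (P := P) J
  -- Since position 0 of `x` is `h m`, the marked half-edge `h 1` is at `1 - m`, and the one of the
  -- second polygon at `1 - l`. The condition `m ≠ 1` says that the first of these is not the shared
  -- position.
  have hJ : ∀ x : Fin (j + 1 + i) → P.G.H, ∑ a ∈ J, ∑ b ∈ Jᶜ, glueK2 x a b =
      ∑ m : Fin (j + 1) with m ≠ 1, ∑ l : Fin (i + 1),
        glueK2 x (Fin.castAdd i (1 - m)) (secondPart i j (1 - l)) := by
    intro x
    rw [compl_image_castAdd, Finset.sum_image (fun _ _ _ _ e => Fin.castAdd_inj.1 e)]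
    refine Finset.sum_bij' (fun q _ => 1 - q) (fun q _ => 1 - q) ?_ ?_ ?_ ?_ ?_
    · intro q hq
      simpa [sub_eq_self] using hq
    · intro q hq
      simpa [sub_eq_zero, eq_comm (a := (1 : Fin (j + 1)))] using hq
    · intro q _
      rw [sub_sub_cancel]
    · intro q _
      rw [sub_sub_cancel]
    · intro q _
      rw [Finset.sum_image (fun _ _ _ _ e => secondPart_injective e), sub_sub_cancel]
      exact (Equiv.sum_comp (Equiv.subLeft 1) _).symm
  simp only [hJ, Finset.sum_sigma'] at key
  rw [← key]
  symm
  have hA : ∀ (m : Fin (j + 1)) (x : Fin (j + 1 + i) → P.G.H),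
      (fun q => x (Fin.castAdd i (q - m))) = fun q => (x ∘ Fin.castAdd i) (q + -m) := by
    intro m x
    simp [sub_eq_add_neg]
  have hB : ∀ (l : Fin (i + 1)) (x : Fin (j + 1 + i) → P.G.H),
      (fun p => x (secondPart i j (p - l))) = fun p => (x ∘ secondPart i j) (p + -l) := by
    intro m x
    simp [sub_eq_add_neg]
  have hAc : ∀ x : Fin (j + 1 + i) → P.G.H, P.InDiff x → P.InDiff (x ∘ Fin.castAdd i) :=
    fun x hx q q' e => Fin.castAdd_inj.1 (hx e)
  have hBc : ∀ x : Fin (j + 1 + i) → P.G.H, P.InDiff x → P.InDiff (x ∘ secondPart i j) :=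
    fun x hx p p' e => secondPart_injective (hx e)
  have hov : ∀ (m : Fin (j + 1)) (l : Fin (i + 1)) (x : Fin (j + 1 + i) → P.G.H), m ≠ 1 →
      P.InDiff x → Overlap (fun q => x (Fin.castAdd i (q - m)))
        (fun p => x (secondPart i j (p - l))) := by
    intro m l x hm hx
    refine ⟨⟨?_, ?_, ?_⟩, l, m, hm, by simp only [sub_self, secondPart_zero]⟩
    · rw [hA]
      exact (hAc x hx).rotate _
    · rw [hB]
      exact (hBc x hx).rotate _
    · intro l1 l2 m1 m2 e1 e2
      have h1 := (secondPart_eq_castAdd (hx e1)).1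
      have h2 := (secondPart_eq_castAdd (hx e2)).1
      rw [sub_eq_zero] at h1 h2
      rw [h1, h2]
  -- Restricting `x` to the two parts and rotating by `m` and `l` recovers the pair. The numbers `l`
  -- and `m` are determined, because the parts share only one half-edge.
  refine Finset.sum_bij (fun y _ => (fun q => y.1 (Fin.castAdd i (q - y.2.1)),
    fun p => y.1 (secondPart i j (p - y.2.2)))) ?_ ?_ ?_ ?_
  · rintro ⟨x, m, l⟩ hy
    simp only [Finset.mem_sigma, Finset.mem_filter, Finset.mem_univ, true_and, and_true] at hy
    exact Finset.mem_filter.2 ⟨Finset.mem_univ _, hov m l x hy.2 hy.1⟩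
  · rintro ⟨x, m, l⟩ hy ⟨x', m', l'⟩ hy' e
    simp only [Finset.mem_sigma, Finset.mem_filter, Finset.mem_univ, true_and, and_true] at hy hy'
    have e1 := congrArg Prod.fst e
    have e2 := congrArg Prod.snd e
    have ho := hov m l x hy.2 hy.1
    simp only at e1 e2
    have h1 := congrFun e1 m'
    have h2 := congrFun e2 l'
    simp only [sub_self] at h1 h2
    have h3 : x (secondPart i j (l' - l)) = x (Fin.castAdd i (m' - m)) := by
      rw [h1, h2]
      rfl
    obtain ⟨h4, h5⟩ := secondPart_eq_castAdd (hy.1.injective h3)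
    rw [sub_eq_zero] at h4 h5
    subst h4 h5
    obtain rfl : x = x' := by
      funext y
      induction y using Fin.addCases with
      | left q =>
        have := congrFun e1 (q + m')
        simpa using this
      | right b =>
        have := congrFun e2 (b.succ + l')
        simpa [secondPart_succ] using this
    rfl
  · rintro ⟨h, h'⟩ hh
    obtain ⟨hc, l, m, hm, hlm⟩ := (Finset.mem_filter.1 hh).2
    simp only at hc hlm
    let x : Fin (j + 1 + i) → P.G.H :=
      Fin.append (fun q => h (q + m)) (fun b => h' (b.succ + l))
    have hx1 : ∀ q, x (Fin.castAdd i q) = h (q + m) := fun q => Fin.append_left _ _ _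
    have hx2 : ∀ p, x (secondPart i j p) = h' (p + l) := by
      intro p
      induction p using Fin.cases with
      | zero => rw [secondPart_zero, hx1, zero_add, zero_add, hlm]
      | succ b => exact Fin.append_right _ _ _
    -- Compatibility leaves only the index `l` for a block met by both tuples, so the entries of the
    -- second tuple after the shared one lie in new blocks.
    have hcross : ∀ (q : Fin (j + 1)) (b : Fin i),
        P.hblk (h' (b.succ + l)) ≠ P.hblk (h (q + m)) := by
      intro q b e
      have := hc.2.2 _ _ _ _ e (congrArg P.hblk hlm)
      exact Fin.succ_ne_zero b (by rwa [add_eq_right] at this)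
    have hx : P.InDiff x := by
      intro y z e
      induction y using Fin.addCases with
      | left q =>
        induction z using Fin.addCases with
        | left q' =>
          simp only [hx1] at e
          rw [add_left_injective m (hc.1 e)]
        | right b =>
          simp only [hx1, ← secondPart_succ, hx2] at e
          exact absurd e.symm (hcross _ _)
      | right b =>
        induction z using Fin.addCases with
        | left q' =>
          simp only [hx1, ← secondPart_succ, hx2] at e
          exact absurd e (hcross _ _)
        | right b' =>
          simp only [← secondPart_succ, hx2] at e
          rw [Fin.succ_injective _ (add_left_injective l (hc.2.1 e))]
    refine ⟨⟨x, m, l⟩, ?_, ?_⟩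
    · simp only [Finset.mem_sigma, Finset.mem_filter, Finset.mem_univ, true_and, and_true]
      exact ⟨hx, hm⟩
    · refine Prod.ext (funext fun q => ?_) (funext fun p => ?_)
      · simp only [hx1, sub_add_cancel]
      · simp only [hx2, sub_add_cancel]
  · rintro ⟨x, m, l⟩ hy
    simp only [Finset.mem_sigma, Finset.mem_filter, Finset.mem_univ, true_and, and_true] at hy
    have hx := hy.1
    have c1 : P.G.cyc (fun q => x (Fin.castAdd i (q - m))) = P.G.cyc (x ∘ Fin.castAdd i) := by
      rw [hA]
      exact formPerm_ofFn_rotate (hAc x hx).injective _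
    have c2 : P.G.cyc (fun q => x (secondPart i j (q - l))) = P.G.cyc (x ∘ secondPart i j) := by
      rw [hB]
      exact formPerm_ofFn_rotate (hBc x hx).injective _
    have m1 : P.mergeBlocks (fun q => x (Fin.castAdd i (q - m))) =
        P.mergeBlocks (x ∘ Fin.castAdd i) := by
      rw [hA, mergeBlocks_rotate]
    have m2 : P.mergeBlocks (fun q => x (secondPart i j (q - l))) =
        P.mergeBlocks (x ∘ secondPart i j) := by
      rw [hB, mergeBlocks_rotate]
    rw [glueGlue, c1, c2, m1, m2, cyc_overlap hx.injective, mergeBlocks_overlap]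
    rfl

end Pairs

end BGraph

/-! ### The composite of two fusion operations -/

namespace BGraph

open OGraph

variable {P : BGraph O} {i j : ℕ}

lemma sum_filter_split {ι M : Type*} [Fintype ι] [AddCommMonoid M] (A N R : ι → Prop)
    [DecidablePred A] [DecidablePred fun x => A x ∧ N x] [DecidablePred fun x => A x ∧ ¬N x ∧ R x]
    [DecidablePred fun x => A x ∧ ¬N x ∧ ¬R x] (t : ι → M) :
    ∑ x with A x, t x = ∑ x with A x ∧ N x, t x +
      (∑ x with A x ∧ ¬N x ∧ R x, t x + ∑ x with A x ∧ ¬N x ∧ ¬R x, t x) := by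
  simp only [Finset.sum_filter, ← Finset.sum_add_distrib]
  refine Finset.sum_congr rfl fun x _ => ?_
  by_cases hA : A x <;> by_cases hN : N x <;> by_cases hR : R x <;> simp [hA, hN, hR]

lemma Avoids.rev [NeZero i] {Q : BGraph O} {a : Q.G.H} {h : Fin i → Q.G.H} (hav : Q.Avoids a h) :
    Q.Avoids a (Q.rev h) := fun l =>
  ⟨fun e => (hav (1 - l)).2 (by rw [← e, BGraph.rev, Q.G.inv_inv]),
    fun e => (hav (1 - l)).1 (Q.G.inv.injective e)⟩

/-- Compatibility would force both coincidences to occur at the same index, but no half-edge of `h`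
is opposite to another one. -/
lemma not_overlap_of_inv {h : Fin j → P.G.H} {h' : Fin i → P.G.H} (hc : P.Compat h h')
    (hR : ∃ l m, h' l = P.G.inv (h m)) :
    ¬∃ l m, h' l = h m := by
  rintro ⟨l, m, hlm⟩
  obtain ⟨l', m', hlm'⟩ := hR
  obtain rfl := hc.2.2 _ _ _ _ (congrArg P.hblk hlm)
    ((congrArg P.hblk hlm').trans (P.hblk_inv _))
  exact hc.1.inv_ne _ _ (hlm'.symm.trans hlm)

lemma sum_sum_pairs {M : Type*} [AddCommMonoid M] (p : (Fin j → P.G.H) → (Fin i → P.G.H) → Prop)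
    (hp : ∀ h h', p h h' → P.InDiff h) (f : (Fin j → P.G.H) → (Fin i → P.G.H) → M) :
    ∑ h : Fin j → P.G.H with P.InDiff h, ∑ h' : Fin i → P.G.H with p h h', f h h' =
      ∑ q : (Fin j → P.G.H) × (Fin i → P.G.H) with p q.1 q.2, f q.1 q.2 := by
  rw [Finset.sum_filter, Finset.sum_filter, Fintype.sum_prod_type]
  refine Finset.sum_congr rfl fun h _ => ?_
  rw [Finset.sum_filter]
  split_ifs with hh
  · rfl
  · exact (Finset.sum_eq_zero fun h' _ => if_neg fun hpp => hh (hp _ _ hpp)).symm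

lemma EdgeDisjoint.symm {h : Fin j → P.G.H} {h' : Fin i → P.G.H} (H : EdgeDisjoint h h') :
    EdgeDisjoint h' h :=
  ⟨H.1.symm, fun l m => ⟨(H.2 m l).1.symm, fun e => (H.2 m l).2 (by rw [e, P.G.inv_inv])⟩⟩

variable [NeZero j]

section

variable {h : Fin j → P.G.H} {h' : Fin i → P.G.H}

/-- The second polygon can be glued after the contraction of the first new edge of the first
one. -/
def Glueable (h : Fin j → P.G.H) (h' : Fin i → P.G.H) : Prop :=
  (P.glueB h).InDiff h' ∧ (P.glueB h).Avoids (h 1) h'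

lemma avoids_glue (hh : P.InDiff h) :
    (P.glueB h).Avoids (h 1) h' ↔ ∀ l, h' l ≠ h 1 ∧ h' l ≠ P.G.inv (h 0) := by
  have : (P.glueB h).G.inv (h 1) = P.G.inv (h 0) := by
    have := hh.glue_inv 0
    rwa [zero_add] at this
  exact forall_congr' fun l => and_congr Iff.rfl (Iff.of_eq (congrArg (h' l ≠ ·) this))

lemma glueable_iff (hh : P.InDiff h) : Glueable h h' ↔
    P.Compat h h' ∧ ∀ l, h' l ≠ h 1 ∧ h' l ≠ P.G.inv (h 0) := by
  rw [Glueable, inDiff_glue hh, avoids_glue hh]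

/-- Avoiding the contracted edge `{h 1, inv (h 0)}` reduces to `m ≠ 1`: only one index of `h'` can
lie in a block of `h`, and it is already used for `h m`. -/
lemma overlap_iff (hh : P.InDiff h) : Overlap h h' ↔ Glueable h h' ∧ ∃ l m, h' l = h m := by
  rw [glueable_iff hh]
  constructor
  · rintro ⟨hc, l, m, hm, hlm⟩
    refine ⟨⟨hc, fun l' => ⟨fun e => ?_, fun e => ?_⟩⟩, l, m, hlm⟩
    · obtain rfl := hc.2.2 _ _ _ _ (congrArg P.hblk hlm) (congrArg P.hblk e)
      exact hm (hh.injective (hlm.symm.trans e))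
    · obtain rfl := hc.2.2 _ _ _ _ (congrArg P.hblk hlm)
        ((congrArg P.hblk e).trans (P.hblk_inv _))
      exact hh.inv_ne _ _ (e.symm.trans hlm)
  · rintro ⟨⟨hc, ha⟩, l, m, hlm⟩
    refine ⟨hc, l, m, ?_, hlm⟩
    rintro rfl
    exact (ha l).1 hlm

lemma edgeDisjoint_iff (hh : P.InDiff h) : EdgeDisjoint h h' ↔
    Glueable h h' ∧ (¬∃ l m, h' l = h m) ∧ ¬∃ l m, h' l = P.G.inv (h m) := by
  rw [glueable_iff hh, EdgeDisjoint]
  push Not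
  constructor
  · rintro ⟨hc, hd⟩
    exact ⟨⟨hc, fun l => ⟨(hd l _).1, (hd l _).2⟩⟩, fun l m => (hd l m).1, fun l m => (hd l m).2⟩
  · rintro ⟨⟨hc, -⟩, h1, h2⟩
    exact ⟨hc, fun l m => ⟨h1 l m, h2 l m⟩⟩

variable [NeZero i]

/-- Reversal takes place in the glued graph, where `h m` is joined to `inv (h (m - 1))`. It
therefore exchanges the two ways of using a new edge. -/
lemma rev_overlap (hh : P.InDiff h) (hN : ∃ l m, h' l = h m) :
    ∃ l m, (P.glueB h).rev h' l = P.G.inv (h m) := by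
  obtain ⟨l, m, e⟩ := hN
  refine ⟨1 - l, m - 1, ?_⟩
  have := hh.glue_inv (m - 1)
  rw [sub_add_cancel, ← e] at this
  refine Eq.trans ?_ this
  exact congrArg (fun q => (P.glueB h).G.inv (h' q)) (sub_sub_cancel 1 l)

lemma rev_inv_overlap (hh : P.InDiff h) (hR : ∃ l m, h' l = P.G.inv (h m)) :
    ∃ l m, (P.glueB h).rev h' l = h m := by
  obtain ⟨l, m, e⟩ := hR
  refine ⟨1 - l, m + 1, ?_⟩
  have := hh.glue_inv_inv m
  rw [← e] at this
  refine Eq.trans ?_ this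
  exact congrArg (fun q => (P.glueB h).G.inv (h' q)) (sub_sub_cancel 1 l)

/-- The second polygon uses a new edge starting at some `h m`, uses one starting at some `inv (h
m)`, or uses none. The second kind contributes the same as the first, whence the repeated sum. -/
lemma fusion_fterm (hh : P.InDiff h) : fusion O i (P.fterm h) =
    ∑ h' : Fin i → P.G.H with Overlap h h', glueGlue h h' +
    (∑ h' : Fin i → P.G.H with Overlap h h', glueGlue h h' +
      ∑ h' : Fin i → P.G.H with EdgeDisjoint h h', glueGlue h h') := by
  have ha : P.G.cyc h (h 0) = h 1 := by rw [hh.cyc_apply, zero_add]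
  let Q := P.glueB h
  let t : (Fin i → P.G.H) → BSpace O := fun h' => (Q.glueB h').K2 (h 1) (Q.G.cyc h' (h' 0))
  have ht : ∀ h' : Fin i → P.G.H, Q.InDiff h' → t h' = glueGlue h h' := by
    intro h' hd
    have hc := ((inDiff_glue hh h').1 hd).2.1
    refine (P.K2_glue_glue h h' _ _).trans ?_
    have : Q.G.cyc h' (h' 0) = h' 1 := by
      refine (hc.cyc_apply 0).trans ?_
      rw [zero_add]
    exact congrArg (P.modK2 _ _ _) this
  have h0 : fusion O i (P.fterm h) =
      ∑ h' : Fin i → P.G.H with Glueable h h', t h' := by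
    refine (fusion_pcontract (n := i) (Q := Q) (a := P.G.cyc h (h 0))).trans ?_
    rw [ha]
    exact Finset.sum_congr (Finset.ext fun h' =>
      (Finset.mem_filter_univ h').trans
        (Finset.mem_filter_univ (p := fun h' => Glueable h h') h').symm) fun _ _ => rfl
  have e1 : ∑ h' : Fin i → P.G.H with
      Glueable h h' ∧ ∃ l m, h' l = h m, t h' =
      ∑ h' : Fin i → P.G.H with Overlap h h', glueGlue h h' := by
    refine Finset.sum_congr (by
      ext h'
      simp only [Finset.mem_filter, Finset.mem_univ, true_and]
      exact (overlap_iff hh).symm) ?_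
    intro h' hm
    exact ht h' ((overlap_iff hh).1 ((Finset.mem_filter_univ h').1 hm)).1.1
  -- Reversing the second polygon in the glued graph is a bijection between the two kinds that
  -- preserves the terms.
  have e2 : ∑ h' : Fin i → P.G.H with
      Glueable h h' ∧ (¬∃ l m, h' l = h m) ∧ ∃ l m, h' l = P.G.inv (h m), t h' =
      ∑ h' : Fin i → P.G.H with
        Glueable h h' ∧ ∃ l m, h' l = h m, t h' := by
    refine Finset.sum_bij' (fun h' _ => Q.rev h') (fun h' _ => Q.rev h') ?_ ?_ ?_ ?_ ?_
    · intro h' hm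
      obtain ⟨-, ⟨h1, h2⟩, -, h3⟩ := Finset.mem_filter.1 hm
      exact Finset.mem_filter.2 ⟨Finset.mem_univ _, ⟨h1.rev, h2.rev⟩,
        rev_inv_overlap hh h3⟩
    · intro h' hm
      obtain ⟨-, ⟨h1, h2⟩, h3⟩ := Finset.mem_filter.1 hm
      exact Finset.mem_filter.2 ⟨Finset.mem_univ _, ⟨h1.rev, h2.rev⟩,
        not_overlap_of_inv (P := P) ((inDiff_glue hh _).1 h1.rev) (rev_overlap hh h3),
        rev_overlap hh h3⟩
    · exact fun h' _ => rev_rev (P := Q) h'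
    · exact fun h' _ => rev_rev (P := Q) h'
    · intro h' hm
      obtain ⟨-, ⟨h1, h2⟩, -⟩ := Finset.mem_filter.1 hm
      exact (K2_glue_rev h1 h2).symm
  have e3 : ∑ h' : Fin i → P.G.H with Glueable h h' ∧
      (¬∃ l m, h' l = h m) ∧ ¬∃ l m, h' l = P.G.inv (h m), t h' =
      ∑ h' : Fin i → P.G.H with EdgeDisjoint h h', glueGlue h h' := by
    refine Finset.sum_congr (by
      ext h'
      simp only [Finset.mem_filter, Finset.mem_univ, true_and]
      exact (edgeDisjoint_iff hh).symm) ?_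
    intro h' hm
    exact ht h' ((edgeDisjoint_iff hh).1 ((Finset.mem_filter_univ h').1 hm)).1.1
  rw [h0, ← e3, ← e1]
  refine (sum_filter_split _ (fun h' => ∃ l m, h' l = h m)
    (fun h' => ∃ l m, h' l = P.G.inv (h m)) t).trans ?_
  rw [e2]

end

variable [NeZero i]

/-- Both sums over overlapping pairs vanish after summation over the first tuple; only pairs of
edge-disjoint polygons survive. -/
lemma fusion_fusion_cls (P : BGraph O) : fusion O i (fusion O j P.cls) =
    ∑ p : (Fin j → P.G.H) × (Fin i → P.G.H) with EdgeDisjoint p.1 p.2, glueGlue p.1 p.2 := by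
  rw [fusion_cls, map_sum, Finset.sum_congr rfl fun h hm =>
    fusion_fterm (i := i) (Finset.mem_filter.1 hm).2, Finset.sum_add_distrib,
    Finset.sum_add_distrib, sum_sum_pairs _ fun h h' (H : Overlap h h') => H.1.1,
    sum_sum_pairs _ fun h h' (H : EdgeDisjoint h h') => H.1.1, sum_overlap, zero_add, zero_add]

/-- Disjoint cycles commute and the join of block relations is symmetric, so the exchange affects
only the order of the two contractions. -/
lemma EdgeDisjoint.glueGlue {h : Fin j → P.G.H} {h' : Fin i → P.G.H} (H : EdgeDisjoint h h') :
    glueGlue h' h = -glueGlue h h' := by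
  have hcomm : P.G.cyc h * P.G.cyc h' = P.G.cyc h' * P.G.cyc h := by
    refine Equiv.Perm.Disjoint.commute fun x => ?_
    by_cases hx : ∃ l, h l = x
    · obtain ⟨l, rfl⟩ := hx
      exact .inr (formPerm_ofFn_of_notMem fun m => (H.2 m l).1)
    · push Not at hx
      exact .inl (formPerm_ofFn_of_notMem hx)
  rw [BGraph.glueGlue, BGraph.glueGlue, modK2_antisymm, hcomm, sup_comm]

end BGraph

/-- Exchanging the tuples pairs off opposite terms. There is no fixed point, since edge-disjoint
nonempty tuples are different. -/
theorem fusion_comp_self (i : ℕ) [NeZero i] : fusion O i ∘ₗ fusion O i = 0 := by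
  refine BSpace.hom_ext fun P => ?_
  rw [LinearMap.comp_apply, BGraph.fusion_fusion_cls]
  refine Finset.sum_involution (fun p _ => p.swap) ?_ ?_ ?_ ?_
  · intro p hp
    have := (Finset.mem_filter.1 hp).2.glueGlue
    rw [Prod.fst_swap, Prod.snd_swap, this, add_neg_cancel]
  · rintro ⟨h, h'⟩ hp - e
    obtain rfl : h' = h := congrArg Prod.fst e
    exact ((Finset.mem_filter.1 hp).2.2 0 0).1 rfl
  · exact fun p hp => Finset.mem_filter.2 ⟨Finset.mem_univ _, (Finset.mem_filter.1 hp).2.symm⟩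
  · exact fun p _ => rfl

theorem fusion_anticomm (i j : ℕ) [NeZero i] [NeZero j] :
    fusion O i ∘ₗ fusion O j + fusion O j ∘ₗ fusion O i = 0 := by
  refine BSpace.hom_ext fun P => ?_
  rw [LinearMap.add_apply, LinearMap.comp_apply, LinearMap.comp_apply, LinearMap.zero_apply,
    BGraph.fusion_fusion_cls, BGraph.fusion_fusion_cls, add_eq_zero_iff_eq_neg,
    ← Finset.sum_neg_distrib]
  refine Finset.sum_bij' (fun p _ => p.swap) (fun p _ => p.swap) ?_ ?_ ?_ ?_ ?_
  · exact fun p hp => Finset.mem_filter.2 ⟨Finset.mem_univ _, (Finset.mem_filter.1 hp).2.symm⟩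
  · exact fun p hp => Finset.mem_filter.2 ⟨Finset.mem_univ _, (Finset.mem_filter.1 hp).2.symm⟩
  · exact fun p _ => rfl
  · exact fun p _ => rfl
  · intro p hp
    rw [Prod.fst_swap, Prod.snd_swap, (Finset.mem_filter.1 hp).2.glueGlue, neg_neg]

/-! ### Linear maps out of the graph space -/

namespace OGraph

lemma wire_congr (G : OGraph O) {i i' : Equiv.Perm G.H} {t t' : G.H → Bool}
    {L L' : ∀ v, O.obj {h // G.vert h = v}} (hi : i = i') (ht : t = t') (hL : L = L')
    (h1 h2 h3 h1' h2' h3') : G.wire i t L h1 h2 h3 = G.wire i' t' L' h1' h2' h3' := by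
  subst hi ht hL
  rfl

/-- An isomorphism as a similarity. -/
def Iso.toSim {G G' : OGraph O} (e : Iso G G') : Sim G G' :=
  Sim.ofLab e.onV e.onH e.vert fun v => ⟨_, inferInstance, _, _, G.lab_label v,
    _, fun _ => rfl, (e.label v).symm⟩

lemma sperm_map (G : OGraph O) [Fintype G.V] (σ : Equiv.Perm G.V) :
    SPerm (Equiv.Perm.sign σ) G.ord (G.ord.map σ) := by
  have hp : G.ord.Perm (G.ord.map σ) :=
    (List.perm_ext_iff_of_nodup G.ord_nodup (G.ord_nodup.map σ.injective)).2 fun v =>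
      iff_of_true (G.mem_ord v) (List.mem_map.2 ⟨σ.symm v, G.mem_ord _, by simp⟩)
  obtain ⟨s, hs⟩ := SPerm.exists_of_perm hp
  obtain ⟨τ, h1, h2, -⟩ := hs.exists_equiv G.ord_nodup
  have : σ = τ := Equiv.ext fun v => List.map_inj_left.1 h1 v (G.mem_ord v)
  rw [this, h2, ← this]
  exact hs

lemma cls_reverse (G : OGraph O) (a : G.H) : (G.reverse a).cls = -G.cls := by
  have := (Submodule.Quotient.mk_eq_zero _).2
    (Submodule.subset_span (Relator.reverse G a) : _ ∈ Submodule.span k {x | Relator x})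
  rwa [Submodule.Quotient.mk_add, add_eq_zero_iff_eq_neg] at this

lemma mk_single (G : OGraph O) (c : k) :
    (Submodule.Quotient.mk (Finsupp.single G c) : GraphSpace O) = c • G.cls := by
  rw [cls, ← Submodule.Quotient.mk_smul, Finsupp.smul_single, smul_eq_mul, mul_one]

lemma isLinearMap_cls (G : OGraph O) (v : G.V) :
    IsLinearMap k fun p => (G.setLabel v p).cls := by
  constructor
  · intro p q
    have := (Submodule.Quotient.mk_eq_zero _).2
      (Submodule.subset_span (Relator.add G v p q) : _ ∈ Submodule.span k {x | Relator x})
    rwa [Submodule.Quotient.mk_sub, Submodule.Quotient.mk_sub, mk_single, mk_single, mk_single,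
      one_smul, one_smul, one_smul, sub_sub, sub_eq_zero] at this
  · intro c p
    have := (Submodule.Quotient.mk_eq_zero _).2
      (Submodule.subset_span (Relator.smul G v c p) : _ ∈ Submodule.span k {x | Relator x})
    rwa [Submodule.Quotient.mk_sub, mk_single, mk_single, one_smul, sub_eq_zero] at this

end OGraph

namespace GraphSpace

open OGraph

variable {M : Type*} [AddCommGroup M] [Module k M]

/-- A linear map on the graph complex, given on graphs. -/
def lift (f : OGraph O → M)
    (hsim : ∀ {G G' : OGraph O} {s : ℤˣ} (e : Sim G G')
      (_ : ∀ h, G'.inv (e.onH h) = e.onH (G.inv h)) (_ : ∀ h, G'.tail (e.onH h) = G.tail h)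
      (_ : SPerm s (G.ord.map e.onV) G'.ord), f G' = sg k s • f G)
    (hrev : ∀ (G : OGraph O) a, f (G.reverse a) = -f G)
    (hlin : ∀ (G : OGraph O) v, IsLinearMap k fun p => f (G.setLabel v p)) :
    GraphSpace O →ₗ[k] M :=
  Submodule.liftQ _ (Finsupp.linearCombination k f) (by
    rw [Submodule.span_le]
    rintro _ (e | ⟨G, σ⟩ | ⟨G, a⟩ | ⟨G, v, p, q⟩ | ⟨G, v, c, p⟩)
    · simp [hsim e.toSim e.inv e.tail (SPerm.of_eq e.ord.symm)]
    · have := hsim (G := G) (G' := G.reorder σ) ⟨Equiv.refl _, Equiv.refl _, fun _ => rfl,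
        fun _ _ _ _ _ h => h⟩ (fun _ => rfl) (fun _ => rfl)
        (s := Equiv.Perm.sign σ) (((SPerm.of_eq (List.map_id _)).trans
          (G.sperm_map σ)).cast (one_mul _))
      simp [this, sg]
    · simp [hrev]
    · simp [(hlin G v).map_add]
    · simp [(hlin G v).map_smul])

@[simp] lemma lift_cls (f : OGraph O → M) (h1 h2 h3) (G : OGraph O) :
    lift (k := k) f h1 h2 h3 G.cls = f G := by
  simp [lift, OGraph.cls]

lemma span_cls : Submodule.span k (Set.range (OGraph.cls (O := O))) = ⊤ := by
  rw [eq_top_iff]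
  rintro x -
  obtain ⟨y, rfl⟩ := Submodule.Quotient.mk_surjective _ x
  induction y using Finsupp.induction_linear with
  | zero => exact Submodule.zero_mem _
  | add a b ha hb => exact Submodule.add_mem _ ha hb
  | single P c =>
    rw [OGraph.mk_single]
    exact Submodule.smul_mem _ _ (Submodule.subset_span ⟨P, rfl⟩)

end GraphSpace

namespace OGraph

/-! ### Disjoint union of two graphs -/

section Sum

variable (G G' : OGraph O)

/-- The half-edges at a vertex of the first summand. -/
def fiberInl (v : G.V) :
    {h // G.vert h = v} ≃ {x : G.H ⊕ G'.H // Sum.map G.vert G'.vert x = .inl v} :=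
  Equiv.ofBijective (fun h => ⟨.inl h.1, congrArg Sum.inl h.2⟩) (by
    constructor
    · rintro ⟨x, _⟩ ⟨y, _⟩ h
      exact Subtype.ext (Sum.inl_injective (congrArg Subtype.val h))
    · rintro ⟨x | x, h⟩
      · exact ⟨⟨x, Sum.inl_injective h⟩, rfl⟩
      · simp at h)

/-- The half-edges at a vertex of the second summand. -/
def fiberInr (v : G'.V) :
    {h // G'.vert h = v} ≃ {x : G.H ⊕ G'.H // Sum.map G.vert G'.vert x = .inr v} :=
  Equiv.ofBijective (fun h => ⟨.inr h.1, congrArg Sum.inr h.2⟩) (by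
    constructor
    · rintro ⟨x, _⟩ ⟨y, _⟩ h
      exact Subtype.ext (Sum.inr_injective (congrArg Subtype.val h))
    · rintro ⟨x | x, h⟩
      · simp at h
      · exact ⟨⟨x, Sum.inr_injective h⟩, rfl⟩)

/-- The labels of a disjoint union. -/
def sumLabel : ∀ w : G.V ⊕ G'.V, O.obj {x : G.H ⊕ G'.H // Sum.map G.vert G'.vert x = w}
  | .inr v => O.map (fiberInr G G' v) (G'.label v)
  | .inl v => O.map (fiberInl G G' v) (G.label v)

/-- The disjoint union of two graphs. -/
def sum : OGraph O where
  V := G.V ⊕ G'.V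
  H := G.H ⊕ G'.H
  vert := Sum.map G.vert G'.vert
  inv := Equiv.sumCongr G.inv G'.inv
  inv_inv := by rintro (h | h) <;> simp [inv_inv]
  inv_ne := by rintro (h | h) <;> simp [inv_ne]
  tail := Sum.elim G.tail G'.tail
  tail_inv := by rintro (h | h) <;> simp [tail_inv]
  ord := G.ord.map .inl ++ G'.ord.map .inr
  ord_nodup := by
    refine List.Nodup.append (G.ord_nodup.map Sum.inl_injective)
      (G'.ord_nodup.map Sum.inr_injective) ?_
    simp [List.disjoint_left]
  mem_ord := by rintro (v | v) <;> simp [mem_ord]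
  three_le := by
    rintro (v | v)
    · rw [← Nat.card_congr (fiberInl G G' v)]
      exact G.three_le v
    · rw [← Nat.card_congr (fiberInr G G' v)]
      exact G'.three_le v
  label := sumLabel G G'

lemma map_sum_ord {X : Type*} (f : G.V ⊕ G'.V → X) : (G.sum G').ord.map f =
    G.ord.map (fun v => f (.inl v)) ++ G'.ord.map fun v => f (.inr v) :=
  List.map_append.trans (congrArg₂ _ List.map_map List.map_map)

variable {G G'} {S : Type} [Finite S] {p : O.obj S}

lemma Lab.inl {v : G.V} {j : S → G.H} (h : G.Lab v j p) :
    (G.sum G').Lab (.inl v) (fun s => (.inl (j s) : G.H ⊕ G'.H)) p := by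
  obtain ⟨e, he, hp⟩ := h
  refine ⟨e.trans (fiberInl G G' v), fun s => congrArg Sum.inl (he s), ?_⟩
  exact (O.map_trans _ _ _).trans (congrArg _ hp)

lemma Lab.inr {v : G'.V} {j : S → G'.H} (h : G'.Lab v j p) :
    (G.sum G').Lab (.inr v) (fun s => (.inr (j s) : G.H ⊕ G'.H)) p := by
  obtain ⟨e, he, hp⟩ := h
  refine ⟨e.trans (fiberInr G G' v), fun s => congrArg Sum.inr (he s), ?_⟩
  exact (O.map_trans _ _ _).trans (congrArg _ hp)

/-- A similarity from a disjoint union, with the labels in coordinates of the summands. -/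
def Sim.ofSum {G'' : OGraph O} (onV : G.V ⊕ G'.V ≃ G''.V) (onH : G.H ⊕ G'.H ≃ G''.H)
    (vert_inl : ∀ h, G''.vert (onH (.inl h)) = onV (.inl (G.vert h)))
    (vert_inr : ∀ h, G''.vert (onH (.inr h)) = onV (.inr (G'.vert h)))
    (lab_inl : ∀ (v : G.V) (S : Type) [Finite S] (j : S → G.H) (p : O.obj S), G.Lab v j p →
      G''.Lab (onV (.inl v)) (fun s => onH (.inl (j s))) p)
    (lab_inr : ∀ (v : G'.V) (S : Type) [Finite S] (j : S → G'.H) (p : O.obj S), G'.Lab v j p →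
      G''.Lab (onV (.inr v)) (fun s => onH (.inr (j s))) p) :
    Sim (G.sum G') G'' :=
  Sim.ofLab (G := G.sum G') onV onH
    (by rintro (h | h); exacts [vert_inl h, vert_inr h])
    (by
      rintro (v | v)
      · exact ⟨_, inferInstance, _, _, (G.lab_label v).inl, lab_inl _ _ _ _ (G.lab_label v)⟩
      · exact ⟨_, inferInstance, _, _, (G'.lab_label v).inr, lab_inr _ _ _ _ (G'.lab_label v)⟩)

/-- The disjoint union of similarities. -/
def Sim.sum {G₁ G₁' : OGraph O} (e : Sim G G₁) (e' : Sim G' G₁') :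
    Sim (G.sum G') (G₁.sum G₁') :=
  Sim.ofSum (G'' := G₁.sum G₁') (e.onV.sumCongr e'.onV) (e.onH.sumCongr e'.onH)
    (fun h => congrArg Sum.inl (e.vert h)) (fun h => congrArg Sum.inr (e'.vert h))
    (fun v _ _ j p h => (e.lab v _ j p h).inl) (fun v _ _ j p h => (e'.lab v _ j p h).inr)

end Sum

end OGraph

/-! ### Disjoint unions of blocked graphs -/

namespace BGraph

open OGraph

/-- The disjoint union of blocked graphs. -/
def sum (P Q : BGraph O) : BGraph O where
  G := P.G.sum Q.G
  B := P.B ⊕ Q.B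
  blk := Sum.map P.blk Q.blk
  blk_inv := by
    rintro (h | h)
    · exact congrArg Sum.inl (P.blk_inv h)
    · exact congrArg Sum.inr (Q.blk_inv h)

/-- A graph as a blocked graph with one block. -/
def single (G : OGraph O) : BGraph O := ⟨G, Unit, fun _ => (), fun _ => rfl⟩

/-- An isomorphism of graphs as an isomorphism of blocked graphs. -/
def isoSingle {G G' : OGraph O} {s : ℤˣ} (e : Sim G G')
    (inv : ∀ h, G'.inv (e.onH h) = e.onH (G.inv h)) (tail : ∀ h, G'.tail (e.onH h) = G.tail h)
    (ord : SPerm s (G.ord.map e.onV) G'.ord) : Iso (single G) (single G') s where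
  toSim := e
  inv := inv
  tail := tail
  onB := Equiv.refl _
  blk _ := rfl
  ord := ord

/-- The disjoint union of isomorphisms. -/
def Iso.sum {P P' Q Q' : BGraph O} {s t : ℤˣ} (e : Iso P P' s) (e' : Iso Q Q' t) :
    Iso (P.sum Q) (P'.sum Q') (s * t) where
  toSim := e.toSim.sum e'.toSim
  inv := by
    rintro (h | h)
    · exact congrArg Sum.inl (e.inv h)
    · exact congrArg Sum.inr (e'.inv h)
  tail := by
    rintro (h | h)
    · exact e.tail h
    · exact e'.tail h
  onB := e.onB.sumCongr e'.onB
  blk := by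
    rintro (v | v)
    · exact congrArg Sum.inl (e.blk v)
    · exact congrArg Sum.inr (e'.blk v)
  ord := by
    refine (SPerm.of_eq ?_).trans ((e.ord.map Sum.inl).append (e'.ord.map Sum.inr)) |>.cast
      (one_mul _)
    refine (map_sum_ord P.G Q.G _).trans ?_
    rw [List.map_map, List.map_map]
    rfl

/-- The identity. -/
def Iso.refl (P : BGraph O) : Iso P P 1 where
  onV := Equiv.refl _
  onH := Equiv.refl _
  vert _ := rfl
  lab _ _ _ _ _ h := h
  inv _ := rfl
  tail _ := rfl
  onB := Equiv.refl _
  blk _ := rfl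
  ord := SPerm.of_eq (List.map_id _)

/-- `(A ⊕ B) ⊕ C ≃ (B ⊕ A) ⊕ C`, associated to the right. -/
def sumLeftComm (A B C : Type) : A ⊕ (B ⊕ C) ≃ B ⊕ (A ⊕ C) :=
  (Equiv.sumAssoc A B C).symm.trans
    (((Equiv.sumComm A B).sumCongr (Equiv.refl C)).trans (Equiv.sumAssoc B A C))

/-- Exchange of two summands. -/
def isoSumLeftComm (P Q R : BGraph O) :
    Iso (P.sum (Q.sum R)) (Q.sum (P.sum R)) ((-1) ^ (P.G.ord.length * Q.G.ord.length)) where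
  toSim := Sim.ofLab (G := (P.sum (Q.sum R)).G) (G' := (Q.sum (P.sum R)).G)
    (sumLeftComm _ _ _) (sumLeftComm _ _ _)
    (by rintro (h | h | h) <;> rfl)
    (by
      rintro (v | v | v)
      · exact ⟨_, inferInstance, _, _, (P.G.lab_label v).inl, (P.G.lab_label v).inl.inr⟩
      · exact ⟨_, inferInstance, _, _, (Q.G.lab_label v).inl.inr, (Q.G.lab_label v).inl⟩
      · exact ⟨_, inferInstance, _, _, (R.G.lab_label v).inr.inr, (R.G.lab_label v).inr.inr⟩)
  inv := by rintro (h | h | h) <;> rfl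
  tail := by rintro (h | h | h) <;> rfl
  onB := sumLeftComm _ _ _
  blk := by rintro (v | v | v) <;> rfl
  ord := by
    let a := P.G.ord.map fun v => (.inr (.inl v) : Q.G.V ⊕ (P.G.V ⊕ R.G.V))
    let b := Q.G.ord.map fun v => (.inl v : Q.G.V ⊕ (P.G.V ⊕ R.G.V))
    let c := R.G.ord.map fun v => (.inr (.inr v) : Q.G.V ⊕ (P.G.V ⊕ R.G.V))
    have h1 : (P.sum (Q.sum R)).G.ord.map (sumLeftComm P.G.V Q.G.V R.G.V) = a ++ b ++ c := by
      refine (map_sum_ord P.G (Q.sum R).G _).trans ?_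
      rw [List.append_assoc]
      exact congrArg (a ++ ·) (map_sum_ord Q.G R.G _)
    have h2 : (Q.sum (P.sum R)).G.ord = b ++ a ++ c := by
      rw [List.append_assoc]
      exact congrArg (b ++ ·) (map_sum_ord P.G R.G Sum.inr)
    have h3 := (SPerm.append_comm b a).append_right c
    exact (((SPerm.of_eq h1).trans h3).trans (SPerm.of_eq h2.symm)).cast (by simp [a, b])

lemma reverse_sum (P Q : BGraph O) (a : P.G.H) :
    (P.reverse a).sum Q = (P.sum Q).reverse (.inl a : P.G.H ⊕ Q.G.H) := by
  refine wire_congr (P.sum Q) (i := (P.sum Q).G.inv) rfl ?_ ?_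
    (P.sum Q).G.inv_inv (P.sum Q).G.inv_ne ((P.reverse a).sum Q).G.tail_inv
    (P.sum Q).blk_inv (P.sum Q).G.inv_inv (P.sum Q).G.inv_ne
    ((P.sum Q).reverse (.inl a : P.G.H ⊕ Q.G.H)).G.tail_inv (P.sum Q).blk_inv
  · funext x
    rcases x with x | x
    · refine if_congr (or_congr Sum.inl_injective.eq_iff.symm ?_) rfl rfl
      exact (Sum.inl_injective (β := Q.G.H)).eq_iff.symm
    · refine (if_neg ?_).symm
      rintro (h | h)
      · exact Sum.inr_ne_inl h
      · exact Sum.inr_ne_inl (a := P.G.inv a) h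
  · funext w
    cases w <;> rfl

lemma sum_reverse (P Q : BGraph O) (a : Q.G.H) :
    P.sum (Q.reverse a) = (P.sum Q).reverse (.inr a : P.G.H ⊕ Q.G.H) := by
  refine wire_congr (P.sum Q) (i := (P.sum Q).G.inv) rfl ?_ ?_
    (P.sum Q).G.inv_inv (P.sum Q).G.inv_ne (P.sum (Q.reverse a)).G.tail_inv
    (P.sum Q).blk_inv (P.sum Q).G.inv_inv (P.sum Q).G.inv_ne
    ((P.sum Q).reverse (.inr a : P.G.H ⊕ Q.G.H)).G.tail_inv (P.sum Q).blk_inv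
  · funext x
    rcases x with x | x
    · refine (if_neg ?_).symm
      rintro (h | h)
      · exact Sum.inl_ne_inr h
      · exact Sum.inl_ne_inr (b := Q.G.inv a) h
    · refine if_congr (or_congr Sum.inr_injective.eq_iff.symm ?_) rfl rfl
      exact (Sum.inr_injective (α := P.G.H)).eq_iff.symm
  · funext w
    cases w <;> rfl

lemma setLabel_sum (P Q : BGraph O) (v : P.G.V) (p : O.obj {h // P.G.vert h = v}) :
    (P.setLabel v p).sum Q =
      (P.sum Q).setLabel (.inl v : P.G.V ⊕ Q.G.V) (O.map (fiberInl P.G Q.G v) p) := by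
  refine wire_congr (P.sum Q) (i := (P.sum Q).G.inv) rfl rfl ?_
    (P.sum Q).G.inv_inv (P.sum Q).G.inv_ne (P.sum Q).G.tail_inv
    (P.sum Q).blk_inv (P.sum Q).G.inv_inv (P.sum Q).G.inv_ne
    (P.sum Q).G.tail_inv (P.sum Q).blk_inv
  refine (@Function.eq_update_iff _ _ (fun _ _ => Classical.propDecidable _) _ _ _ _).2 ⟨?_, ?_⟩
  · exact congrArg (O.map (fiberInl P.G Q.G v))
      (show Function.update P.G.label v p v = p from Function.update_self ..)
  · rintro (w | w) hw
    · exact congrArg (O.map (fiberInl P.G Q.G w))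
        (Function.update_of_ne (fun e => hw (congrArg Sum.inl e)) _ _)
    · rfl

lemma sum_setLabel (P Q : BGraph O) (v : Q.G.V) (p : O.obj {h // Q.G.vert h = v}) :
    P.sum (Q.setLabel v p) =
      (P.sum Q).setLabel (.inr v : P.G.V ⊕ Q.G.V) (O.map (fiberInr P.G Q.G v) p) := by
  refine wire_congr (P.sum Q) (i := (P.sum Q).G.inv) rfl rfl ?_
    (P.sum Q).G.inv_inv (P.sum Q).G.inv_ne (P.sum Q).G.tail_inv
    (P.sum Q).blk_inv (P.sum Q).G.inv_inv (P.sum Q).G.inv_ne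
    (P.sum Q).G.tail_inv (P.sum Q).blk_inv
  refine (@Function.eq_update_iff _ _ (fun _ _ => Classical.propDecidable _) _ _ _ _).2 ⟨?_, ?_⟩
  · exact congrArg (O.map (fiberInr P.G Q.G v))
      (show Function.update Q.G.label v p v = p from Function.update_self ..)
  · rintro (w | w) hw
    · rfl
    · exact congrArg (O.map (fiberInr P.G Q.G w))
        (Function.update_of_ne (fun e => hw (congrArg Sum.inr e)) _ _)

lemma isLinearMap_setLabel_sum (P Q : BGraph O) (v : P.G.V) :
    IsLinearMap k fun p => ((P.setLabel v p).sum Q).cls := by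
  have : (fun p => ((P.setLabel v p).sum Q).cls) = fun p =>
      ((isLinearMap_cls (P.sum Q) (.inl v : P.G.V ⊕ Q.G.V)).mk' _ ∘ₗ
        O.map (fiberInl P.G Q.G v)) p := by
    funext p
    rw [setLabel_sum]
    rfl
  rw [this]
  exact LinearMap.isLinear _

lemma isLinearMap_sum_setLabel (P Q : BGraph O) (v : Q.G.V) :
    IsLinearMap k fun p => (P.sum (Q.setLabel v p)).cls := by
  have : (fun p => (P.sum (Q.setLabel v p)).cls) = fun p =>
      ((isLinearMap_cls (P.sum Q) (.inr v : P.G.V ⊕ Q.G.V)).mk' _ ∘ₗ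
        O.map (fiberInr P.G Q.G v)) p := by
    funext p
    rw [sum_setLabel]
    rfl
  rw [this]
  exact LinearMap.isLinear _

/-- Disjoint union with a graph, as a linear map. -/
def mulLeft (G : OGraph O) : Module.End k (BSpace O) :=
  BSpace.lift (fun Q => ((single G).sum Q).cls)
    (fun e => by rw [cls_iso ((Iso.refl (single G)).sum e), one_mul])
    (fun Q a => (congrArg _ (sum_reverse (single G) Q a)).trans (cls_reverse _ _))
    (fun Q v => isLinearMap_sum_setLabel _ Q v)

lemma mulLeft_cls (G : OGraph O) (Q : BGraph O) : mulLeft G Q.cls = ((single G).sum Q).cls :=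
  BSpace.lift_cls _ _ _ _ Q

end BGraph

/-! ### The action of the symmetric algebra on blocked graphs -/

open BGraph

/-- Disjoint union with one more block. -/
def blockMul (O : CyclicOperad.{u, v} k) : GraphSpace O →ₗ[k] Module.End k (BSpace O) :=
  GraphSpace.lift mulLeft
    (fun e h1 h2 h3 => BSpace.hom_ext fun Q => by
      rw [LinearMap.smul_apply, mulLeft_cls, mulLeft_cls,
        BGraph.cls_iso ((isoSingle e h1 h2 h3).sum (Iso.refl Q)), mul_one])
    (fun G a => BSpace.hom_ext fun Q => by
      rw [LinearMap.neg_apply, mulLeft_cls, mulLeft_cls, ← BGraph.cls_reverse]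
      exact congrArg _ (reverse_sum (single G) Q a))
    (fun G v => ⟨fun p q => BSpace.hom_ext fun Q => by
      rw [LinearMap.add_apply, mulLeft_cls, mulLeft_cls, mulLeft_cls]
      exact (isLinearMap_setLabel_sum (single G) Q v).map_add p q,
      fun c p => BSpace.hom_ext fun Q => by
      rw [LinearMap.smul_apply, mulLeft_cls, mulLeft_cls]
      exact (isLinearMap_setLabel_sum (single G) Q v).map_smul c p⟩)

lemma blockMul_cls (G : OGraph O) (Q : BGraph O) :
    blockMul O G.cls Q.cls = ((single G).sum Q).cls := by
  rw [blockMul, GraphSpace.lift_cls, mulLeft_cls]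

/-- Exchanging blocks with `d` and `e` vertices permutes the vertex order with sign `(-1) ^ (d *
e)`. This is the defining relation of the graded symmetric algebra, which therefore acts. -/
lemma blockMul_comm {d e : ℕ} {x y : GraphSpace O} (hx : x ∈ degreePart O d)
    (hy : y ∈ degreePart O e) :
    blockMul O x * blockMul O y = (-1 : k) ^ (d * e) • (blockMul O y * blockMul O x) := by
  induction hx using Submodule.span_induction with
  | zero => simp
  | add a b _ _ ha hb => rw [map_add, add_mul, mul_add, ha, hb, smul_add]
  | smul c a _ ha => rw [map_smul, smul_mul_assoc, mul_smul_comm, ha, smul_comm]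
  | mem x hx =>
    obtain ⟨G, rfl, rfl⟩ := hx
    induction hy using Submodule.span_induction with
    | zero => simp
    | add a b _ _ ha hb => rw [map_add, mul_add, add_mul, ha, hb, smul_add]
    | smul c a _ ha => rw [map_smul, smul_mul_assoc, mul_smul_comm, ha, smul_comm]
    | mem y hy =>
      obtain ⟨G', rfl, rfl⟩ := hy
      refine BSpace.hom_ext fun Q => ?_
      have := BGraph.cls_iso (isoSumLeftComm (single G') (single G) Q)
      rw [LinearMap.smul_apply, Module.End.mul_apply, Module.End.mul_apply, blockMul_cls,
        blockMul_cls, blockMul_cls, blockMul_cls, this, sg_pow, sg_neg, sg_one, OGraph.card_V,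
        OGraph.card_V,
        mul_comm]
      rfl

/-- The action of the symmetric algebra by disjoint union. -/
def symAct (O : CyclicOperad.{u, v} k) : SymAlg O →ₐ[k] Module.End k (BSpace O) :=
  RingQuot.liftAlgHom k ⟨TensorAlgebra.lift k (blockMul O), by
    rintro _ _ ⟨hx, hy⟩
    rw [map_mul, map_smul, map_mul, TensorAlgebra.lift_ι_apply, TensorAlgebra.lift_ι_apply,
      blockMul_comm hx hy]⟩

lemma symAct_symι (x : GraphSpace O) : symAct O (symι O x) = blockMul O x := by
  change symAct O (RingQuot.mkAlgHom k (SymRel O) (TensorAlgebra.ι k x)) = _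
  rw [symAct, RingQuot.liftAlgHom_mkAlgHom_apply, TensorAlgebra.lift_ι_apply]

lemma symι_mul_symι {d e : ℕ} {x y : GraphSpace O} (hx : x ∈ degreePart O d)
    (hy : y ∈ degreePart O e) :
    symι O x * symι O y = (-1 : k) ^ (d * e) • (symι O y * symι O x) := by
  have := RingQuot.mkAlgHom_rel k (SymRel.swap hx hy)
  rwa [map_mul, map_smul, map_mul] at this

namespace OGraph

/-! ### Restriction to a set of vertices -/

section Restrict

variable (G : OGraph O) (p : G.V → Prop)

/-- The half-edges at a vertex of the restriction. -/
def fiberRestrict (v : {v // p v}) : {h // G.vert h = v.1} ≃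
    {x : {h // p (G.vert h)} // (⟨G.vert x.1, x.2⟩ : {v // p v}) = v} :=
  Equiv.ofBijective (fun h => ⟨⟨h.1, by rw [h.2]; exact v.2⟩, Subtype.ext h.2⟩) (by
    constructor
    · rintro ⟨x, _⟩ ⟨y, _⟩ h
      exact Subtype.ext (congrArg (fun z => z.1.1) h)
    · rintro ⟨⟨x, hx⟩, h⟩
      exact ⟨⟨x, congrArg Subtype.val h⟩, rfl⟩)

/-- The part of a graph with vertices in a set that is closed under adjacency. -/
def restrict (hp : ∀ h, p (G.vert (G.inv h)) ↔ p (G.vert h)) : OGraph O where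
  V := {v // p v}
  H := {h // p (G.vert h)}
  vert x := ⟨G.vert x.1, x.2⟩
  inv := G.inv.subtypePerm hp
  inv_inv x := Subtype.ext (G.inv_inv x.1)
  inv_ne x e := G.inv_ne x.1 (congrArg Subtype.val e)
  tail x := G.tail x.1
  tail_inv x := G.tail_inv x.1
  ord := (G.ord.filter p).attachWith p fun v hv => by simpa using (List.mem_filter.1 hv).2
  ord_nodup := by
    refine List.Nodup.of_map Subtype.val ?_
    rw [List.attachWith_map_subtype_val]
    exact G.ord_nodup.filter _
  mem_ord v := by
    rw [List.mem_attachWith]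
    exact List.mem_filter.2 ⟨G.mem_ord _, by simpa using v.2⟩
  three_le v := by
    rw [← Nat.card_congr (G.fiberRestrict p v)]
    exact G.three_le v.1
  label v := O.map (G.fiberRestrict p v) (G.label v.1)

variable {G p}

lemma restrict_ord (hp) : (G.restrict p hp).ord.map Subtype.val = G.ord.filter p :=
  List.attachWith_map_subtype_val _

lemma lab_restrict {hp} {v : {v // p v}} {S : Type} [Finite S] {J : S → {h // p (G.vert h)}}
    {q : O.obj S} : (G.restrict p hp).Lab v J q ↔ G.Lab v.1 (fun s => (J s).1) q := by
  constructor
  · rintro ⟨e, he, hq⟩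
    refine ⟨e.trans (G.fiberRestrict p v).symm, fun s => ?_, ?_⟩
    · refine Eq.trans ?_ (congrArg Subtype.val (he s))
      have := congrArg (fun z => z.1.1) ((G.fiberRestrict p v).apply_symm_apply (e s))
      exact this
    · exact (O.map_trans _ _ _).trans ((congrArg _ hq).trans (map_symm_map O _ _))
  · rintro ⟨e, he, hq⟩
    exact ⟨e.trans (G.fiberRestrict p v), fun s => Subtype.ext (he s),
      (O.map_trans _ _ _).trans (congrArg _ hq)⟩

/-- The restriction of a similarity. -/
def Sim.restrict {G' : OGraph O} (e : Sim G G') {p' : G'.V → Prop}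
    (h : ∀ v, p v ↔ p' (e.onV v)) (hp hp') : Sim (G.restrict p hp) (G'.restrict p' hp') where
  onV := e.onV.subtypeEquiv h
  onH := e.onH.subtypeEquiv fun x => by rw [e.vert]; exact h _
  vert x := Subtype.ext (e.vert x.1)
  lab v S _ J q hl := lab_restrict.2 (e.lab _ _ _ _ (lab_restrict.1 hl))

end Restrict

end OGraph

/-! ### Signed products over lists -/

section Products

variable {ι V : Type*}

/-- Permuting factors in the symmetric algebra and permuting the corresponding vertex lists produce
one and the same sign. -/
lemma exists_sperm_flatMap_perm (F : ι → List V) (g : ι → GraphSpace O)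
    (hg : ∀ b, g b ∈ degreePart O (F b).length) {l l' : List ι} (h : l.Perm l') :
    ∃ t, SPerm t (l.flatMap F) (l'.flatMap F) ∧
      (l'.map fun b => symι O (g b)).prod = sg k t • (l.map fun b => symι O (g b)).prod := by
  induction h with
  | nil => exact ⟨1, SPerm.refl _, by simp⟩
  | cons b _ ih =>
    obtain ⟨t, h1, h2⟩ := ih
    exact ⟨t, h1.append_left _, by rw [List.map_cons, List.prod_cons, h2, mul_smul_comm]; rfl⟩
  | swap b c l =>
    refine ⟨(-1) ^ ((F c).length * (F b).length), ?_, ?_⟩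
    · have := (SPerm.append_comm (F b) (F c)).append_right (l.flatMap F)
      rwa [List.append_assoc, List.append_assoc] at this
    · simp only [List.map_cons, List.prod_cons, ← mul_assoc]
      rw [symι_mul_symι (hg b) (hg c), smul_mul_assoc, sg_pow, sg_neg, sg_one, mul_comm]
  | trans _ _ ih1 ih2 =>
    obtain ⟨t, h1, h2⟩ := ih1
    obtain ⟨t', h1', h2'⟩ := ih2
    exact ⟨t * t', h1.trans h1', by rw [h2', h2, smul_smul, ← sg_mul, mul_comm]⟩

lemma exists_sperm_flatMap_congr {ι' : Type*} (f : ι → ι') (F : ι → List V) (F' : ι' → List V)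
    (g : ι → SymAlg O) (g' : ι' → SymAlg O)
    (h : ∀ b, ∃ s, SPerm s (F b) (F' (f b)) ∧ g' (f b) = sg k s • g b) (l : List ι) :
    ∃ t, SPerm t (l.flatMap F) ((l.map f).flatMap F') ∧
      ((l.map f).map g').prod = sg k t • (l.map g).prod := by
  induction l with
  | nil => exact ⟨1, SPerm.refl _, by simp⟩
  | cons b l ih =>
    obtain ⟨t, h1, h2⟩ := ih
    obtain ⟨s, h3, h4⟩ := h b
    refine ⟨s * t, h3.append h1, ?_⟩
    rw [List.map_cons, List.map_cons, List.map_cons, List.prod_cons, List.prod_cons, h2, h4,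
      smul_mul_smul_comm, sg_mul]

end Products

/-! ### From blocked graphs to the symmetric algebra -/

namespace BGraph

open OGraph

/-- One block of a blocked graph. -/
def block (P : BGraph O) (b : P.B) : OGraph O :=
  P.G.restrict (fun v => P.blk v = b) fun h => by rw [P.blk_inv]

/-- A set of blocks of a blocked graph. -/
def restr (P : BGraph O) (q : P.B → Prop) : BGraph O where
  G := P.G.restrict (fun v => q (P.blk v)) fun h => by rw [P.blk_inv]
  B := {b // q b}
  blk v := ⟨P.blk v.1, v.2⟩
  blk_inv h := Subtype.ext (P.blk_inv h.1)

/-- The vertices of a block in order. -/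
def blockOrd (P : BGraph O) (b : P.B) : List P.G.V := P.G.ord.filter fun v => P.blk v = b

/-- The product of blocks in the symmetric algebra. -/
def blockProd (P : BGraph O) (l : List P.B) : SymAlg O :=
  (l.map fun b => symι O (P.block b).cls).prod

section

variable (P : BGraph O)

lemma block_mem_degreePart (b : P.B) :
    (P.block b).cls ∈ degreePart O (P.blockOrd b).length := by
  refine Submodule.subset_span ⟨P.block b, ?_, rfl⟩
  have := congrArg List.length (restrict_ord (G := P.G) (p := fun v => P.blk v = b)
    fun h => by rw [P.blk_inv])
  rw [OGraph.card_V]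
  exact (List.length_map (f := Subtype.val)).symm.trans this

lemma exists_sperm_blockOrd {l : List P.B} (hl : l.Nodup) (hm : ∀ b, b ∈ l) :
    ∃ t, SPerm t P.G.ord (l.flatMap P.blockOrd) := by
  refine SPerm.exists_of_perm ((List.perm_ext_iff_of_nodup P.G.ord_nodup ?_).2 fun v =>
    iff_of_true (P.G.mem_ord v) ?_)
  · refine List.nodup_flatMap.2 ⟨fun b _ => P.G.ord_nodup.filter _, hl.imp ?_⟩
    intro b c hbc
    simp only [Function.onFun, List.disjoint_left, blockOrd, List.mem_filter, decide_eq_true_eq]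
    exact fun v h h' => hbc (h.2.symm.trans h'.2)
  · exact List.mem_flatMap.2 ⟨P.blk v, hm _, List.mem_filter.2 ⟨P.G.mem_ord v, by simp⟩⟩

lemma exists_enum : ∃ l : List P.B, l.Nodup ∧ ∀ b, b ∈ l := by
  have := Fintype.ofFinite P.B
  exact ⟨Finset.univ.toList, Finset.nodup_toList _, by simp⟩

lemma exists_enum_cons (b : P.B) : ∃ l : List P.B, (b :: l).Nodup ∧ ∀ c, c ∈ b :: l := by
  obtain ⟨l, h1, h2⟩ := P.exists_enum
  refine ⟨l.erase b, ?_, fun c => ?_⟩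
  · exact (List.perm_cons_erase (h2 b)).nodup_iff.1 h1
  · exact (List.perm_cons_erase (h2 b)).mem_iff.1 (h2 c)

/-- A change of the enumeration of the blocks alters the sign of the vertex order and the product by
the same factor, so the signed product is well defined without a chosen order of the blocks. -/
lemma exists_symVal : ∃ w : SymAlg O, ∀ (l : List P.B) (t : ℤˣ), l.Nodup → (∀ b, b ∈ l) →
    SPerm t P.G.ord (l.flatMap P.blockOrd) → w = sg k t • P.blockProd l := by
  obtain ⟨l, h1, h2⟩ := P.exists_enum
  obtain ⟨t, ht⟩ := P.exists_sperm_blockOrd h1 h2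
  refine ⟨sg k t • P.blockProd l, fun l' t' h1' h2' ht' => ?_⟩
  have hp : l.Perm l' := (List.perm_ext_iff_of_nodup h1 h1').2 fun b =>
    iff_of_true (h2 b) (h2' b)
  obtain ⟨s, hs, hs'⟩ := exists_sperm_flatMap_perm P.blockOrd (fun b => (P.block b).cls)
    P.block_mem_degreePart hp
  rw [ht'.unique (ht.trans hs) P.G.ord_nodup, blockProd, blockProd, hs', smul_smul, ← sg_mul,
    mul_assoc, Int.units_mul_self, mul_one]

/-- The product of the blocks, in the symmetric algebra. -/
def symVal : SymAlg O := P.exists_symVal.choose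

variable {P}

lemma symVal_eq {l : List P.B} {t : ℤˣ} (hl : l.Nodup) (hm : ∀ b, b ∈ l)
    (ht : SPerm t P.G.ord (l.flatMap P.blockOrd)) : P.symVal = sg k t • P.blockProd l :=
  P.exists_symVal.choose_spec l t hl hm ht

lemma Iso.exists_sperm_block {Q : BGraph O} {s : ℤˣ} (e : Iso P Q s) (b : P.B) :
    ∃ t, SPerm t ((P.blockOrd b).map e.onV) (Q.blockOrd (e.onB b)) ∧
      symι O (Q.block (e.onB b)).cls = sg k t • symι O (P.block b).cls := by
  let f : Sim (P.block b) (Q.block (e.onB b)) := e.toSim.restrict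
    (p' := fun v => Q.blk v = e.onB b)
    (fun v => by rw [e.blk, e.onB.injective.eq_iff]) _ _
  have hp : ((P.block b).ord.map f.onV).Perm (Q.block (e.onB b)).ord :=
    (List.perm_ext_iff_of_nodup ((P.block b).ord_nodup.map f.onV.injective)
      (Q.block (e.onB b)).ord_nodup).2 fun v => iff_of_true
        (List.mem_map.2 ⟨f.onV.symm v, (P.block b).mem_ord _, by simp⟩)
        ((Q.block (e.onB b)).mem_ord v)
  obtain ⟨t, ht⟩ := SPerm.exists_of_perm hp
  refine ⟨t, ?_, ?_⟩
  · have h1 := ht.map Subtype.val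
    have h2 : (Q.block (e.onB b)).ord.map Subtype.val = Q.blockOrd (e.onB b) := restrict_ord _
    have h3 : (P.block b).ord.map Subtype.val = P.blockOrd b := restrict_ord _
    rw [h2] at h1
    rw [← h3]
    have h4 : ((P.block b).ord.map Subtype.val).map e.onV =
        ((P.block b).ord.map f.onV).map Subtype.val := List.map_map.trans
          (List.map_map (g := (Subtype.val : {v // Q.blk v = e.onB b} → Q.G.V)) (f := f.onV)).symm
    exact ((SPerm.of_eq h4).trans h1).cast (one_mul _)
  · rw [cls_sim f (fun h => Subtype.ext (e.inv h.1)) (fun h => e.tail h.1) ht, map_smul]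

/-- The sign `s` of the whole vertex order need not split evenly over the blocks: each block has its
own sign, and these are compared with `s` along one enumeration. -/
lemma symVal_iso {Q : BGraph O} {s : ℤˣ} (e : Iso P Q s) : Q.symVal = sg k s • P.symVal := by
  obtain ⟨l, h1, h2⟩ := P.exists_enum
  obtain ⟨t, ht⟩ := P.exists_sperm_blockOrd h1 h2
  obtain ⟨r, hr, hr'⟩ := exists_sperm_flatMap_congr e.onB (fun b => (P.blockOrd b).map e.onV)
    Q.blockOrd (fun b => symι O (P.block b).cls) (fun b => symι O (Q.block b).cls)
    e.exists_sperm_block l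
  have h3 := ht.map e.onV
  rw [List.map_flatMap] at h3
  have h4 := (e.ord.symm.trans h3).trans hr
  rw [symVal_eq h1 h2 ht, symVal_eq (h1.map e.onB.injective)
    (fun b => List.mem_map.2 ⟨e.onB.symm b, h2 _, by simp⟩) h4, blockProd, hr', blockProd]
  simp only [smul_smul, ← sg_mul]
  rw [mul_assoc, Int.units_mul_self, mul_one]

lemma symVal_eq_cons {b : P.B} {l : List P.B} {t : ℤˣ} (hl : (b :: l).Nodup)
    (hm : ∀ c, c ∈ b :: l) (ht : SPerm t P.G.ord ((b :: l).flatMap P.blockOrd)) :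
    P.symVal = sg k t • (symι O (P.block b).cls * P.blockProd l) :=
  symVal_eq hl hm ht

/-- The enumeration starts with the block that contains the edge, so only the first factor changes.
-/
lemma symVal_reverse (a : P.G.H) : (P.reverse a).symVal = -P.symVal := by
  obtain ⟨l, h1, h2⟩ := P.exists_enum_cons (P.hblk a)
  obtain ⟨t, ht⟩ := P.exists_sperm_blockOrd h1 h2
  have e1 : ((P.reverse a).block (P.hblk a)) =
      (P.block (P.hblk a)).reverse (⟨a, rfl⟩ : {h // P.blk (P.G.vert h) = P.hblk a}) := by
    refine OGraph.wire_congr (P.block (P.hblk a)) (i := (P.block (P.hblk a)).inv) rfl ?_ rfl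
      (P.block _).inv_inv (P.block _).inv_ne ((P.reverse a).block (P.hblk a)).tail_inv
      (P.block _).inv_inv (P.block _).inv_ne ((P.block (P.hblk a)).reverse
        (⟨a, rfl⟩ : {h // P.blk (P.G.vert h) = P.hblk a})).tail_inv
    funext x
    exact if_congr (or_congr
      ⟨fun h => Subtype.ext h, fun h => congrArg Subtype.val h⟩
      ⟨fun h => Subtype.ext h, fun h => congrArg Subtype.val h⟩) rfl rfl
  have e2 : (P.reverse a).blockProd l = P.blockProd l := by
    refine congrArg List.prod (List.map_congr_left fun b hb => ?_)
    have hne : b ≠ P.hblk a := by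
      rintro rfl
      exact (List.nodup_cons.1 h1).1 hb
    have e3 : (P.reverse a).block b = P.block b := by
      refine OGraph.wire_congr (P.block b) (i := (P.block b).inv) rfl ?_ rfl
        (P.block _).inv_inv (P.block _).inv_ne ((P.reverse a).block b).tail_inv
        (P.block _).inv_inv (P.block _).inv_ne (P.block b).tail_inv
      funext x
      refine if_neg ?_
      rintro (e | e)
      · exact hne (x.2.symm.trans (congrArg P.hblk e))
      · exact hne (x.2.symm.trans ((congrArg P.hblk e).trans (P.hblk_inv a)))
    rw [e3]
  rw [symVal_eq_cons h1 h2 ht]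
  refine (symVal_eq_cons (P := P.reverse a) h1 h2 ht).trans ?_
  have e4 : ((P.reverse a).block (P.hblk a)).cls = -(P.block (P.hblk a)).cls :=
    (congrArg _ e1).trans (OGraph.cls_reverse _ _)
  rw [e2, e4]
  exact (congrArg (sg k t • ·)
    ((LinearMap.mulRight k (P.blockProd l) ∘ₗ symι O).map_neg _)).trans (smul_neg _ _)

lemma isLinearMap_symVal (v : P.G.V) : IsLinearMap k fun p => (P.setLabel v p).symVal := by
  obtain ⟨l, h1, h2⟩ := P.exists_enum_cons (P.blk v)
  obtain ⟨t, ht⟩ := P.exists_sperm_blockOrd h1 h2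
  let T := O.map (P.G.fiberRestrict (fun w => P.blk w = P.blk v) ⟨v, rfl⟩)
  have e1 : ∀ p, ((P.setLabel v p).block (P.blk v)) =
      (P.block (P.blk v)).setLabel (⟨v, rfl⟩ : {w // P.blk w = P.blk v}) (T p) := by
    intro p
    refine OGraph.wire_congr (P.block (P.blk v)) (i := (P.block (P.blk v)).inv) rfl rfl ?_
      (P.block _).inv_inv (P.block _).inv_ne (P.block (P.blk v)).tail_inv
      (P.block _).inv_inv (P.block _).inv_ne (P.block (P.blk v)).tail_inv
    refine (@Function.eq_update_iff _ _ (fun _ _ => Classical.propDecidable _) _ _ _ _).2 ⟨?_, ?_⟩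
    · exact congrArg T (show Function.update P.G.label v p v = p from Function.update_self ..)
    · intro w hw
      exact congrArg (O.map (P.G.fiberRestrict _ w))
        (Function.update_of_ne (fun e => hw (Subtype.ext e)) _ _)
  have e2 : ∀ p, (P.setLabel v p).blockProd l = P.blockProd l := by
    intro p
    refine congrArg List.prod (List.map_congr_left fun b hb => ?_)
    have hne : b ≠ P.blk v := by
      rintro rfl
      exact (List.nodup_cons.1 h1).1 hb
    have e3 : (P.setLabel v p).block b = P.block b := by
      refine OGraph.wire_congr (P.block b) (i := (P.block b).inv) rfl rfl ?_
        (P.block _).inv_inv (P.block _).inv_ne (P.block b).tail_inv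
        (P.block _).inv_inv (P.block _).inv_ne (P.block b).tail_inv
      funext w
      exact congrArg (O.map (P.G.fiberRestrict _ w))
        (Function.update_of_ne (fun e => hne (w.2.symm.trans (congrArg P.blk e))) _ _)
    rw [e3]
  have e4 : (fun p => (P.setLabel v p).symVal) = fun p => sg k t •
      (LinearMap.mulRight k (P.blockProd l) ∘ₗ symι O ∘ₗ
        (OGraph.isLinearMap_cls (P.block (P.blk v)) ⟨v, rfl⟩).mk' _ ∘ₗ T) p := by
    funext p
    refine (symVal_eq_cons (P := P.setLabel v p) h1 h2 ht).trans ?_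
    rw [e2]
    refine congrArg (fun x => sg k t • (symι O x * P.blockProd l)) ?_
    exact congrArg OGraph.cls (e1 p)
  rw [e4]
  exact (sg k t • (LinearMap.mulRight k (P.blockProd l) ∘ₗ symι O ∘ₗ
        (OGraph.isLinearMap_cls (P.block (P.blk v)) ⟨v, rfl⟩).mk' _ ∘ₗ T)).isLinear

end

end BGraph

/-- The product of the blocks as a linear map. -/
def toSym (O : CyclicOperad.{u, v} k) : BSpace O →ₗ[k] SymAlg O :=
  BSpace.lift BGraph.symVal (fun e => BGraph.symVal_iso e)
    (fun _ a => BGraph.symVal_reverse a) (fun _ v => BGraph.isLinearMap_symVal v)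

lemma toSym_cls (P : BGraph O) : toSym O P.cls = P.symVal := BSpace.lift_cls _ _ _ _ P

/-! ### From the symmetric algebra back to blocked graphs -/

namespace BGraph

open OGraph

/-- The empty blocked graph. -/
def empty (O : CyclicOperad.{u, v} k) : BGraph O where
  G :=
    { V := Empty
      H := Empty
      vert := id
      inv := Equiv.refl _
      inv_inv := fun h => h.elim
      inv_ne := fun h => h.elim
      tail := fun h => h.elim
      tail_inv := fun h => h.elim
      ord := []
      ord_nodup := List.nodup_nil
      mem_ord := fun v => v.elim
      three_le := fun v => v.elim
      label := fun v => v.elim }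
  B := Empty
  blk := id
  blk_inv h := h.elim

/-- Elements with value in a list are divided by the first entry of the list. -/
def consEquiv {X B : Type} (f : X → B) {b : B} {l : List B} (hb : b ∉ l) :
    {x // f x = b} ⊕ {x // f x ∈ l} ≃ {x // f x ∈ b :: l} :=
  Equiv.ofBijective (Sum.elim (fun x => ⟨x.1, by rw [x.2]; exact List.mem_cons_self⟩)
    (fun x => ⟨x.1, List.mem_cons_of_mem _ x.2⟩)) (by
    constructor
    · rintro (⟨x, hx⟩ | ⟨x, hx⟩) (⟨y, hy⟩ | ⟨y, hy⟩) h
      all_goals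
        have e : x = y := congrArg Subtype.val h
        subst e
      · rfl
      · exact absurd hy (hx ▸ hb)
      · exact absurd hx (hy ▸ hb)
      · rfl
    · rintro ⟨x, hx⟩
      rcases List.mem_cons.1 hx with h | h
      · exact ⟨.inl ⟨x, h⟩, rfl⟩
      · exact ⟨.inr ⟨x, h⟩, rfl⟩)

/-- A list with its first entry separated. -/
def consEquivUnit {B : Type} {b : B} {l : List B} (hb : b ∉ l) :
    Unit ⊕ {x // x ∈ l} ≃ {x // x ∈ b :: l} :=
  Equiv.ofBijective (Sum.elim (fun _ => ⟨b, List.mem_cons_self⟩)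
    (fun x => ⟨x.1, List.mem_cons_of_mem _ x.2⟩)) (by
    constructor
    · rintro (⟨⟩ | ⟨x, hx⟩) (⟨⟩ | ⟨y, hy⟩) h
      · rfl
      · have e : b = y := congrArg Subtype.val h
        exact absurd hy (e ▸ hb)
      · have e : x = b := congrArg Subtype.val h
        exact absurd hx (e ▸ hb)
      · have e : x = y := congrArg Subtype.val h
        exact congrArg Sum.inr (Subtype.ext e)
    · rintro ⟨x, hx⟩
      rcases List.mem_cons.1 hx with h | h
      · exact ⟨.inl (), Subtype.ext h.symm⟩
      · exact ⟨.inr ⟨x, h⟩, rfl⟩)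

variable (P : BGraph O)

lemma restr_ord (q : P.B → Prop) : (P.restr q).G.ord.map Subtype.val =
    P.G.ord.filter fun v => q (P.blk v) := restrict_ord _

lemma block_ord (b : P.B) : (P.block b).ord.map Subtype.val = P.blockOrd b := restrict_ord _

/-- Splitting off one block. -/
lemma exists_iso_cons {b : P.B} {l : List P.B} (hb : b ∉ l) :
    ∃ s, Nonempty (Iso ((single (P.block b)).sum (P.restr (· ∈ l))) (P.restr (· ∈ b :: l)) s) ∧
      SPerm s (P.blockOrd b ++ (P.restr (· ∈ l)).G.ord.map Subtype.val)
        ((P.restr (· ∈ b :: l)).G.ord.map Subtype.val) := by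
  let σ : Sim ((P.block b).sum (P.restr (· ∈ l)).G) (P.restr (· ∈ b :: l)).G :=
    Sim.ofSum (G := P.block b) (G' := (P.restr (· ∈ l)).G) (G'' := (P.restr (· ∈ b :: l)).G)
      (consEquiv P.blk hb) (consEquiv (fun h => P.blk (P.G.vert h)) hb)
      (fun h => rfl) (fun h => rfl)
      (fun v S _ j p h => by
        have h' : P.G.Lab v.1 (fun s => (j s).1) p := lab_restrict.1 h
        exact lab_restrict.2 h')
      (fun v S _ j p h => by
        have h' : P.G.Lab v.1 (fun s => (j s).1) p := lab_restrict.1 h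
        exact lab_restrict.2 h')
  have hp : (((P.block b).sum (P.restr (· ∈ l)).G).ord.map σ.onV).Perm
      (P.restr (· ∈ b :: l)).G.ord :=
    (List.perm_ext_iff_of_nodup (List.Nodup.map σ.onV.injective (OGraph.ord_nodup _))
      (P.restr (· ∈ b :: l)).G.ord_nodup).2 fun v => iff_of_true
        (List.mem_map.2 ⟨σ.onV.symm v, OGraph.mem_ord _ _, by simp⟩) (OGraph.mem_ord _ v)
  obtain ⟨s, hs⟩ := SPerm.exists_of_perm hp
  refine ⟨s, ⟨{ toSim := σ, inv := ?_, tail := ?_, onB := consEquivUnit hb, blk := ?_, ord := hs }⟩,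
    ?_⟩
  · rintro (h | h) <;> rfl
  · rintro (h | h) <;> rfl
  · rintro (v | v)
    · exact Subtype.ext v.2
    · rfl
  · have h1 := hs.map Subtype.val
    have h2 : (((P.block b).sum (P.restr (· ∈ l)).G).ord.map σ.onV).map Subtype.val =
        P.blockOrd b ++ (P.restr (· ∈ l)).G.ord.map Subtype.val := by
      rw [← P.block_ord b]
      exact (List.map_map (f := σ.onV)
        (g := (Subtype.val : {v // P.blk v ∈ b :: l} → P.G.V))).trans
          (map_sum_ord (P.block b) (P.restr (· ∈ l)).G _)
    rw [← h2]
    exact h1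

end BGraph

open BGraph

/-- The blocked graph of an element of the symmetric algebra. -/
def fromSym (O : CyclicOperad.{u, v} k) : SymAlg O →ₗ[k] BSpace O :=
  LinearMap.applyₗ (BGraph.empty O).cls ∘ₗ (symAct O).toLinearMap

lemma fromSym_one : fromSym O 1 = (BGraph.empty O).cls := by
  change symAct O 1 (BGraph.empty O).cls = _
  rw [map_one]
  rfl

lemma fromSym_mul (x : GraphSpace O) (s : SymAlg O) :
    fromSym O (symι O x * s) = blockMul O x (fromSym O s) := by
  change symAct O (symι O x * s) (BGraph.empty O).cls = _
  rw [map_mul, symAct_symι]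
  rfl

/-- Acting on the empty graph by one block after another rebuilds the restriction to those blocks.
The sign compares the restricted vertex order with the concatenated block orders. -/
lemma exists_fromSym_blockProd (P : BGraph O) {l : List P.B} (hl : l.Nodup) :
    ∃ t, SPerm t ((P.restr (· ∈ l)).G.ord.map Subtype.val) (l.flatMap P.blockOrd) ∧
      fromSym O (P.blockProd l) = sg k t • (P.restr (· ∈ l)).cls := by
  induction l with
  | nil =>
    have h0 : (P.restr (· ∈ [])).G.ord = [] :=
      List.eq_nil_iff_forall_not_mem.2 fun v _ => absurd v.2 List.not_mem_nil
    refine ⟨1, SPerm.of_eq (congrArg (List.map Subtype.val) h0), ?_⟩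
    have e : Iso (BGraph.empty O) (P.restr (· ∈ [])) 1 :=
      { onV := ⟨fun v => v.elim, fun v => absurd v.2 List.not_mem_nil, fun v => v.elim,
          fun v => absurd v.2 List.not_mem_nil⟩
        onH := ⟨fun v => v.elim, fun v => absurd v.2 List.not_mem_nil, fun v => v.elim,
          fun v => absurd v.2 List.not_mem_nil⟩
        vert := fun h => h.elim
        lab := fun v => v.elim
        inv := fun h => h.elim
        tail := fun h => h.elim
        onB := ⟨fun v => v.elim, fun v => absurd v.2 List.not_mem_nil, fun v => v.elim,
          fun v => absurd v.2 List.not_mem_nil⟩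
        blk := fun v => v.elim
        ord := SPerm.of_eq h0.symm }
    rw [BGraph.cls_iso e, blockProd, List.map_nil, List.prod_nil, fromSym_one]
    simp
  | cons b l ih =>
    obtain ⟨t, h1, h2⟩ := ih (List.nodup_cons.1 hl).2
    obtain ⟨s, ⟨e⟩, h3⟩ := P.exists_iso_cons (List.nodup_cons.1 hl).1
    refine ⟨s * t, h3.symm.trans (h1.append_left _), ?_⟩
    rw [blockProd, List.map_cons, List.prod_cons, fromSym_mul, ← blockProd, h2, map_smul,
      blockMul_cls, BGraph.cls_iso e, smul_smul, ← sg_mul]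
    congr 2
    rw [mul_comm s, mul_assoc, Int.units_mul_self, mul_one]

/-- For an enumeration of all blocks the restriction is the whole graph; the signs from splitting
and from rebuilding agree by uniqueness and cancel. -/
lemma fromSym_toSym (x : BSpace O) : fromSym O (toSym O x) = x := by
  suffices h : fromSym O ∘ₗ toSym O = LinearMap.id from LinearMap.congr_fun h x
  refine BSpace.hom_ext fun P => ?_
  obtain ⟨l, h1, h2⟩ := P.exists_enum
  obtain ⟨t, ht⟩ := P.exists_sperm_blockOrd h1 h2
  obtain ⟨t', ht', h3⟩ := exists_fromSym_blockProd P h1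
  have hf : (P.restr (· ∈ l)).G.ord.map Subtype.val = P.G.ord :=
    (P.restr_ord _).trans (List.filter_eq_self.2 fun v _ => by simpa using h2 _)
  rw [hf] at ht'
  obtain rfl := ht.unique ht' P.G.ord_nodup
  let e : Iso (P.restr (· ∈ l)) P 1 :=
    { onV := Equiv.subtypeUnivEquiv fun v => h2 _
      onH := Equiv.subtypeUnivEquiv fun v => h2 _
      vert := fun h => rfl
      lab := fun v S _ j p h => OGraph.lab_restrict.1 h
      inv := fun h => rfl
      tail := fun h => rfl
      onB := Equiv.subtypeUnivEquiv fun v => h2 _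
      blk := fun v => rfl
      ord := SPerm.of_eq hf }
  rw [LinearMap.comp_apply, toSym_cls, symVal_eq h1 h2 ht, map_smul, h3, sg_smul_smul,
    LinearMap.id_apply, BGraph.cls_iso e, sg_one, one_smul]

/-! ### Contraction and gluing in one factor of a disjoint union -/

namespace OGraph

variable {G G' : OGraph O}

lemma Lab.of_inl {v : G.V} {S : Type} [Finite S] {j : S → G.H ⊕ G'.H} {p : O.obj S}
    (h : (G.sum G').Lab (.inl v) j p) : ∃ i, (∀ s, j s = .inl (i s)) ∧ G.Lab v i p := by
  obtain ⟨σ, rfl, hp⟩ := (G.lab_label v).inl.exists_equiv h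
  exact ⟨fun s => (σ s).1, fun _ => rfl, σ, fun _ => rfl, hp.symm⟩

lemma Lab.of_inr {v : G'.V} {S : Type} [Finite S] {j : S → G.H ⊕ G'.H} {p : O.obj S}
    (h : (G.sum G').Lab (.inr v) j p) : ∃ i, (∀ s, j s = .inr (i s)) ∧ G'.Lab v i p := by
  obtain ⟨σ, rfl, hp⟩ := (G'.lab_label v).inr.exists_equiv h
  exact ⟨fun s => (σ s).1, fun _ => rfl, σ, fun _ => rfl, hp.symm⟩

lemma Lab.of_eq {v w : G.V} {S : Type} [Finite S] {j : S → G.H} {p : O.obj S}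
    (h : G.Lab v j p) (e : w = v) : G.Lab w j p := e ▸ h

variable (G G') (a : G.H)

/-- The half-edges after the contraction of an edge in the first summand. -/
def sumCH : (G.sum G').CH (.inl a : G.H ⊕ G'.H) ≃ G.CH a ⊕ G'.H where
  toFun
    | ⟨.inl x, h⟩ => .inl ⟨x, fun e => h.1 (congrArg Sum.inl e), fun e => h.2 (congrArg Sum.inl e)⟩
    | ⟨.inr x, _⟩ => .inr x
  invFun
    | .inl x => ⟨.inl x.1, fun e => x.2.1 (Sum.inl_injective e),
        fun e => x.2.2 (Sum.inl_injective e)⟩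
    | .inr x => ⟨.inr x, Sum.inr_ne_inl, Sum.inr_ne_inl⟩
  left_inv := by rintro ⟨x | x, h⟩ <;> rfl
  right_inv := by rintro (x | x) <;> rfl

lemma sum_cproj_eq_iff (v w : G.V ⊕ G'.V) :
    (G.sum G').cproj (.inl a : G.H ⊕ G'.H) v = (G.sum G').cproj (.inl a : G.H ⊕ G'.H) w ↔
      Sum.map (G.cproj a) id v = Sum.map (G.cproj a) id w := by
  refine ((G.sum G').cproj_eq_iff (.inl a : G.H ⊕ G'.H)).trans ?_
  change v = w ∨ (v = .inl (G.vert a) ∨ v = .inl (G.vert (G.inv a))) ∧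
    (w = .inl (G.vert a) ∨ w = .inl (G.vert (G.inv a))) ↔ _
  rcases v with v | v <;> rcases w with w | w <;> simp [cproj_eq_iff]

/-- The vertices after the contraction of an edge in the first summand. -/
def sumCV : (G.sum G').CV (.inl a : G.H ⊕ G'.H) ≃ G.CV a ⊕ G'.V :=
  equivOfSurjective ((G.sum G').cproj (.inl a : G.H ⊕ G'.H)) (Sum.map (G.cproj a) id)
    (cproj_surjective _ _) ((G.cproj_surjective a).sumMap Function.surjective_id)
    (sum_cproj_eq_iff G G' a)

lemma sumCV_cproj (w : G.V ⊕ G'.V) : sumCV G G' a ((G.sum G').cproj (.inl a : G.H ⊕ G'.H) w) =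
    Sum.map (G.cproj a) id w :=
  equivOfSurjective_apply (f := (G.sum G').cproj (.inl a : G.H ⊕ G'.H))
    (g := Sum.map (G.cproj a) id) w

/-- Contraction of an edge in the first summand. -/
def simContractSum (hl : G.vert a ≠ G.vert (G.inv a))
    (hl' : (G.sum G').vert (.inl a : G.H ⊕ G'.H) ≠
      (G.sum G').vert ((G.sum G').inv (.inl a : G.H ⊕ G'.H))) :
    Sim ((G.sum G').contract (.inl a : G.H ⊕ G'.H) hl') ((G.contract a hl).sum G') :=
  Sim.ofContract (G.sum G') (.inl a : G.H ⊕ G'.H) hl' (G' := (G.contract a hl).sum G')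
    (sumCV G G' a) (sumCH G G' a)
    (by
      rintro ⟨x | x, h⟩
      · exact (sumCV_cproj G G' a (.inl (G.vert x))).symm
      · exact (sumCV_cproj G G' a (.inr (G'.vert x))).symm)
    (by
      intro w hw S _ j p J h hJ
      refine Lab.of_eq ?_ (sumCV_cproj G G' a w)
      rcases w with w | w
      · obtain ⟨i, hi, hp⟩ := h.of_inl
        have hw' : w ≠ G.vert a ∧ w ≠ G.vert (G.inv a) :=
          ⟨fun e => hw.1 (congrArg Sum.inl e), fun e => hw.2 (congrArg Sum.inl e)⟩
        obtain ⟨I, hI⟩ := exists_lift_CH a hp.mem hw'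
        refine (hp.contract_some hl hw' hI).inl.congr fun s => ?_
        have e : J s = (sumCH G G' a).symm (.inl (I s)) :=
          Subtype.ext ((hJ s).trans ((hi s).trans (congrArg Sum.inl (hI s).symm)))
        exact (sumCH G G' a).eq_symm_apply.1 e
      · obtain ⟨i, hi, hp⟩ := h.of_inr
        refine hp.inr.congr fun s => ?_
        have e : J s = (sumCH G G' a).symm (.inr (i s)) := Subtype.ext ((hJ s).trans (hi s))
        exact (sumCH G G' a).eq_symm_apply.1 e)
    (by
      intro A B _ _ j p j' q J hj h hj' h' hJ hJ'
      obtain ⟨i, hi, hp⟩ := Lab.of_inl (v := G.vert a) h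
      obtain ⟨i', hi', hq⟩ := Lab.of_inl (v := G.vert (G.inv a)) h'
      have hin : i none = a := Sum.inl_injective ((hi none).symm.trans hj)
      have hin' : i' none = G.inv a := Sum.inl_injective ((hi' none).symm.trans hj')
      have h1 : ∀ x, ∃ y : G.CH a, J x = (sumCH G G' a).symm (.inl y) := by
        intro x
        obtain ⟨y, hy⟩ : ∃ y, (J x).1 = .inl y := by
          rcases x with x | x
          · exact ⟨_, (hJ x).trans (hi _)⟩
          · exact ⟨_, (hJ' x).trans (hi' _)⟩
        refine ⟨⟨y, fun e => (J x).2.1 (hy.trans (congrArg Sum.inl e)),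
          fun e => (J x).2.2 (hy.trans (congrArg Sum.inl e))⟩, Subtype.ext hy⟩
      choose I hI using h1
      have h2 := hp.contract_none hl hin hq hin' (J := I)
        (fun x => Sum.inl_injective (((congrArg Subtype.val (hI (.inl x))).symm.trans
          (hJ x)).trans (hi _)))
        (fun x => Sum.inl_injective (((congrArg Subtype.val (hI (.inr x))).symm.trans
          (hJ' x)).trans (hi' _)))
      have h3 : sumCV G G' a none = .inl none := by
        have := sumCV_cproj G G' a (.inl (G.vert a))
        rw [show (G.sum G').cproj (.inl a : G.H ⊕ G'.H) (.inl (G.vert a)) = none from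
          cproj_vert _ _] at this
        exact this.trans (congrArg Sum.inl (G.cproj_vert a))
      refine Lab.of_eq ?_ h3
      exact h2.inl.congr fun s => (sumCH G G' a).eq_symm_apply.1 (hI s))

end OGraph

namespace BGraph

open OGraph

/-- The vertices of `G` come first, so bringing the ends of the edge to the front never passes a
vertex of `Q`, and no additional sign arises. -/
lemma pcontract_sum (G : OGraph O) (Q : BGraph O) (a : G.H) :
    ((single G).sum Q).pcontract (.inl a : G.H ⊕ Q.G.H) = blockMul O (G.contractClass a) Q.cls := by
  by_cases hl : G.vert a = G.vert (G.inv a)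
  · rw [contractClass, dif_pos hl, map_zero, LinearMap.zero_apply]
    exact ((single G).sum Q).pcontract_of_loop _ (congrArg Sum.inl hl)
  · have hl' : ((single G).sum Q).G.vert (.inl a : G.H ⊕ Q.G.H) ≠
        ((single G).sum Q).G.vert (((single G).sum Q).G.inv (.inl a : G.H ⊕ Q.G.H)) :=
      fun e => hl (Sum.inl_injective e)
    rw [contractClass, dif_neg hl, map_smul, LinearMap.smul_apply, blockMul_cls, contractSign_eq]
    have hs : SPerm (G.endSign a) (G.sum Q.G).ord (.inl (G.vert a) :: .inl (G.vert (G.inv a)) ::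
        ((G.rest a).map .inl ++ Q.G.ord.map .inr)) :=
      ((G.sperm_ends a hl).map Sum.inl).append_right (Q.G.ord.map .inr)
    have hp := sumCV_cproj G Q.G a
    have ht : SPerm 1 ((simContractSum G Q.G a hl hl').onV ((G.sum Q.G).cproj
        (.inl a : G.H ⊕ Q.G.H) (.inl (G.vert a))) ::
        ((G.rest a).map Sum.inl ++ Q.G.ord.map Sum.inr).map fun w =>
          (simContractSum G Q.G a hl hl').onV ((G.sum Q.G).cproj (.inl a : G.H ⊕ Q.G.H) w))
        ((G.contract a hl).sum Q.G).ord := by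
      have h1 : ((G.contract a hl).sum Q.G).ord = Sum.inl none ::
          ((G.rest a).map (fun w => Sum.inl (G.cproj a w)) ++ Q.G.ord.map Sum.inr) := by
        have h := congrArg (List.map (Sum.inl : G.CV a → G.CV a ⊕ Q.G.V)) (G.contract_ord' a hl)
        rw [List.map_cons, List.map_map] at h
        exact congrArg (· ++ Q.G.ord.map Sum.inr) h
      have h2 : ∀ f : G.V ⊕ Q.G.V → G.CV a ⊕ Q.G.V, (∀ w, f w = Sum.map (G.cproj a) id w) →
          f (.inl (G.vert a)) :: ((G.rest a).map Sum.inl ++ Q.G.ord.map Sum.inr).map f =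
            Sum.inl none ::
              ((G.rest a).map (fun w => Sum.inl (G.cproj a w)) ++ Q.G.ord.map Sum.inr) := by
        intro f hf
        rw [List.map_append, List.map_map, List.map_map, hf, Sum.map_inl, cproj_vert]
        exact congrArg _ (congrArg₂ _ (List.map_congr_left fun w _ => hf (.inl w))
          (List.map_congr_left fun w _ => hf (.inr w)))
      exact SPerm.of_eq ((h2 _ hp).trans h1.symm)
    have e : Iso (((single G).sum Q).contr (.inl a : G.H ⊕ Q.G.H) hl')
        ((single (G.contract a hl)).sum Q)
        (((single G).sum Q).G.endSign (.inl a : G.H ⊕ Q.G.H) * G.endSign a * 1) :=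
      isoOfContract (P := (single G).sum Q) hl' (Q := (single (G.contract a hl)).sum Q)
        (simContractSum G Q.G a hl hl')
        (by rintro ⟨x | x, h⟩ <;> rfl) (by rintro ⟨x | x, h⟩ <;> rfl) (Equiv.refl _)
        (by
          intro w
          refine (congrArg ((single (G.contract a hl)).sum Q).blk (hp w)).trans ?_
          rcases w with w | w <;> rfl) hs ht
    rw [mul_one] at e
    exact pcontract_eq e

/-- Gluing a polygon that meets all blocks of the first summand. -/
def isoGlueSum (P Q : BGraph O) {n : ℕ} [NeZero n] {h : Fin n → P.G.H} (hh : P.InDiff h)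
    (hs : Function.Surjective fun l => P.hblk (h l)) :
    Iso ((single (P.G.glue h)).sum Q)
      ((P.sum Q).glueB fun l => (.inl (h l) : P.G.H ⊕ Q.G.H)) 1 := by
  let c := (P.sum Q).G.cyc fun l => (.inl (h l) : P.G.H ⊕ Q.G.H)
  have hi : Function.Injective fun l => (.inl (h l) : P.G.H ⊕ Q.G.H) :=
    Sum.inl_injective.comp hh.injective
  have c1 : ∀ x, c (.inl x) = .inl (P.G.cyc h x) := by
    intro x
    by_cases hx : ∃ l, h l = x
    · obtain ⟨l, rfl⟩ := hx
      exact (formPerm_ofFn_apply hi l).trans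
        (congrArg Sum.inl (formPerm_ofFn_apply hh.injective l).symm)
    · push Not at hx
      exact (formPerm_ofFn_of_notMem fun l e => hx l (Sum.inl_injective e)).trans
        (congrArg Sum.inl (formPerm_ofFn_of_notMem hx).symm)
  have c2 : ∀ x, c (.inr x) = .inr x := fun x => formPerm_ofFn_of_notMem fun l => Sum.inl_ne_inr
  let r := (P.sum Q).mergeBlocks fun l => (.inl (h l) : P.G.H ⊕ Q.G.H)
  -- The polygon meets every block of `P`, so the merging collapses `P.B` to a point and leaves the
  -- blocks of `Q` separate.
  have hr : ∀ b b', Sum.map (fun _ => ()) id b = Sum.map (fun _ => ()) id b' ↔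
      Quotient.mk r b = Quotient.mk r b' := by
    intro b b'
    refine Iff.trans ?_ Quotient.eq.symm
    have hm : ∀ b : P.B, (Sum.inl b : P.B ⊕ Q.B) ∈
        Set.range fun l => (P.sum Q).hblk (.inl (h l) : P.G.H ⊕ Q.G.H) := by
      intro b
      obtain ⟨l, rfl⟩ := hs b
      exact ⟨l, rfl⟩
    have hm' : ∀ b : Q.B, (Sum.inr b : P.B ⊕ Q.B) ∉
        Set.range fun l => (P.sum Q).hblk (.inl (h l) : P.G.H ⊕ Q.G.H) := by
      rintro b ⟨l, hl⟩
      exact Sum.inl_ne_inr hl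
    refine Iff.trans ?_ merge_iff.symm
    rcases b with b | b <;> rcases b' with b' | b'
    · exact iff_of_true rfl (.inr ⟨hm _, hm _⟩)
    · exact iff_of_false Sum.inl_ne_inr (not_or.2 ⟨Sum.inl_ne_inr, fun x => hm' _ x.2⟩)
    · exact iff_of_false Sum.inr_ne_inl (not_or.2 ⟨Sum.inr_ne_inl, fun x => hm' _ x.1⟩)
    · refine ⟨fun e => .inl (congrArg Sum.inr (Sum.inr_injective e)), fun x => ?_⟩
      rcases x with x | x
      · exact congrArg (Sum.map (fun _ => ()) id) x
      · exact absurd x.1 (hm' _)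
  have hsurj : Function.Surjective (Sum.map (fun _ : P.B => ()) (id : Q.B → Q.B)) :=
    Function.Surjective.sumMap (fun _ => ⟨P.hblk (h 0), rfl⟩) Function.surjective_id
  exact
    { onV := Equiv.refl _
      onH := Equiv.refl _
      vert := by rintro (x | x) <;> rfl
      lab := by
        rintro (v | v) S _ j p hp
        · obtain ⟨i, hi, hp⟩ := hp.of_inl
          have hp' : P.G.Lab v i p := hp
          exact hp'.inl.congr hi
        · obtain ⟨i, hi, hp⟩ := hp.of_inr
          exact hp.inr.congr hi
      inv := by
        rintro (x | x)
        · obtain ⟨x, rfl⟩ := (P.G.cyc h).surjective x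
          have h1 := rewire_inv_apply (P.sum Q).G c (.inl x)
          rw [c1] at h1
          refine h1.trans ((c1 _).trans ?_)
          exact congrArg Sum.inl (rewire_inv_apply P.G (P.G.cyc h) x).symm
        · have h1 := rewire_inv_apply (P.sum Q).G c (.inr x)
          rw [c2] at h1
          exact h1.trans (c2 _)
      tail := by
        rintro (x | x)
        · obtain ⟨x, rfl⟩ := (P.G.cyc h).surjective x
          have h1 := rewire_tail_apply (P.sum Q).G c (.inl x)
          rw [c1] at h1
          exact h1.trans (rewire_tail_apply P.G (P.G.cyc h) x).symm
        · have h1 := rewire_tail_apply (P.sum Q).G c (.inr x)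
          rw [c2] at h1
          exact h1
      onB := equivOfSurjective (Sum.map (fun _ => ()) id) (Quotient.mk r) hsurj
        Quotient.mk_surjective hr
      blk := fun v => by
        refine Eq.trans ?_ (congrArg (equivOfSurjective (Sum.map (fun _ => ()) id) (Quotient.mk r)
          hsurj Quotient.mk_surjective hr)
          (show Sum.map (fun _ => ()) id ((P.sum Q).blk v) = _ by rcases v with v | v <;> rfl))
        exact (equivOfSurjective_apply (f := Sum.map (fun _ => ()) id) (g := Quotient.mk r)
          ((P.sum Q).blk v)).symm
      ord := SPerm.of_eq (List.map_id _) }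

/-- This yields the product form of a coderivation term: the polygon turns its own factor into a
single graph, and the other factor is only multiplied on. -/
lemma fterm_sum (P Q : BGraph O) {n : ℕ} [NeZero n] {h : Fin n → P.G.H} (hh : P.InDiff h)
    (hs : Function.Surjective fun l => P.hblk (h l)) :
    (P.sum Q).fterm (fun l => (.inl (h l) : P.G.H ⊕ Q.G.H)) =
      blockMul O ((P.G.glue h).contractClass (P.G.cyc h (h 0))) Q.cls := by
  have h1 := pcontract_iso (isoGlueSum P Q hh hs) (.inl (P.G.cyc h (h 0)) : P.G.H ⊕ Q.G.H)
  rw [sg_one, one_smul] at h1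
  refine Eq.trans (congrArg ((P.sum Q).glueB fun l => (.inl (h l) : P.G.H ⊕ Q.G.H)).pcontract ?_)
    (h1.trans (pcontract_sum (P.G.glue h) Q _))
  exact (formPerm_ofFn_apply (Sum.inl_injective.comp hh.injective) 0).trans
    (congrArg Sum.inl (formPerm_ofFn_apply hh.injective 0).symm)

end BGraph

/-! ### Sorted lists -/

section Sorted

variable {ι : Type*} [LinearOrder ι]

lemma sort_eq_of_pairwise {s : Finset ι} {l : List ι} (hl : l.Pairwise (· < ·))
    (h : ∀ i, i ∈ l ↔ i ∈ s) : s.sort (· ≤ ·) = l := by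
  refine List.Perm.eq_of_pairwise' (s.pairwise_sort _) (hl.imp le_of_lt) ?_
  refine (List.perm_ext_iff_of_nodup (s.sort_nodup _) (hl.imp ne_of_lt)).2 fun i => ?_
  rw [Finset.mem_sort, h]

lemma pairwise_lt_sort (s : Finset ι) : (s.sort (· ≤ ·)).Pairwise (· < ·) :=
  s.sortedLT_sort.pairwise

lemma map_val_sort_univ (s : Finset ι) :
    ((Finset.univ : Finset s).sort (· ≤ ·)).map Subtype.val = s.sort (· ≤ ·) := by
  refine (sort_eq_of_pairwise ?_ fun i => ?_).symm
  · exact List.pairwise_map.2 ((pairwise_lt_sort _).imp fun h => h)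
  · simp

lemma sort_eq_filter [Fintype ι] (s : Finset ι) (p : ι → Prop) [DecidablePred p]
    (h : ∀ i, i ∈ s ↔ p i) :
    s.sort (· ≤ ·) = ((Finset.univ : Finset ι).sort (· ≤ ·)).filter p := by
  refine sort_eq_of_pairwise ((pairwise_lt_sort _).filter _) fun i => ?_
  simp [h]

end Sorted

/-! ### Disjoint unions of families -/

namespace OGraph

variable {ι : Type} [Fintype ι] [LinearOrder ι] {G : ι → OGraph O}

lemma lab_union_label (i : ι) (v : (G i).V) : (union G).Lab ⟨i, v⟩
    (fun x : {h // (G i).vert h = v} => (⟨i, x.1⟩ : Σ i, (G i).H)) ((G i).label v) :=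
  (lab_map _).1 ((union G).lab_label ⟨i, v⟩)

lemma Lab.union {i : ι} {v : (G i).V} {S : Type} [Finite S] {j : S → (G i).H} {p : O.obj S}
    (h : (G i).Lab v j p) : (union G).Lab ⟨i, v⟩ (fun s => (⟨i, j s⟩ : Σ i, (G i).H)) p := by
  obtain ⟨σ, rfl, hp⟩ := ((G i).lab_label v).exists_equiv h
  have := lab_union_label i v
  rw [hp] at this
  exact (lab_map σ).1 this

end OGraph

namespace BGraph

open OGraph

lemma filter_flatMap_fst {ι : Type} (G : ι → OGraph O) (i : ι) : ∀ l : List ι, l.Nodup → i ∈ l →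
    (l.flatMap fun j => (G j).ord.map (Sigma.mk j)).filter (fun v => v.1 = i) =
      (G i).ord.map (Sigma.mk i) := by
  intro l hl hi
  have h1 : ∀ m : List ι, i ∉ m →
      (m.flatMap fun j => (G j).ord.map (Sigma.mk j)).filter (fun v => v.1 = i) = [] := by
    intro m hm
    rw [List.filter_eq_nil_iff]
    intro v hv
    obtain ⟨j, hj, hv⟩ := List.mem_flatMap.1 hv
    obtain ⟨w, -, rfl⟩ := List.mem_map.1 hv
    have : j ≠ i := fun e => hm (e ▸ hj)
    simpa using this
  obtain ⟨m, m', rfl⟩ := List.append_of_mem hi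
  have h2 := (List.nodup_middle.1 hl)
  rw [List.nodup_cons, List.mem_append, not_or] at h2
  rw [List.flatMap_append, List.flatMap_cons, List.filter_append, List.filter_append, h1 _ h2.1.1,
    h1 _ h2.1.2, List.nil_append, List.append_nil, List.filter_eq_self]
  intro v hv
  obtain ⟨w, -, rfl⟩ := List.mem_map.1 hv
  simp

section Union

variable {ι : Type} [Fintype ι] [LinearOrder ι] (G : ι → OGraph O)

/-- The disjoint union of a family of graphs, with the members as blocks. -/
def union : BGraph O := ⟨OGraph.union G, ι, Sigma.fst, fun _ => rfl⟩

lemma union_blockOrd (i : ι) : (union G).blockOrd i = (G i).ord.map (Sigma.mk i) := by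
  exact filter_flatMap_fst G i _ (Finset.sort_nodup Finset.univ (· ≤ ·)) (by simp)

lemma union_block_cls (i : ι) : ((union G).block i).cls = (G i).cls := by
  let e : Sim (G i) ((union G).block i) :=
    { onV := ⟨fun v => ⟨⟨i, v⟩, rfl⟩, fun v => v.2 ▸ v.1.2, fun v => rfl, by
        rintro ⟨⟨j, v⟩, rfl⟩
        rfl⟩
      onH := ⟨fun v => ⟨⟨i, v⟩, rfl⟩, fun v => v.2 ▸ v.1.2, fun v => rfl, by
        rintro ⟨⟨j, v⟩, rfl⟩
        rfl⟩
      vert := fun h => rfl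
      lab := fun v S _ j p h => lab_restrict.2 h.union }
  have h := cls_sim e (fun _ => rfl) (fun _ => rfl) (s := 1) (SPerm.of_eq (by
    refine List.map_injective_iff.2 Subtype.val_injective ?_
    refine Eq.trans ?_ (((union G).block_ord i).trans (union_blockOrd G i)).symm
    exact List.map_map))
  rw [h, sg_one, one_smul]

lemma toSym_union : toSym O (union G).cls =
    (((Finset.univ : Finset ι).sort (· ≤ ·)).map fun i => symι O (G i).cls).prod := by
  let l : List ι := (Finset.univ : Finset ι).sort (· ≤ ·)
  have h : SPerm 1 (union G).G.ord (l.flatMap (union G).blockOrd) :=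
    SPerm.of_eq (congrArg l.flatMap (funext fun i => (union_blockOrd G i).symm))
  have hn : l.Nodup := Finset.sort_nodup _ _
  have hm : ∀ i : ι, i ∈ l := fun i => (Finset.mem_sort _).2 (Finset.mem_univ i)
  rw [toSym_cls, symVal_eq (P := union G) hn hm h, sg_one, one_smul]
  exact congrArg List.prod (List.map_congr_left fun i _ => congrArg (symι O) (union_block_cls G i))

end Union

end BGraph

open BGraph

/-! ### The symmetric algebra and blocked graphs -/

/-- Classes of graphs span the graph space and hence generate the algebra. Uniqueness of the
coderivation and surjectivity of `toSym` both follow from this. -/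
lemma span_prod_cls : Submodule.span k
    (Set.range fun l : List (OGraph O) => (l.map fun G => symι O G.cls).prod) = ⊤ := by
  have h1 : Algebra.adjoin k (Set.range fun G : OGraph O => symι O G.cls) = ⊤ := by
    rw [eq_top_iff]
    rintro x -
    obtain ⟨x, rfl⟩ := RingQuot.mkAlgHom_surjective k (SymRel O) x
    induction x using TensorAlgebra.induction with
    | algebraMap r => rw [AlgHom.commutes]; exact Subalgebra.algebraMap_mem _ _
    | mul a b ha hb => rw [map_mul]; exact Subalgebra.mul_mem _ ha hb
    | add a b ha hb => rw [map_add]; exact Subalgebra.add_mem _ ha hb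
    | ι x =>
      have hx : x ∈ Submodule.span k (Set.range (OGraph.cls (O := O))) := by
        rw [GraphSpace.span_cls]; trivial
      change symι O x ∈ _
      induction hx using Submodule.span_induction with
      | mem x hx =>
        obtain ⟨G, rfl⟩ := hx
        exact Algebra.subset_adjoin ⟨G, rfl⟩
      | zero => rw [map_zero]; exact Subalgebra.zero_mem _
      | add a b _ _ ha hb => rw [map_add]; exact Subalgebra.add_mem _ ha hb
      | smul c a _ ha => rw [map_smul]; exact Subalgebra.smul_mem _ ha c
  rw [eq_top_iff, ← Algebra.top_toSubmodule, ← h1, Algebra.adjoin_eq_span, Submodule.span_le]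
  intro x hx
  obtain ⟨l, hl, rfl⟩ := Submonoid.exists_list_of_mem_closure hx
  obtain ⟨l, rfl⟩ : l ∈ Set.range (List.map fun G : OGraph O => symι O G.cls) := by
    rw [Set.range_list_map]
    exact hl
  exact Submodule.subset_span ⟨l, rfl⟩

lemma word_univ {m : ℕ} (G : Fin m → OGraph O) :
    word G Finset.univ = ((List.ofFn G).map fun G => symι O G.cls).prod := by
  rw [word, Fin.sort_univ, List.map_ofFn, ← List.ofFn_eq_map]
  rfl

lemma prod_cls_eq_word (l : List (OGraph O)) :
    (l.map fun G => symι O G.cls).prod = word l.get Finset.univ := by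
  rw [word_univ, List.ofFn_get]

lemma toSym_union_fin {m : ℕ} (G : Fin m → OGraph O) :
    toSym O (BGraph.union G).cls = word G Finset.univ := toSym_union G

lemma toSym_union_restrict {m : ℕ} (G : Fin m → OGraph O) (I : Finset (Fin m)) :
    toSym O (BGraph.union fun i : I => G i).cls = word G I := by
  rw [toSym_union, word, ← map_val_sort_univ I, List.map_map]
  rfl

lemma toSym_surjective : Function.Surjective (toSym O) := by
  rw [← LinearMap.range_eq_top, eq_top_iff, ← span_prod_cls, Submodule.span_le]
  rintro _ ⟨l, rfl⟩
  exact ⟨(BGraph.union l.get).cls, (toSym_union_fin _).trans (prod_cls_eq_word l).symm⟩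

lemma toSym_fromSym (s : SymAlg O) : toSym O (fromSym O s) = s := by
  obtain ⟨x, rfl⟩ := toSym_surjective s
  rw [fromSym_toSym]

/-- Multiplicativity is immediate for `fromSym`, and passes to the inverse. -/
lemma toSym_blockMul (x : GraphSpace O) (y : BSpace O) :
    toSym O (blockMul O x y) = symι O x * toSym O y := by
  rw [← toSym_fromSym (symι O x * toSym O y), fromSym_mul, fromSym_toSym]

lemma hom_ext_word {M : Type*} [AddCommGroup M] [Module k M] {f g : SymAlg O →ₗ[k] M}
    (h : ∀ (m : ℕ) (G : Fin m → OGraph O), f (word G Finset.univ) = g (word G Finset.univ)) :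
    f = g := by
  refine LinearMap.ext_on span_prod_cls ?_
  rintro _ ⟨l, rfl⟩
  change f (l.map fun G => symι O G.cls).prod = g (l.map fun G => symι O G.cls).prod
  rw [prod_cls_eq_word]
  exact h _ _

/-! ### The sign of a partition -/

section Koszul

variable {ι : Type*} [LinearOrder ι]

/-- The sign of exchanging the `j`-th list with the `i`-th one, if this is needed to move the lists
with index in `I` to the front. -/
def swapSign (d : ι → ℕ) (I : Finset ι) (i j : ι) : ℤˣ :=
  if i ∈ I ∧ j ∉ I ∧ j < i then (-1) ^ (d i * d j) else 1

lemma prod_map_swapSign {V : Type*} (F : ι → List V) (I : Finset ι) {x : ι} (hx : x ∉ I)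
    (l : List ι) (hl : ∀ i ∈ l, x < i) :
    (l.map fun i => swapSign (fun i => (F i).length) I i x).prod =
      (-1) ^ (((l.filter (· ∈ I)).flatMap F).length * (F x).length) := by
  induction l with
  | nil => simp
  | cons y l ih =>
    rw [List.map_cons, List.prod_cons, ih fun i hi => hl i (List.mem_cons_of_mem _ hi)]
    by_cases hy : y ∈ I
    · rw [swapSign, if_pos ⟨hy, hx, hl y List.mem_cons_self⟩,
        List.filter_cons_of_pos (by simpa using hy), List.flatMap_cons, List.length_append,
        add_mul, pow_add]
    · rw [swapSign, if_neg fun h => hy h.1, one_mul,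
        List.filter_cons_of_neg (by simpa using hy)]

/-- The sign collects one factor for each inversion. In the inductive step a head outside `I` has to
be passed by all later lists with index in `I`; a head inside `I` is passed by none. -/
lemma sperm_filter_flatMap {V : Type*} (F : ι → List V) (I : Finset ι) (l : List ι)
    (hl : l.Pairwise (· < ·)) :
    SPerm ((l.map fun i => (l.map fun j => swapSign (fun i => (F i).length) I i j).prod).prod)
      ((l.filter (· ∈ I)).flatMap F ++ (l.filter (· ∉ I)).flatMap F) (l.flatMap F) := by
  induction l with
  | nil => exact SPerm.nil
  | cons x l ih =>
    rw [List.pairwise_cons] at hl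
    have h1 : (l.map fun j => swapSign (fun i => (F i).length) I x j).prod = 1 :=
      List.prod_eq_one fun y hy => by
        obtain ⟨j, hj, rfl⟩ := List.mem_map.1 hy
        exact if_neg fun h => (h.2.2.trans (hl.1 j hj)).false
    have h2 : swapSign (fun i => (F i).length) I x x = 1 := if_neg fun h => h.2.2.false
    simp only [List.map_cons, List.prod_cons, h1, h2, one_mul, List.prod_map_mul]
    by_cases hx : x ∈ I
    · have h3 : (l.map fun i => swapSign (fun i => (F i).length) I i x).prod = 1 :=
        List.prod_eq_one fun y hy => by
          obtain ⟨j, hj, rfl⟩ := List.mem_map.1 hy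
          exact if_neg fun h => h.2.1 hx
      rw [List.filter_cons_of_pos (by simpa using hx), List.filter_cons_of_neg (by simpa using hx),
        List.flatMap_cons, List.flatMap_cons, List.append_assoc, h3, one_mul]
      exact (ih hl.2).append_left _
    · rw [List.filter_cons_of_neg (by simpa using hx), List.filter_cons_of_pos (by simpa using hx),
        List.flatMap_cons, List.flatMap_cons, prod_map_swapSign F I hx l hl.1, ← List.append_assoc]
      refine ((SPerm.append_comm (F x) _).append_right _).trans ?_
      rw [List.append_assoc]
      exact (ih hl.2).append_left _

lemma sg_prod {ι : Type*} (s : Finset ι) (f : ι → ℤˣ) : sg k (∏ i ∈ s, f i) = ∏ i ∈ s, sg k (f i) :=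
  map_prod (⟨⟨sg k, sg_one k⟩, sg_mul k⟩ : ℤˣ →* k) f s

/-- `swapSign` is trivial unless the pair is an inversion of the partition, so the double product
over all indices reduces to that in `koszulSign`. -/
lemma sg_swapSign {m : ℕ} (G : Fin m → OGraph O) (I : Finset (Fin m)) :
    sg k ((Finset.univ.sort (· ≤ ·)).map fun i => ((Finset.univ.sort (· ≤ ·)).map fun j =>
      swapSign (fun i => (G i).ord.length) I i j).prod).prod = koszulSign G I := by
  have h : ∀ f : Fin m → ℤˣ, ((Finset.univ.sort (· ≤ ·)).map f).prod = ∏ i, f i := by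
    intro f
    rw [Finset.prod_eq_multiset_prod, ← Finset.sort_eq Finset.univ (· ≤ ·), Multiset.map_coe,
      Multiset.prod_coe]
  rw [h, sg_prod, koszulSign, ← Finset.prod_subset I.subset_univ]
  · refine Finset.prod_congr rfl fun i hi => ?_
    rw [h, sg_prod, Finset.prod_filter, ← Finset.prod_subset (Finset.subset_univ Iᶜ)]
    · refine Finset.prod_congr rfl fun j hj => ?_
      rw [OGraph.card_V, OGraph.card_V]
      by_cases hij : j < i
      · rw [swapSign, if_pos ⟨hi, Finset.mem_compl.1 hj, hij⟩, if_pos hij, sg_pow, sg_neg, sg_one]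
      · rw [swapSign, if_neg fun h => hij h.2.2, if_neg hij, sg_one]
    · intro j _ hj
      rw [swapSign, if_neg fun h => hj (Finset.mem_compl.2 h.2.1), sg_one]
  · intro i _ hi
    rw [h, sg_prod]
    exact Finset.prod_eq_one fun j _ => by rw [swapSign, if_neg fun h => hi h.1, sg_one]

end Koszul

/-! ### Splitting a family of graphs -/

/-- The members of a family are divided by a set of indices. -/
def sigmaSplit {ι : Type} [Fintype ι] [DecidableEq ι] (X : ι → Type) (I : Finset ι) :
    (Σ i : I, X i) ⊕ (Σ i : (Iᶜ : Finset ι), X i) ≃ Σ i, X i :=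
  Equiv.ofBijective (Sum.elim (fun x => ⟨x.1.1, x.2⟩) (fun x => ⟨x.1.1, x.2⟩)) (by
    constructor
    · rintro (⟨⟨i, hi⟩, x⟩ | ⟨⟨i, hi⟩, x⟩) (⟨⟨j, hj⟩, y⟩ | ⟨⟨j, hj⟩, y⟩) h
      all_goals
        obtain rfl : i = j := congrArg Sigma.fst h
        obtain rfl : x = y := eq_of_heq (Sigma.mk.inj h).2
      · rfl
      · exact absurd hi (Finset.mem_compl.1 hj)
      · exact absurd hj (Finset.mem_compl.1 hi)
      · rfl
    · rintro ⟨i, x⟩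
      by_cases hi : i ∈ I
      · exact ⟨.inl ⟨⟨i, hi⟩, x⟩, rfl⟩
      · exact ⟨.inr ⟨⟨i, Finset.mem_compl.2 hi⟩, x⟩, rfl⟩)

/-- A finite type is divided by a set and its complement. -/
def finsetSplit {ι : Type} [Fintype ι] [DecidableEq ι] (I : Finset ι) : I ⊕ (Iᶜ : Finset ι) ≃ ι :=
  Equiv.ofBijective (Sum.elim Subtype.val Subtype.val) (by
    constructor
    · rintro (⟨i, hi⟩ | ⟨i, hi⟩) (⟨j, hj⟩ | ⟨j, hj⟩) h
      all_goals
        obtain rfl : i = j := h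
      · rfl
      · exact absurd hi (Finset.mem_compl.1 hj)
      · exact absurd hj (Finset.mem_compl.1 hi)
      · rfl
    · intro i
      by_cases hi : i ∈ I
      · exact ⟨.inl ⟨i, hi⟩, rfl⟩
      · exact ⟨.inr ⟨i, Finset.mem_compl.2 hi⟩, rfl⟩)

namespace BGraph

open OGraph

section

variable {m : ℕ} (G : Fin m → OGraph O) (I : Finset (Fin m))

lemma map_union_ord : (OGraph.union fun i : I => G i).ord.map
    (fun v => (⟨v.1.1, v.2⟩ : Σ i, (G i).V)) =
      (I.sort (· ≤ ·)).flatMap fun i => (G i).ord.map (Sigma.mk i) := by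
  rw [← map_val_sort_univ I, List.flatMap_map]
  refine (List.map_flatMap ..).trans (congrArg (List.flatMap · _) (funext fun i => ?_))
  exact List.map_map

/-- The disjoint union of a family, divided by a set of indices. -/
lemma exists_iso_split : ∃ (s : ℤˣ) (e : Iso ((union fun i : I => G i).sum
    (union fun i : (Iᶜ : Finset (Fin m)) => G i)) (union G) s),
    sg k s = koszulSign G I ∧ ∀ (i : I) (x : (G i).H),
      e.onH (.inl ⟨i, x⟩ : (Σ i : I, (G i).H) ⊕ (Σ i : (Iᶜ : Finset (Fin m)), (G i).H)) =
        (⟨i.1, x⟩ : Σ i, (G i).H) := by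
  let σ : Sim ((OGraph.union fun i : I => G i).sum
      (OGraph.union fun i : (Iᶜ : Finset (Fin m)) => G i)) (OGraph.union G) :=
    Sim.ofSum (G := OGraph.union fun i : I => G i)
      (G' := OGraph.union fun i : (Iᶜ : Finset (Fin m)) => G i) (G'' := OGraph.union G)
      (sigmaSplit (fun i => (G i).V) I) (sigmaSplit (fun i => (G i).H) I)
      (fun _ => rfl) (fun _ => rfl)
      (fun v S _ j p h => by
        obtain ⟨σ, rfl, hp⟩ := (lab_union_label (G := fun i : I => G i) v.1 v.2).exists_equiv h
        have h1 := lab_union_label (G := G) v.1.1 v.2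
        rw [hp] at h1
        exact (lab_map σ).1 h1)
      (fun v S _ j p h => by
        obtain ⟨σ, rfl, hp⟩ := (lab_union_label
          (G := fun i : (Iᶜ : Finset (Fin m)) => G i) v.1 v.2).exists_equiv h
        have h1 := lab_union_label (G := G) v.1.1 v.2
        rw [hp] at h1
        exact (lab_map σ).1 h1)
  refine ⟨_, { toSim := σ, inv := ?_, tail := ?_, onB := finsetSplit I, blk := ?_, ord := ?_ },
    sg_swapSign G I, fun i x => rfl⟩
  · rintro (x | x) <;> rfl
  · rintro (x | x) <;> rfl
  · rintro (x | x) <;> rfl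
  · have h := sperm_filter_flatMap (fun i => (G i).ord.map (Sigma.mk i)) I
      (Finset.univ.sort (· ≤ ·)) (pairwise_lt_sort _)
    rw [← sort_eq_filter I (· ∈ I) fun _ => Iff.rfl,
      ← sort_eq_filter Iᶜ (· ∉ I) fun _ => Finset.mem_compl, ← map_union_ord G I,
      ← map_union_ord G Iᶜ] at h
    simp only [List.length_map] at h
    refine ((SPerm.of_eq (map_sum_ord (OGraph.union fun i : I => G i)
      (OGraph.union fun i : (Iᶜ : Finset (Fin m)) => G i) _)).trans h).cast (one_mul _)

end

end BGraph

/-! ### The fusion operation on the symmetric algebra -/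

open BGraph

/-- A tuple of half-edges in members of a subfamily as a tuple in the whole family. -/
def extendTuple {m n : ℕ} (G : Fin m → OGraph O) (I : Finset (Fin m))
    (h : Fin n → Σ i : I, (G i).H) : Fin n → Σ i, (G i).H :=
  fun l => ⟨(h l).1.1, (h l).2⟩

lemma extendTuple_injective {m n : ℕ} (G : Fin m → OGraph O) (I : Finset (Fin m)) :
    Function.Injective (extendTuple (n := n) G I) := fun h h' e => funext fun l => by
  have h1 : ∀ x y : Σ i : I, (G i).H,
      (⟨x.1.1, x.2⟩ : Σ i, (G i).H) = ⟨y.1.1, y.2⟩ → x = y := by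
    rintro ⟨⟨i, hi⟩, x⟩ ⟨⟨j, hj⟩, y⟩ e
    obtain rfl : i = j := congrArg Sigma.fst e
    obtain rfl : x = y := eq_of_heq (Sigma.mk.inj e).2
    rfl
  exact h1 _ _ (congrFun e l)

/-- Splitting the union along `I` contributes the sign of the partition; `fterm_sum` then separates
the fused graph from the remaining factors. -/
lemma toSym_fterm_extendTuple {m n : ℕ} [NeZero n] (G : Fin m → OGraph O) (I : Finset (Fin m))
    (hI : I.card = n) (h : Fin n → Σ i : I, (G i).H)
    (hh : Function.Injective fun l => (h l).1) :
    toSym O ((BGraph.union G).fterm (extendTuple G I h)) = koszulSign G I •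
      (symι O (((OGraph.union fun i : I => G i).glue h).contractClass
        ((OGraph.union fun i : I => G i).cyc h (h 0))) * word G Iᶜ) := by
  obtain ⟨s, e, hs, he⟩ := exists_iso_split G I
  -- As `I` has exactly `n` members, edges in `n` different members meet all of them.
  have hsurj : Function.Surjective fun l => (h l).1 :=
    ((Fintype.bijective_iff_injective_and_card _).2 ⟨hh, by simp [hI]⟩).2
  have hinl : Function.Injective fun l => (.inl (h l) :
      (Σ i : I, (G i).H) ⊕ (Σ i : (Iᶜ : Finset (Fin m)), (G i).H)) :=
    Sum.inl_injective.comp fun l l' e => hh (congrArg Sigma.fst e)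
  have h1 := fterm_iso e hinl
  have h2 := fterm_sum (BGraph.union fun i : I => G i)
    (BGraph.union fun i : (Iᶜ : Finset (Fin m)) => G i) (h := h) hh hsurj
  have h3 : (BGraph.union G).fterm (extendTuple G I h) = _ :=
    (congrArg (BGraph.union G).fterm (funext fun l => (he (h l).1 (h l).2).symm)).trans
      (h1.trans (congrArg (sg k s • ·) h2))
  rw [h3, map_smul, toSym_blockMul, hs, toSym_union_restrict]
  rfl

/-- The fusion operation on the symmetric algebra. -/
def symFusion (O : CyclicOperad.{u, v} k) (n : ℕ) [NeZero n] : Module.End k (SymAlg O) :=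
  toSym O ∘ₗ fusion O n ∘ₗ fromSym O

/-- The inner `fromSym ∘ toSym` is the identity, so identities between composites may be proved on
blocked graphs. -/
lemma symFusion_comp (i j : ℕ) [NeZero i] [NeZero j] :
    symFusion O i ∘ₗ symFusion O j = toSym O ∘ₗ (fusion O i ∘ₗ fusion O j) ∘ₗ fromSym O := by
  refine LinearMap.ext fun x => ?_
  change toSym O (fusion O i (fromSym O (toSym O (fusion O j (fromSym O x))))) = _
  rw [fromSym_toSym]
  rfl

lemma symFusion_comp_self (i : ℕ) [NeZero i] : symFusion O i ∘ₗ symFusion O i = 0 := by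
  rw [symFusion_comp, fusion_comp_self, LinearMap.zero_comp, LinearMap.comp_zero]

lemma symFusion_anticomm (i j : ℕ) [NeZero i] [NeZero j] :
    symFusion O i ∘ₗ symFusion O j + symFusion O j ∘ₗ symFusion O i = 0 := by
  rw [symFusion_comp, symFusion_comp, ← LinearMap.comp_add, ← LinearMap.add_comp,
    fusion_anticomm, LinearMap.zero_comp, LinearMap.comp_zero]

lemma isFusion_symFusion (n : ℕ) [NeZero n] : IsFusion n (symFusion O n) := by
  intro m G
  have h1 : symFusion O n (word G Finset.univ) = ∑ h : Fin n → Σ i, (G i).H with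
      Function.Injective fun l => (h l).1, toSym O ((BGraph.union G).fterm h) := by
    rw [← toSym_union_fin]
    change toSym O (fusion O n (fromSym O (toSym O _))) = _
    rw [fromSym_toSym, fusion_cls, map_sum]
    exact Finset.sum_congr (Finset.ext fun h =>
      ⟨fun hh => Finset.mem_filter.2 ⟨Finset.mem_univ _, (Finset.mem_filter.1 hh).2⟩,
        fun hh => Finset.mem_filter.2 ⟨Finset.mem_univ _, (Finset.mem_filter.1 hh).2⟩⟩)
      fun _ _ => rfl
  -- The tuples are grouped by the set `I` of graphs that they meet, which has `n` elements because
  -- these graphs are different.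
  rw [h1, ← Finset.sum_fiberwise_of_maps_to (t := Finset.powersetCard n Finset.univ)
    (g := fun h => Finset.univ.image fun l => (h l).1)]
  · refine Finset.sum_congr rfl fun I hI => ?_
    have hc := (Finset.mem_powersetCard.1 hI).2
    rw [OGraph.fuse, map_sum, Finset.sum_mul, Finset.smul_sum]
    refine (Finset.sum_bij (fun h _ => extendTuple G I h) ?_ ?_ ?_ ?_).symm
    · intro h hh
      have hh' : Function.Injective fun l => (h l).1 := (Finset.mem_filter.1 hh).2
      have hv : Function.Injective fun l => (h l).1.1 := Subtype.val_injective.comp hh'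
      refine Finset.mem_filter.2 ⟨Finset.mem_filter.2 ⟨Finset.mem_univ _, hv⟩, ?_⟩
      refine Finset.eq_of_subset_of_card_le (fun i hi => ?_) ?_
      · obtain ⟨l, -, rfl⟩ := Finset.mem_image.1 hi
        exact (h l).1.2
      · refine (Eq.trans (Finset.card_image_of_injective _ hv) ?_).ge
        rw [hc, Finset.card_univ, Fintype.card_fin]
    · exact fun h _ h' _ hh => extendTuple_injective G I hh
    · intro h hh
      obtain ⟨hh1, hh2⟩ := Finset.mem_filter.1 hh
      have hm : ∀ l, (h l).1 ∈ I := fun l => hh2 ▸ Finset.mem_image_of_mem _ (Finset.mem_univ l)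
      refine ⟨fun l => ⟨⟨(h l).1, hm l⟩, (h l).2⟩, ?_, rfl⟩
      refine Finset.mem_filter.2 ⟨Finset.mem_univ _, fun l l' e => ?_⟩
      exact (Finset.mem_filter.1 hh1).2 (congrArg Subtype.val e)
    · intro h hh
      exact (toSym_fterm_extendTuple G I hc h (Finset.mem_filter.1 hh).2).symm
  · intro h hh
    refine Finset.mem_powersetCard.2 ⟨Finset.subset_univ _, ?_⟩
    rw [Finset.card_image_of_injective _ (Finset.mem_filter.1 hh).2, Finset.card_univ,
      Fintype.card_fin]

lemma IsFusion.unique {n : ℕ} [NeZero n] {φ ψ : Module.End k (SymAlg O)} (hφ : IsFusion n φ)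
    (hψ : IsFusion n ψ) : ψ = φ :=
  hom_ext_word fun m G => (hψ m G).trans (hφ m G).symm

end Fusion

end

theorem theorem1 {k : Type u} [Field k] (O : Fusion.CyclicOperad.{u, v} k) :
    ∃ φ : ℕ → Module.End k (Fusion.SymAlg O),
      (∀ (n : ℕ) [NeZero n], Fusion.IsFusion n (φ n) ∧
        ∀ ψ : Module.End k (Fusion.SymAlg O), Fusion.IsFusion n ψ → ψ = φ n) ∧
      (∀ i : ℕ, 1 ≤ i → φ i ∘ₗ φ i = 0) ∧
      (∀ i j : ℕ, 1 ≤ i → 1 ≤ j → i ≠ j → φ i ∘ₗ φ j + φ j ∘ₗ φ i = 0) := by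
  classical
  -- The value at 0 is arbitrary, since the assertions concern positive indices only.
  let φ : ℕ → Module.End k (Fusion.SymAlg O) := fun n =>
    if h : n ≠ 0 then haveI : NeZero n := ⟨h⟩; Fusion.symFusion O n else 0
  have hφ : ∀ (n : ℕ) [NeZero n], φ n = Fusion.symFusion O n := fun n _ => dif_pos (NeZero.ne n)
  refine ⟨φ, fun n _ => ?_, fun i hi => ?_, fun i j hi hj _ => ?_⟩
  · rw [hφ n]
    exact ⟨Fusion.isFusion_symFusion n, fun ψ h => (Fusion.isFusion_symFusion n).unique h⟩
  · have : NeZero i := ⟨by omega⟩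
    rw [hφ i]
    exact Fusion.symFusion_comp_self i
  · have : NeZero i := ⟨by omega⟩
    have : NeZero j := ⟨by omega⟩
    rw [hφ i, hφ j]
    exact Fusion.symFusion_anticomm i j
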